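/- **Setting.** A *linear network* with $p$ inputs and $q$ outputs is a finite directed acyclic (multi)graph whose edges carry real constants (weights). Its $p$ input vertices are exactly the vertices without incoming edges, its $q$ output vertices are exactly the vertices without outgoing edges, and no vertex is both. An input vertex carries its input; every other vertex carries the sum, over its incoming edges, of the weight times the number carried by the source. The number of *multiplications* is the number of edges of weight $\neq\pm1$, the number of *additions* is $\sum_v(\mathrm{indegree}(v)-1)$ over the non-input vertices $v$, and the number of *flops* is their sum. The *transposed network* arises by reversing all edges and interchanging inputs and outputs. "Flipping the sign" of an input (output) means negating the weights of the edges that leave the input vertex (enter the output vertex). For $N\ge 1$ the transforms are $$C_k=2\sum_{n=0}^{N-1}x_n\cos\left[\tfrac{\pi}{N}\left(n+\tfrac12\right)k\right]\ (0\le k<N)\quad\text{(DCT-II)},\qquad C^{\mathrm T}_k=2\sum_{n=0}^{N-1}x_n\cos\left[\tfrac{\pi}{N}n\left(k+\tfrac12\right)\right]\ (0\le k<N)\quad\text{(DCT-III)},$$ $$S_k=2\sum_{n=0}^{N-1}x_n\sin\left[\tfrac{\pi}{N}\left(n+\tfrac12\right)k\right]\ (1\le k\le N)\quad\text{(DST-II)},\qquad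 S^{\mathrm T}_k=2\sum_{n=1}^{N}x_n\sin\left[\tfrac{\pi}{N}n\left(k+\tfrac12\right)\right]\ (0\le k<N)\quad\text{(DST-III)}.$$ In the *unitary* normalization the factor $2$ is replaced by $\sqrt{(2-\delta_{k,0})/N}$ (DCT-II), $\sqrt{(2-\delta_{k,N})/N}$ (DST-II), and by $\sqrt{(2-\delta_{n,0})/N}$, $\sqrt{(2-\delta_{n,N})/N}$ in the $n$-th term of the DCT-III, DST-III. **Claims.** 1. *Network transposition.* For every linear network $G$ and every matrix $A$, the transposed network computes $A^{\mathsf T}$ if and only if $G$ computes $A$. It has the same number of multiplications and, if $G$ has as many inputs as outputs, the same number of additions. 2. *Relations.* For every $N$, in both normalizations, the DCT-III and DST-III matrices are the transposes of the DCT-II and DST-II matrices. Moreover (with the factor $2$) $$S_{N-k}=2\sum_{n=0}^{N-1}(-1)^nx_n\cos\left[\tfrac{\pi}{N}\left(n+\tfrac12\right)k\right],\qquad S^{\mathrm T}_k=(-1)^k\,2\sum_{n=0}^{N-1}x_{N-n}\cos\left[\tfrac{\pi}{N}n\left(k+\tfrac12\right)\right]\qquad(0\le k<N).$$ 3. *Any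 algorithm transfers.* For every $N$, in both normalizations, and for every network $G$ with $N$ inputs and $N$ outputs: $G$ computes the DCT-II iff its transpose computes the DCT-III; $G$ computes the DCT-II iff $G$ with its outputs reversed and the sign of every other input ($x_1,x_3,\dots$) flipped computes the DST-II; $G$ computes the DST-II iff its transpose computes the DST-III; $G$ computes the DCT-III iff $G$ with its inputs reversed and the sign of every other output (numbers $1,3,\dots$) flipped computes the DST-III. Each of these constructions preserves the number of additions and the number of multiplications. 4. *The new DCT-II and DCT-III algorithms.* Let $N=2^m>1$, $\omega_M=e^{-2\pi i/M}$, and let $s_{N,k}$ be defined by $s_{N,k}=1$ for $N\le4$ and otherwise, with $k_4=k\bmod\frac N4$, by $s_{N,k}=s_{N/4,k_4}\cos(2\pi k_4/N)$ if $k_4\le N/8$ and $s_{N,k}=s_{N/4,k_4}\sin(2\pi k_4/N)$ if not. Let $R$ be any network that computes the scaled DFT $Z_k=s_{N,k}^{-1}\sum_{n}\tilde y_n\omega_N^{nk}$, $0\le k\le N/2$, of $N$ real numbers $\tilde y_n$; its $N$ real outputs are $Z_0$, $Z_{N/2}$ and $\Re Z_k$, $\Im Z_k$ for $0<k<N/2$.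 - *DCT-II:* put $\tilde y_n=x_{2n}$, $\tilde y_{N-1-n}=x_{2n+1}$ ($0\le n<N/2$), apply $R$, and put $C_0=2Z_0$, $C_{N/2}=\sqrt2\,Z_{N/2}$, $C_k=2\Re(\omega_{4N}^ks_{N,k}Z_k)$, $C_{N-k}=-2\Im(\omega_{4N}^ks_{N,k}Z_k)$ ($0<k<N/2$). - *DCT-III:* put $Z_0=2x_0$, $Z_{N/2}=\sqrt2\,x_{N/2}$, $Z_n=2\omega_{4N}^{-n}s_{N,n}(x_n-i\,x_{N-n})$ ($0<n<N/2$), apply the transpose of $R$ to obtain $\tilde y$, and put $C^{\mathrm T}_{2k}=\tilde y_k$, $C^{\mathrm T}_{2k+1}=\tilde y_{N-1-k}$ ($0\le k<N/2$). These networks compute the (unnormalized) DCT-II and DCT-III, and they have the same number of additions and the same number of multiplications. 5. *Flop count.* Let $N=2^m>1$ and $$F(N)=\tfrac{17}{9}N\log_2N-\tfrac{17}{27}N-\tfrac19(-1)^{\log_2N}\log_2N+\tfrac{7}{54}(-1)^{\log_2N}+\tfrac32 .$$ There is a network $R$ for which both algorithms of part 4 take exactly $F(N)$ flops. In each of the two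 normalizations there is a network $G$ that computes the DCT-II with exactly $F(N)$ flops such that the networks derived from it as in part 3 (the transpose of $G$ for the DCT-III; $G$ with reversed outputs and flipped inputs for the DST-II; for the DST-III either the transpose of the latter, or the transpose of $G$ with reversed inputs and flipped outputs) compute the DCT-III, the DST-II and the DST-III with exactly $F(N)$ flops. -/

import Mathlib

open Finset Matrix

/-! ### Linear networks -/

/-- A linear network with `p` inputs and `q` outputs: a finite directed acyclic (multi)graph whose
edges carry real multiplicative constants and whose vertices add up their incoming edges.
The input vertices are exactly the vertices without incoming edges, the output vertices are exactly
the vertices without outgoing edges (so no vertex is dead), and no vertex is both. -/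
structure LinearNetwork (p q : ℕ) where
  V : Type
  E : Type
  [fintypeV : Fintype V]
  [fintypeE : Fintype E]
  src : E → V
  tgt : E → V
  weight : E → ℝ
  inp : Fin p → V
  out : Fin q → V
  inp_injective : Function.Injective inp
  out_injective : Function.Injective out
  inp_iff : ∀ v, (∃ i, inp i = v) ↔ ∀ e, tgt e ≠ v
  out_iff : ∀ v, (∃ j, out j = v) ↔ ∀ e, src e ≠ v
  inp_ne_out : ∀ i j, inp i ≠ out j
  /-- acyclicity: the vertices can be numbered such that every edge goes upwards -/
  acyclic : ∃ rank : V → ℕ, ∀ e, rank (src e) < rank (tgt e)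

attribute [instance] LinearNetwork.fintypeV LinearNetwork.fintypeE

namespace LinearNetwork

variable {p q r N : ℕ}

open scoped Classical in
/-- The number carried by the vertex `v` when the network is fed with the input vector `x`: an input
vertex carries its input (it has no incoming edges), every other vertex carries the sum over its
incoming edges of the weight times the number carried by the source (it is fed no input). -/
noncomputable def value (G : LinearNetwork p q) (x : Fin p → ℝ) (v : G.V) : ℝ :=
  (∑ i : {i : Fin p // G.inp i = v}, x i.1) +
    ∑ e : {e : G.E // G.tgt e = v}, G.weight e.1 * G.value x (G.src e.1)
termination_by G.acyclic.choose v
decreasing_by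
  have h := G.acyclic.choose_spec e.1
  rwa [e.2] at h

/-- An input vertex carries its input. -/
theorem value_inp (G : LinearNetwork p q) (x : Fin p → ℝ) (i : Fin p) :
    G.value x (G.inp i) = x i := by
  classical
  rw [value]
  have h1 : IsEmpty {e : G.E // G.tgt e = G.inp i} :=
    ⟨fun e => (G.inp_iff (G.inp i)).1 ⟨i, rfl⟩ e.1 e.2⟩
  rw [Finset.univ_eq_empty_iff.2 h1, Finset.sum_empty, add_zero,
    Fintype.sum_eq_single (⟨i, rfl⟩ : {k : Fin p // G.inp k = G.inp i})]
  intro k hk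
  exact absurd (Subtype.ext (G.inp_injective k.2)) hk

open scoped Classical in
/-- Any other vertex carries the weighted sum over its incoming edges. -/
theorem value_of_not_inp (G : LinearNetwork p q) (x : Fin p → ℝ) (v : G.V)
    (hv : ∀ i, G.inp i ≠ v) :
    G.value x v = ∑ e : {e : G.E // G.tgt e = v}, G.weight e.1 * G.value x (G.src e.1) := by
  rw [value]
  have h1 : IsEmpty {i : Fin p // G.inp i = v} := ⟨fun i => hv i.1 i.2⟩
  rw [Finset.univ_eq_empty_iff.2 h1, Finset.sum_empty, zero_add]

/-- The output vector for the input vector `x`. -/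
noncomputable def eval (G : LinearNetwork p q) (x : Fin p → ℝ) : Fin q → ℝ :=
  fun j => G.value x (G.out j)

/-- The network computes the linear transform with matrix `A`. -/
def Computes (G : LinearNetwork p q) (A : Matrix (Fin q) (Fin p) ℝ) : Prop :=
  ∀ x : Fin p → ℝ, G.eval x = A *ᵥ x

open scoped Classical in
/-- Number of real multiplications: edges with weight different from `1` and `-1`. -/
noncomputable def numMul (G : LinearNetwork p q) : ℕ :=
  (univ.filter fun e : G.E => G.weight e ≠ 1 ∧ G.weight e ≠ -1).card

open scoped Classical in
/-- Number of real additions (and subtractions): `indegree - 1` at every vertex that is not an input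
vertex; the indegree of such a vertex is at least `1`. -/
noncomputable def numAdd (G : LinearNetwork p q) : ℕ :=
  ∑ v ∈ univ.filter fun v : G.V => ∀ i, G.inp i ≠ v,
    ((univ.filter fun e : G.E => G.tgt e = v).card - 1)

/-- Number of flops: real additions plus real multiplications. -/
noncomputable def flops (G : LinearNetwork p q) : ℕ := G.numAdd + G.numMul

/-- Network transposition: all edges are reversed, inputs and outputs are interchanged. -/
def transpose (G : LinearNetwork p q) : LinearNetwork q p where
  V := G.V
  E := G.E
  src := G.tgt
  tgt := G.src
  weight := G.weight
  inp := G.out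
  out := G.inp
  inp_injective := G.out_injective
  out_injective := G.inp_injective
  inp_iff := G.out_iff
  out_iff := G.inp_iff
  inp_ne_out := fun i j h => G.inp_ne_out j i h.symm
  acyclic := by
    obtain ⟨rank, h⟩ := G.acyclic
    refine ⟨fun v => (∑ w, rank w) - rank v, fun e => ?_⟩
    have h1 := h e
    have h2 : rank (G.tgt e) ≤ ∑ w, rank w :=
      Finset.single_le_sum (f := rank) (fun _ _ => Nat.zero_le _) (mem_univ _)
    show (∑ w, rank w) - rank (G.tgt e) < (∑ w, rank w) - rank (G.src e)
    omega

/-- Renaming of the inputs: input `i` of the new network enters at input `σ i` of the old one. -/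
def permuteInputs (G : LinearNetwork p q) (σ : Equiv.Perm (Fin p)) : LinearNetwork p q where
  V := G.V
  E := G.E
  src := G.src
  tgt := G.tgt
  weight := G.weight
  inp := fun i => G.inp (σ i)
  out := G.out
  inp_injective := G.inp_injective.comp σ.injective
  out_injective := G.out_injective
  inp_iff := fun v => by
    rw [← G.inp_iff v]
    exact ⟨fun ⟨i, h⟩ => ⟨σ i, h⟩, fun ⟨i, h⟩ => ⟨σ.symm i, by simpa using h⟩⟩
  out_iff := G.out_iff
  inp_ne_out := fun i j => G.inp_ne_out (σ i) j
  acyclic := G.acyclic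

/-- Renaming of the outputs: output `j` of the new network is output `σ j` of the old one. -/
def permuteOutputs (G : LinearNetwork p q) (σ : Equiv.Perm (Fin q)) : LinearNetwork p q where
  V := G.V
  E := G.E
  src := G.src
  tgt := G.tgt
  weight := G.weight
  inp := G.inp
  out := fun j => G.out (σ j)
  inp_injective := G.inp_injective
  out_injective := G.out_injective.comp σ.injective
  inp_iff := G.inp_iff
  out_iff := fun v => by
    rw [← G.out_iff v]
    exact ⟨fun ⟨i, h⟩ => ⟨σ i, h⟩, fun ⟨i, h⟩ => ⟨σ.symm i, by simpa using h⟩⟩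
  inp_ne_out := fun i j => G.inp_ne_out i (σ j)
  acyclic := G.acyclic

/-- The inputs in reverse order. -/
def reverseInputs (G : LinearNetwork p q) : LinearNetwork p q := G.permuteInputs Fin.revPerm

/-- The outputs in reverse order. -/
def reverseOutputs (G : LinearNetwork p q) : LinearNetwork p q := G.permuteOutputs Fin.revPerm

open scoped Classical in
/-- Every other input (those with an odd number, counted from `0`) is multiplied by `-1`; the sign
is absorbed into the weights of the edges that leave the input vertex. -/
noncomputable def flipOddInputs (G : LinearNetwork p q) : LinearNetwork p q :=
  { G with
    weight := fun e =>
      if ∃ i : Fin p, Odd (i : ℕ) ∧ G.src e = G.inp i then - G.weight e else G.weight e }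

open scoped Classical in
/-- Every other output (those with an odd number, counted from `0`) is multiplied by `-1`; the sign
is absorbed into the weights of the edges that enter the output vertex. -/
noncomputable def flipOddOutputs (G : LinearNetwork p q) : LinearNetwork p q :=
  { G with
    weight := fun e =>
      if ∃ j : Fin q, Odd (j : ℕ) ∧ G.tgt e = G.out j then - G.weight e else G.weight e }

/-- Serial composition: first `G`, then `H`. Output `j` of `G` is wired to input `j` of `H` by an
edge of weight `1`, which costs nothing. -/
def andThen (G : LinearNetwork p q) (H : LinearNetwork q r) : LinearNetwork p r where
  V := G.V ⊕ H.V
  E := (G.E ⊕ H.E) ⊕ Fin q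
  src := Sum.elim (Sum.map G.src H.src) (fun j => Sum.inl (G.out j))
  tgt := Sum.elim (Sum.map G.tgt H.tgt) (fun j => Sum.inr (H.inp j))
  weight := Sum.elim (Sum.elim G.weight H.weight) (fun _ => 1)
  inp := fun i => Sum.inl (G.inp i)
  out := fun j => Sum.inr (H.out j)
  inp_injective := Sum.inl_injective.comp G.inp_injective
  out_injective := Sum.inr_injective.comp H.out_injective
  inp_iff := by
    rintro (v | v)
    · simpa using G.inp_iff v
    · have h := H.inp_iff v
      simp only [reduceCtorEq, exists_false, false_iff, Sum.forall, Sum.elim_inl, Sum.elim_inr,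
        Sum.map_inl, Sum.map_inr, ne_eq, not_and, Sum.inr.injEq, not_false_eq_true, implies_true,
        true_and]
      intro h1 h2
      obtain ⟨i, hi⟩ := h.2 h1
      exact h2 i hi
  out_iff := by
    rintro (v | v)
    · have h := G.out_iff v
      simp only [reduceCtorEq, exists_false, false_iff, Sum.forall, Sum.elim_inl, Sum.elim_inr,
        Sum.map_inl, Sum.map_inr, ne_eq, not_and, Sum.inl.injEq, not_false_eq_true, implies_true,
        and_true]
      intro h1 h2
      obtain ⟨i, hi⟩ := h.2 h1
      exact h2 i hi
    · simpa using H.out_iff v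
  inp_ne_out := by simp
  acyclic := by
    obtain ⟨rG, hG⟩ := G.acyclic
    obtain ⟨rH, hH⟩ := H.acyclic
    refine ⟨Sum.elim rG (fun v => (∑ w, rG w) + 1 + rH v), ?_⟩
    rintro ((e | e) | j)
    · simpa using hG e
    · simpa using hH e
    · have h2 : rG (G.out j) ≤ ∑ w, rG w :=
        Finset.single_le_sum (f := rG) (fun _ _ => Nat.zero_le _) (mem_univ _)
      simp only [Sum.elim_inr, Sum.elim_inl]
      omega

/-- The one-stage network in which output `k` is `W k j` times input `j`, added up over those `j`
with `j = k` or `j + k = N` (one or two values of `j`). -/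
def rotations (N : ℕ) (W : Fin N → Fin N → ℝ) : LinearNetwork N N where
  V := Fin N ⊕ Fin N
  E := {e : Fin N × Fin N // e.1 = e.2 ∨ (e.1 : ℕ) + e.2 = N}
  src := fun e => Sum.inl e.1.2
  tgt := fun e => Sum.inr e.1.1
  weight := fun e => W e.1.1 e.1.2
  inp := Sum.inl
  out := Sum.inr
  inp_injective := Sum.inl_injective
  out_injective := Sum.inr_injective
  inp_iff := by
    rintro (v | v)
    · simp
    · simp only [reduceCtorEq, exists_false, false_iff, not_forall, ne_eq, not_not]
      exact ⟨⟨(v, v), Or.inl rfl⟩, rfl⟩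
  out_iff := by
    rintro (v | v)
    · simp only [reduceCtorEq, exists_false, false_iff, not_forall, ne_eq, not_not]
      exact ⟨⟨(v, v), Or.inl rfl⟩, rfl⟩
    · simp
  inp_ne_out := by simp
  acyclic := ⟨Sum.elim (fun _ => 0) (fun _ => 1), by simp⟩

end LinearNetwork

/-! ### The trigonometric transforms of size `N` -/

/-- The two normalizations: the factor `2`, or the orthogonal (unitary) one. -/
inductive Normalization
  | unnormalized
  | unitary

/-- The factor in front of the terms with frequency `k`: either `2`, or `√((2 - δ_{k,k₀}) / N)`. -/
noncomputable def Normalization.factor (ν : Normalization) (N k k₀ : ℕ) : ℝ :=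
  match ν with
  | .unnormalized => 2
  | .unitary => √((2 - if k = k₀ then 1 else 0) / N)

/-- DCT-II, inputs `x_0, …, x_{N-1}` and outputs `C_0, …, C_{N-1}`. -/
noncomputable def dctII (ν : Normalization) (N : ℕ) : Matrix (Fin N) (Fin N) ℝ :=
  Matrix.of fun k n => ν.factor N k 0 * Real.cos (Real.pi / N * ((n : ℝ) + 1 / 2) * (k : ℝ))

/-- DCT-III, inputs `x_0, …, x_{N-1}` and outputs `C_0, …, C_{N-1}`. -/
noncomputable def dctIII (ν : Normalization) (N : ℕ) : Matrix (Fin N) (Fin N) ℝ :=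
  Matrix.of fun k n => ν.factor N n 0 * Real.cos (Real.pi / N * (n : ℝ) * ((k : ℝ) + 1 / 2))

/-- DST-II, inputs `x_0, …, x_{N-1}` and outputs `S_1, …, S_N`; `S_{k+1}` has the index `k`. -/
noncomputable def dstII (ν : Normalization) (N : ℕ) : Matrix (Fin N) (Fin N) ℝ :=
  Matrix.of fun k n =>
    ν.factor N (k + 1) N * Real.sin (Real.pi / N * ((n : ℝ) + 1 / 2) * ((k : ℝ) + 1))

/-- DST-III, inputs `x_1, …, x_N` and outputs `S_0, …, S_{N-1}`; `x_{n+1}` has the index `n`. -/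
noncomputable def dstIII (ν : Normalization) (N : ℕ) : Matrix (Fin N) (Fin N) ℝ :=
  Matrix.of fun k n =>
    ν.factor N (n + 1) N * Real.sin (Real.pi / N * ((n : ℝ) + 1) * ((k : ℝ) + 1 / 2))

/-- The flop count of the new DCT-II of size `N = 2 ^ m` (so that `log₂ N = m`). -/
noncomputable def newDCTFlops (m : ℕ) : ℝ :=
  17 / 9 * 2 ^ m * m - 17 / 27 * 2 ^ m - 1 / 9 * (-1) ^ m * m + 7 / 54 * (-1) ^ m + 3 / 2

/-! ### The new DCT-II and DCT-III algorithms -/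

/-- `ω_M ^ j` with `ω_M = exp (-2πi/M)`. -/
noncomputable def rootPow (M : ℕ) (j : ℤ) : ℂ :=
  Complex.exp (-(2 * Real.pi * Complex.I / M) * j)

/-- The scale factor `s_{N,k}` of the new FFT. -/
noncomputable def fftScale (N k : ℕ) : ℝ :=
  if N ≤ 4 then 1
  else if 8 * (k % (N / 4)) ≤ N then
    fftScale (N / 4) (k % (N / 4)) * Real.cos (2 * Real.pi * ((k % (N / 4) : ℕ) : ℝ) / N)
  else
    fftScale (N / 4) (k % (N / 4)) * Real.sin (2 * Real.pi * ((k % (N / 4) : ℕ) : ℝ) / N)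
termination_by N

/-- The DFT of `N` real numbers `y_n`, scaled by `1 / s_{N,k}`: the numbers
`Z_k = s_{N,k}⁻¹ ∑ n, y_n ω_N ^ (n k)` for `0 ≤ k ≤ N/2` (the others are their conjugates), for even
`N`. They are stored as `N` real numbers: position `k ≤ N/2` holds `Re Z_k` and position `N - k` with
`0 < k < N/2` holds `Im Z_k`; here `Z_0` and `Z_{N/2}` are real. -/
noncomputable def scaledRealDFT (N : ℕ) : Matrix (Fin N) (Fin N) ℝ :=
  Matrix.of fun j n =>
    if 2 * (j : ℕ) ≤ N then (rootPow N ((n : ℤ) * (j : ℤ))).re / fftScale N j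
    else (rootPow N ((n : ℤ) * ((N - (j : ℕ) : ℕ) : ℤ))).im / fftScale N (N - j)

/-- Position of the DCT data in the DFT data: `2 n ↦ n` and `2 n + 1 ↦ N - 1 - n`. -/
noncomputable def evenOddPerm (N : ℕ) : Equiv.Perm (Fin N) :=
  Equiv.ofBijective
    (fun i => if (i : ℕ) % 2 = 0 then ⟨(i : ℕ) / 2, by omega⟩ else ⟨N - 1 - (i : ℕ) / 2, by omega⟩)
    (Finite.injective_iff_bijective.1 (by
      intro a b h
      have ha := a.2
      have hb := b.2
      rw [Fin.ext_iff] at h ⊢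
      dsimp only at h
      split_ifs at h <;> simp only at h <;> omega))

/-- Coefficients of the last stage of the new DCT-II, applied to the stored `Z_k`:
`C_0 = 2 Z_0`, `C_{N/2} = √2 Z_{N/2}`, and for `0 < k < N/2`, with `c_k = 2 ω_{4N}^k s_{N,k}`,
`C_k = Re (c_k Z_k)`, `C_{N-k} = - Im (c_k Z_k)`. -/
noncomputable def dctIICoeff (N : ℕ) (k j : Fin N) : ℝ :=
  let c : ℕ → ℂ := fun l => 2 * rootPow (4 * N) (l : ℤ) * fftScale N l
  if (k : ℕ) = 0 then 2
  else if 2 * (k : ℕ) = N then √2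
  else if 2 * (k : ℕ) < N then
    if j = k then (c k).re else - (c k).im
  else
    if j = k then - (c (N - k)).re else - (c (N - k)).im

/-- Coefficients of the first stage of the new DCT-III, producing the stored `Z_n`:
`Z_0 = 2 x_0`, `Z_{N/2} = √2 x_{N/2}`, and for `0 < n < N/2`, with `d_n = 2 ω_{4N}^{-n} s_{N,n}`,
`Z_n = d_n (x_n - i x_{N-n})`. -/
noncomputable def dctIIICoeff (N : ℕ) (j i : Fin N) : ℝ :=
  let d : ℕ → ℂ := fun l => 2 * rootPow (4 * N) (-(l : ℤ)) * fftScale N l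
  if (j : ℕ) = 0 then 2
  else if 2 * (j : ℕ) = N then √2
  else if 2 * (j : ℕ) < N then
    if i = j then (d j).re else (d j * (-Complex.I)).re
  else
    if i = j then (d (N - j) * (-Complex.I)).im else (d (N - j)).im

/-- The new DCT-II algorithm of even size `N`, with the network `R` as subroutine for the scaled
DFT of real inputs: reorder the inputs, apply `R`, multiply by the factors `2 ω_{4N}^k s_{N,k}`. -/
noncomputable def newDCTII {N : ℕ} (R : LinearNetwork N N) : LinearNetwork N N :=
  (R.permuteInputs (evenOddPerm N)).andThen (LinearNetwork.rotations N (dctIICoeff N))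

/-- The new DCT-III algorithm of even size `N`, with the transpose of the network `R` for the scaled
DFT of real inputs as subroutine: multiply the inputs by the factors `2 ω_{4N}^{-n} s_{N,n}`, apply
the transpose of `R`, reorder the outputs. -/
noncomputable def newDCTIII {N : ℕ} (R : LinearNetwork N N) : LinearNetwork N N :=
  ((LinearNetwork.rotations N (dctIIICoeff N)).andThen R.transpose).permuteOutputs (evenOddPerm N)

/-! Transposition is adjointness. Let `f` and `g` be the vertex values of a network and of its
transpose. Expanding `∑ v, f v * g v` by the equations of `f`, or by those of `g`, gives the same
sum over the edges, so the boundary terms agree: `⟨G x, y⟩ = ⟨x, Gᵀ y⟩` (`sum_eval_mul`). The number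
of additions is edges minus vertices plus inputs (`numAdd_add_card`). Only cardinalities enter, so
renamings and sign changes preserve it, and so does transposition of a network with as many inputs
as outputs.

The sine transforms differ from the cosine transforms by a quarter-period shift: reversing the
frequency turns `sin` into `cos` up to the sign `(-1) ^ n` (`dstII_rev`). With transposition,
everything reduces to the DCT-II.

The DCT-II is a permuted real DFT: after the reordering, `ω_{4N}^k ω_N^{nk}` equals
`ω_{4N}^{±(2i+1)k}`. Its real part is the cosine of frequency `k`, and minus its imaginary part is
the cosine of frequency `N - k` (`rotationMatrix_mul_scaledRealDFT`). The first stage of the new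
DCT-III is the transpose of the last stage of the new DCT-II (`dctIIICoeff_swap`), which makes the
whole algorithm the transposed one.

For the flop count, `R` is a real conjugate-pair split-radix transform, `X_k = U_k + ω^k P_k +
ω^{-k} Q_k`. Writing `ω^k = cos θ (1 - i tan θ)` leaves two multiplications per rotation, and the
recursion of `fftScale` is made so that the cosine disappears into the scale factors. The transforms
of size `N` scaled by `s_N`, `s_{2N}` and `s_{4N}` call each other, and their costs are solved for
together (`HasFlops.realDFT_two_pow`). The last stage adds `3N - 4`.

The count is exact, so every constant that is charged must be shown to differ from `±1`. Mostly
strict inequalities suffice. The quotients of `s_N` by `s_{2N}` and the unnormalized coefficients `2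
cos(2πk/4N) s_{N,k}` need arithmetic: cosines of odd multiples of `2π/2^(n+1)` are not in the field
of `2^n`-th roots of unity (`cos_notMem_twoPowCyclotomic`). -/

namespace LinearNetwork

/-! ### The defining equations of the vertex values -/

variable {p q r N : ℕ}

-- Indicator sums over index types independent of `v` allow the order of summation to be exchanged
-- later.
open scoped Classical in
theorem value_eq_sum_ite (G : LinearNetwork p q) (x : Fin p → ℝ) (v : G.V) :
    G.value x v = (∑ i, if G.inp i = v then x i else 0) +
      ∑ e, if G.tgt e = v then G.weight e * G.value x (G.src e) else 0 := by
  rw [value]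
  congr 1
  · rw [← Finset.sum_filter]
    exact (Finset.sum_subtype _ (by simp) x).symm
  · rw [← Finset.sum_filter]
    exact (Finset.sum_subtype _ (by simp) fun e => G.weight e * G.value x (G.src e)).symm

open scoped Classical in
theorem value_eq_sum_of_not_inp (G : LinearNetwork p q) (x : Fin p → ℝ) (v : G.V)
    (hv : ∀ i, G.inp i ≠ v) :
    G.value x v = ∑ e, if G.tgt e = v then G.weight e * G.value x (G.src e) else 0 := by
  rw [value_eq_sum_ite, Finset.sum_eq_zero, zero_add]
  exact fun i _ => if_neg (hv i)

open scoped Classical in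
/-- The values of the vertices are determined by the defining equations of a network. -/
theorem value_unique (G : LinearNetwork p q) (x : Fin p → ℝ) (f : G.V → ℝ)
    (hinp : ∀ i, f (G.inp i) = x i)
    (hf : ∀ v, (∀ i, G.inp i ≠ v) →
      f v = ∑ e, if G.tgt e = v then G.weight e * f (G.src e) else 0) (v : G.V) :
    G.value x v = f v := by
  obtain ⟨rank, hrank⟩ := G.acyclic
  -- Edges go upwards in rank, so the equation at `v` involves only values settled earlier.
  induction h : rank v using Nat.strong_induction_on generalizing v with
  | _ n ih =>
    by_cases hv : ∀ i, G.inp i ≠ v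
    · rw [hf v hv, value_eq_sum_of_not_inp _ _ _ hv]
      refine Finset.sum_congr rfl fun e _ => ?_
      split_ifs with he
      · rw [ih (rank (G.src e)) (by have := hrank e; rw [he] at this; omega) _ rfl]
      · rfl
    · push Not at hv
      obtain ⟨i, rfl⟩ := hv
      rw [value_inp, hinp]

/-! ### Transposition -/

/-- A network and its transpose are adjoint to each other. -/
theorem sum_eval_mul (G : LinearNetwork p q) (x : Fin p → ℝ) (y : Fin q → ℝ) :
    ∑ j, G.eval x j * y j = ∑ i, x i * G.transpose.eval y i := by
  classical
  set f := G.value x with hf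
  set g : G.V → ℝ := G.transpose.value y with hg
  have h1 : ∑ v, f v * g v = (∑ i, x i * g (G.inp i)) +
      ∑ e, G.weight e * f (G.src e) * g (G.tgt e) := by
    have : ∀ v, f v * g v = (∑ i, if G.inp i = v then x i * g v else 0) +
        ∑ e, if G.tgt e = v then G.weight e * f (G.src e) * g v else 0 := fun v => by
      rw [hf, value_eq_sum_ite, add_mul, Finset.sum_mul, Finset.sum_mul]
      simp only [ite_mul, zero_mul]
    rw [Finset.sum_congr rfl fun v _ => this v, Finset.sum_add_distrib, Finset.sum_comm,
      Finset.sum_comm (s := univ (α := G.V))]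
    simp
  have h2 : ∑ v, f v * g v = (∑ j, f (G.out j) * y j) +
      ∑ e, G.weight e * f (G.src e) * g (G.tgt e) := by
    have : ∀ v, f v * g v = (∑ j, if G.out j = v then f v * y j else 0) +
        ∑ e, if G.src e = v then G.weight e * f v * g (G.tgt e) else 0 := fun v => by
      have hgv : g v = (∑ j, if G.out j = v then y j else 0) +
          ∑ e, if G.src e = v then G.weight e * g (G.tgt e) else 0 :=
        G.transpose.value_eq_sum_ite y v
      rw [hgv, mul_add, Finset.mul_sum, Finset.mul_sum]
      simp only [mul_ite, mul_zero, ← mul_assoc, mul_comm (f v) (G.weight _)]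
    rw [Finset.sum_congr rfl fun v _ => this v, Finset.sum_add_distrib, Finset.sum_comm,
      Finset.sum_comm (s := univ (α := G.V))]
    simp
  exact add_right_cancel (h2.symm.trans h1)

/-- By adjointness both sides have the same pairing with every vector; unit vectors separate the
coordinates. -/
theorem Computes.transpose {G : LinearNetwork p q} {A : Matrix (Fin q) (Fin p) ℝ}
    (h : G.Computes A) : G.transpose.Computes Aᵀ := by
  intro y
  have key : ∀ x : Fin p → ℝ, x ⬝ᵥ G.transpose.eval y = x ⬝ᵥ (Aᵀ *ᵥ y) := fun x => by
    rw [Matrix.dotProduct_mulVec, Matrix.vecMul_transpose, ← h x]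
    exact (sum_eval_mul G x y).symm
  funext i
  simpa using key (Pi.single i 1)

theorem transpose_computes_iff (G : LinearNetwork p q) (A : Matrix (Fin q) (Fin p) ℝ) :
    G.transpose.Computes Aᵀ ↔ G.Computes A :=
  ⟨fun h => Computes.transpose (G := G.transpose) h, Computes.transpose⟩

theorem numMul_transpose (G : LinearNetwork p q) : G.transpose.numMul = G.numMul := rfl

/-- Every edge ends in a vertex that is not an input, which gives the number of additions. -/
theorem numAdd_add_card (G : LinearNetwork p q) :
    G.numAdd + Fintype.card G.V = Fintype.card G.E + p := by
  classical
  have hcard : (univ.filter fun v : G.V => ∀ i, G.inp i ≠ v).card + p = Fintype.card G.V := by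
    have h := Finset.card_filter_add_card_filter_not (s := (univ : Finset G.V))
      (fun v : G.V => ∀ i, G.inp i ≠ v)
    have h' : (univ.filter fun v : G.V => ¬ ∀ i, G.inp i ≠ v) = univ.image G.inp := by
      ext v; simp
    rw [h', Finset.card_image_of_injective _ G.inp_injective, Finset.card_univ, Fintype.card_fin,
      Finset.card_univ] at h
    exact h
  have hE : ∑ v ∈ univ.filter fun v : G.V => ∀ i, G.inp i ≠ v,
      (univ.filter fun e : G.E => G.tgt e = v).card = Fintype.card G.E := by
    rw [← Finset.card_univ]
    refine (Finset.card_eq_sum_card_fiberwise fun e _ => ?_).symm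
    simp only [coe_filter, mem_univ, true_and, Set.mem_ofPred_eq]
    exact fun i hi => (G.inp_iff _).1 ⟨i, hi⟩ e rfl
  -- The truncated subtraction in `numAdd` loses nothing: a vertex without incoming edges is an
  -- input.
  have hpos : ∀ v ∈ univ.filter fun v : G.V => ∀ i, G.inp i ≠ v,
      1 ≤ (univ.filter fun e : G.E => G.tgt e = v).card := fun v hv => by
    rw [Nat.one_le_iff_ne_zero, Finset.card_ne_zero]
    simp only [mem_filter, mem_univ, true_and] at hv
    have := mt (G.inp_iff v).2 (by simpa using hv)
    push Not at this
    obtain ⟨e, he⟩ := this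
    exact ⟨e, by simpa using he⟩
  have hadd : G.numAdd + (univ.filter fun v : G.V => ∀ i, G.inp i ≠ v).card =
      Fintype.card G.E := by
    rw [← hE, numAdd, Finset.card_eq_sum_ones, ← Finset.sum_add_distrib]
    exact Finset.sum_congr (by congr) fun v hv => Nat.sub_add_cancel (hpos v (by convert hv))
  omega

theorem numAdd_transpose (G : LinearNetwork N N) : G.transpose.numAdd = G.numAdd :=
  Nat.add_right_cancel (G.transpose.numAdd_add_card.trans G.numAdd_add_card.symm)

theorem flops_transpose (G : LinearNetwork N N) : G.transpose.flops = G.flops := by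
  rw [flops, flops, numAdd_transpose, numMul_transpose]

/-! ### Renaming and sign changes of inputs and outputs -/

/-- Since `x i` enters at the old input `σ i`, the old input `j` receives `x (σ.symm j)`; hence the
inverse. -/
theorem eval_permuteInputs (G : LinearNetwork p q) (σ : Equiv.Perm (Fin p)) (x : Fin p → ℝ) :
    (G.permuteInputs σ).eval x = G.eval (x ∘ σ.symm) := by
  classical
  funext j
  refine value_unique (G.permuteInputs σ) x (G.value (x ∘ σ.symm)) (fun i => ?_) (fun v hv => ?_) _
  · simp [permuteInputs, value_inp]
  · refine value_eq_sum_of_not_inp G _ v fun i hi => hv (σ.symm i) ?_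
    simpa [permuteInputs] using hi

theorem value_permuteOutputs (G : LinearNetwork p q) (σ : Equiv.Perm (Fin q)) (x : Fin p → ℝ)
    (v : G.V) : (G.permuteOutputs σ).value x v = G.value x v := by
  classical
  exact value_unique (G.permuteOutputs σ) x (G.value x) (value_inp G x)
    (fun v hv => value_eq_sum_of_not_inp G x v hv) v

theorem eval_permuteOutputs (G : LinearNetwork p q) (σ : Equiv.Perm (Fin q)) (x : Fin p → ℝ) :
    (G.permuteOutputs σ).eval x = G.eval x ∘ σ :=
  funext fun _ => value_permuteOutputs G σ x _

theorem numAdd_permuteInputs (G : LinearNetwork p q) (σ : Equiv.Perm (Fin p)) :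
    (G.permuteInputs σ).numAdd = G.numAdd :=
  Nat.add_right_cancel ((G.permuteInputs σ).numAdd_add_card.trans G.numAdd_add_card.symm)

theorem numAdd_permuteOutputs (G : LinearNetwork p q) (σ : Equiv.Perm (Fin q)) :
    (G.permuteOutputs σ).numAdd = G.numAdd :=
  Nat.add_right_cancel ((G.permuteOutputs σ).numAdd_add_card.trans G.numAdd_add_card.symm)

theorem flops_permuteInputs (G : LinearNetwork p q) (σ : Equiv.Perm (Fin p)) :
    (G.permuteInputs σ).flops = G.flops :=
  congrArg₂ _ (numAdd_permuteInputs G σ) rfl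

theorem flops_permuteOutputs (G : LinearNetwork p q) (σ : Equiv.Perm (Fin q)) :
    (G.permuteOutputs σ).flops = G.flops :=
  congrArg₂ _ (numAdd_permuteOutputs G σ) rfl

theorem numAdd_flipOddInputs (G : LinearNetwork p q) : G.flipOddInputs.numAdd = G.numAdd :=
  Nat.add_right_cancel (G.flipOddInputs.numAdd_add_card.trans G.numAdd_add_card.symm)

theorem numAdd_flipOddOutputs (G : LinearNetwork p q) : G.flipOddOutputs.numAdd = G.numAdd :=
  Nat.add_right_cancel (G.flipOddOutputs.numAdd_add_card.trans G.numAdd_add_card.symm)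

theorem numMul_flipOddInputs (G : LinearNetwork p q) : G.flipOddInputs.numMul = G.numMul := by
  classical
  refine congrArg Finset.card (Finset.filter_congr fun e _ => ?_)
  simp only [flipOddInputs]
  split_ifs
  · rw [Ne, Ne, neg_eq_iff_eq_neg, neg_inj, and_comm]
  · rfl

theorem numMul_flipOddOutputs (G : LinearNetwork p q) : G.flipOddOutputs.numMul = G.numMul := by
  classical
  refine congrArg Finset.card (Finset.filter_congr fun e _ => ?_)
  simp only [flipOddOutputs]
  split_ifs
  · rw [Ne, Ne, neg_eq_iff_eq_neg, neg_inj, and_comm]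
  · rfl

/-- The vertex values of the flipped network are `s v * G.value y v`, where `s` is `-1` at the odd
inputs only. On an edge the sign of the weight and the sign of the source value cancel. -/
theorem eval_flipOddInputs (G : LinearNetwork p q) (x : Fin p → ℝ) :
    G.flipOddInputs.eval x = G.eval fun i => (-1) ^ (i : ℕ) * x i := by
  classical
  set y : Fin p → ℝ := fun i => (-1) ^ (i : ℕ) * x i with hy
  set s : G.V → ℝ := fun v => if ∃ i : Fin p, Odd (i : ℕ) ∧ v = G.inp i then -1 else 1 with hs
  have hsi : ∀ i : Fin p, s (G.inp i) = (-1) ^ (i : ℕ) := fun i => by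
    rcases Nat.even_or_odd (i : ℕ) with h | h
    · rw [hs, h.neg_one_pow]
      refine if_neg ?_
      rintro ⟨j, hj, hij⟩
      rw [G.inp_injective hij] at h
      exact (Nat.not_even_iff_odd.2 hj) h
    · rw [hs, h.neg_one_pow]
      exact if_pos ⟨i, h, rfl⟩
  have hsn : ∀ v, (∀ i, G.inp i ≠ v) → s v = 1 := fun v hv =>
    if_neg fun ⟨i, _, hi⟩ => hv i hi.symm
  have hss : ∀ v, s v * s v = 1 := fun v => by simp only [hs]; split_ifs <;> norm_num
  have hw : ∀ e, G.flipOddInputs.weight e = s (G.src e) * G.weight e := fun e => by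
    simp only [flipOddInputs, hs]
    split_ifs <;> ring
  funext j
  refine (value_unique G.flipOddInputs x (fun v => s v * G.value y v) (fun i => ?_)
    (fun v hv => ?_) _).trans ?_
  · show s (G.inp i) * G.value y (G.inp i) = x i
    rw [hsi, value_inp, hy, ← mul_assoc, ← mul_pow]
    norm_num
  · show s v * G.value y v = _
    rw [hsn v hv, one_mul, value_eq_sum_of_not_inp G y v hv]
    refine Finset.sum_congr rfl fun e _ => if_congr Iff.rfl ?_ rfl
    refine Eq.trans ?_
      (congrArg (fun w => w * (s (G.src e) * G.value y (G.src e))) (hw e)).symm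
    show _ = s (G.src e) * G.weight e * (s (G.src e) * G.value y (G.src e))
    linear_combination (-(G.weight e * G.value y (G.src e))) * hss (G.src e)
  · show s (G.out j) * _ = _
    rw [hsn _ fun i => G.inp_ne_out i j, one_mul]
    rfl

/-- An output vertex is never a source, so the sign on its incoming edges affects its own value and
no other. -/
theorem eval_flipOddOutputs (G : LinearNetwork p q) (x : Fin p → ℝ) :
    G.flipOddOutputs.eval x = fun j : Fin q => (-1) ^ (j : ℕ) * G.eval x j := by
  classical
  set s : G.V → ℝ := fun v => if ∃ j : Fin q, Odd (j : ℕ) ∧ v = G.out j then -1 else 1 with hs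
  have hsn : ∀ v, (∀ j, G.out j ≠ v) → s v = 1 := fun v hv =>
    if_neg fun ⟨i, _, hi⟩ => hv i hi.symm
  have hw : ∀ e, G.flipOddOutputs.weight e = s (G.tgt e) * G.weight e := fun e => by
    simp only [flipOddOutputs, hs]
    split_ifs <;> ring
  funext j
  refine (value_unique G.flipOddOutputs x (fun v => s v * G.value x v) (fun i => ?_)
    (fun v hv => ?_) _).trans ?_
  · show s (G.inp i) * G.value x (G.inp i) = x i
    rw [hsn _ fun j h => G.inp_ne_out i j h.symm, value_inp, one_mul]
  · show s v * G.value x v = _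
    rw [value_eq_sum_of_not_inp G x v hv, Finset.mul_sum]
    refine Finset.sum_congr rfl fun e _ => ?_
    rw [mul_ite, mul_zero]
    show (if G.tgt e = v then _ else _) = if G.tgt e = v then _ else _
    split_ifs with he
    · refine Eq.trans ?_
        (congrArg (fun w => w * (s (G.src e) * G.value x (G.src e))) (hw e)).symm
      simp only [he]
      show _ = s v * G.weight e * (s (G.src e) * G.value x (G.src e))
      rw [hsn (G.src e) fun j hj => (G.out_iff _).1 ⟨j, hj⟩ e rfl]
      ring
    · rfl
  · show s (G.out j) * _ = _
    congr 1
    rcases Nat.even_or_odd (j : ℕ) with h | h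
    · rw [hs, h.neg_one_pow]
      refine if_neg ?_
      rintro ⟨i, hi, hij⟩
      rw [G.out_injective hij] at h
      exact (Nat.not_even_iff_odd.2 hi) h
    · rw [hs, h.neg_one_pow]
      exact if_pos ⟨j, h, rfl⟩

/-! ### Serial composition -/

theorem eval_andThen (G : LinearNetwork p q) (H : LinearNetwork q r) (x : Fin p → ℝ) :
    (G.andThen H).eval x = H.eval (G.eval x) := by
  classical
  funext k
  refine value_unique (G.andThen H) x (Sum.elim (G.value x) (H.value (G.eval x)))
    (fun i => G.value_inp x i) ?_ (Sum.inr (H.out k))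
  rintro (v | v) hv
  · rw [Sum.elim_inl, value_eq_sum_of_not_inp G x v fun i h => hv i (congrArg Sum.inl h)]
    show _ = ∑ e : (G.E ⊕ H.E) ⊕ Fin q, _
    simp [andThen, Fintype.sum_sum_type]
  -- An input vertex of `H` is not an input of the composite: the input term of its equation is
  -- delivered by the wire instead.
  · rw [Sum.elim_inr, value_eq_sum_ite]
    show _ = ∑ e : (G.E ⊕ H.E) ⊕ Fin q, _
    simp [andThen, Fintype.sum_sum_type, eval, add_comm]

/-- The `q` wires are offset by the `q` inputs of `H` that cease to be inputs. -/
theorem numAdd_andThen (G : LinearNetwork p q) (H : LinearNetwork q r) :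
    (G.andThen H).numAdd = G.numAdd + H.numAdd := by
  have h := (G.andThen H).numAdd_add_card
  have hV : Fintype.card (G.andThen H).V = Fintype.card G.V + Fintype.card H.V :=
    Fintype.card_sum
  have hE : Fintype.card (G.andThen H).E = Fintype.card G.E + Fintype.card H.E + q := by
    refine (Fintype.card_sum (α := G.E ⊕ H.E) (β := Fin q)).trans ?_
    rw [Fintype.card_sum, Fintype.card_fin]
  have := G.numAdd_add_card
  have := H.numAdd_add_card
  omega

open scoped Classical in
theorem numMul_eq_sum (G : LinearNetwork p q) :
    G.numMul = ∑ e, if G.weight e ≠ 1 ∧ G.weight e ≠ -1 then 1 else 0 :=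
  Finset.card_filter _ _

theorem numMul_andThen (G : LinearNetwork p q) (H : LinearNetwork q r) :
    (G.andThen H).numMul = G.numMul + H.numMul := by
  classical
  simp only [numMul_eq_sum]
  show ∑ e : (G.E ⊕ H.E) ⊕ Fin q, _ = _
  simp [andThen, Fintype.sum_sum_type, -Finset.sum_boole]
  congr!

theorem flops_andThen (G : LinearNetwork p q) (H : LinearNetwork q r) :
    (G.andThen H).flops = G.flops + H.flops := by
  rw [flops, numAdd_andThen, numMul_andThen, flops, flops]
  omega

end LinearNetwork

namespace LinearNetwork

/-! ### Building blocks -/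

/-- The network that consists of `n` wires. -/
def wires (n : ℕ) : LinearNetwork n n where
  V := Fin n ⊕ Fin n
  E := Fin n
  src := Sum.inl
  tgt := Sum.inr
  weight := fun _ => 1
  inp := Sum.inl
  out := Sum.inr
  inp_injective := Sum.inl_injective
  out_injective := Sum.inr_injective
  inp_iff := by rintro (v | v) <;> simp
  out_iff := by rintro (v | v) <;> simp
  inp_ne_out := by simp
  acyclic := ⟨Sum.elim (fun _ => 0) (fun _ => 1), by simp⟩

theorem eval_wires (n : ℕ) (x : Fin n → ℝ) : (wires n).eval x = x := by
  classical
  funext j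
  refine value_unique (wires n) x (Sum.elim x x) (fun i => rfl) ?_ (Sum.inr j)
  rintro (v | v) hv
  · exact absurd rfl (hv v)
  · simp only [wires, Sum.elim_inr, Sum.inr.injEq, one_mul, Sum.elim_inl, Finset.sum_ite_eq']
    exact (if_pos (Finset.mem_univ v)).symm

theorem flops_wires (n : ℕ) : (wires n).flops = 0 := by
  have h := (wires n).numAdd_add_card
  have hV : Fintype.card (wires n).V = n + n := by
    rw [show Fintype.card (wires n).V = Fintype.card (Fin n ⊕ Fin n) from rfl]; simp
  have hE : Fintype.card (wires n).E = n := Fintype.card_fin n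
  have hm : (wires n).numMul = 0 := by
    classical
    rw [numMul, Finset.card_eq_zero, Finset.filter_eq_empty_iff]
    exact fun e _ h => h.1 rfl
  rw [flops, hm]
  omega

/-- The complete bipartite network with the coefficients of a matrix as weights. -/
def dense {p q : ℕ} [NeZero p] [NeZero q] (W : Matrix (Fin q) (Fin p) ℝ) : LinearNetwork p q where
  V := Fin p ⊕ Fin q
  E := Fin q × Fin p
  src := fun e => Sum.inl e.2
  tgt := fun e => Sum.inr e.1
  weight := fun e => W e.1 e.2
  inp := Sum.inl
  out := Sum.inr
  inp_injective := Sum.inl_injective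
  out_injective := Sum.inr_injective
  inp_iff := by rintro (v | v) <;> simp
  out_iff := by rintro (v | v) <;> simp
  inp_ne_out := by simp
  acyclic := ⟨Sum.elim (fun _ => 0) (fun _ => 1), by simp⟩

section dense

variable {p q : ℕ} [NeZero p] [NeZero q]

theorem eval_dense (W : Matrix (Fin q) (Fin p) ℝ) (x : Fin p → ℝ) :
    (dense W).eval x = W *ᵥ x := by
  classical
  funext j
  refine value_unique (dense W) x (Sum.elim x (W *ᵥ x)) (fun i => rfl) ?_ (Sum.inr j)
  rintro (v | v) hv
  · exact absurd rfl (hv v)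
  · show _ = ∑ e : Fin q × Fin p, _
    simp [dense, Fintype.sum_prod_type_right, Matrix.mulVec, dotProduct]

theorem numAdd_dense (W : Matrix (Fin q) (Fin p) ℝ) : (dense W).numAdd = q * (p - 1) := by
  have h := (dense W).numAdd_add_card
  have hV : Fintype.card (dense W).V = p + q := by
    rw [show Fintype.card (dense W).V = Fintype.card (Fin p ⊕ Fin q) from rfl]; simp
  have hE : Fintype.card (dense W).E = q * p := by
    rw [show Fintype.card (dense W).E = Fintype.card (Fin q × Fin p) from rfl]; simp
  have hq : q * (p - 1) + q = q * p := by
    rw [← Nat.mul_succ, Nat.succ_eq_add_one, Nat.sub_add_cancel NeZero.one_le]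
  omega

end dense

/-- Two networks side by side. -/
def par {p q p' q' : ℕ} (G : LinearNetwork p q) (H : LinearNetwork p' q') :
    LinearNetwork (p + p') (q + q') where
  V := G.V ⊕ H.V
  E := G.E ⊕ H.E
  src := Sum.map G.src H.src
  tgt := Sum.map G.tgt H.tgt
  weight := Sum.elim G.weight H.weight
  inp := fun i => Sum.map G.inp H.inp (finSumFinEquiv.symm i)
  out := fun j => Sum.map G.out H.out (finSumFinEquiv.symm j)
  inp_injective :=
    (G.inp_injective.sumMap H.inp_injective).comp finSumFinEquiv.symm.injective
  out_injective :=
    (G.out_injective.sumMap H.out_injective).comp finSumFinEquiv.symm.injective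
  inp_iff := by
    intro v
    rw [← finSumFinEquiv.exists_congr_left (p := fun i => Sum.map G.inp H.inp i = v)]
    rcases v with v | v
    · simpa using G.inp_iff v
    · simpa using H.inp_iff v
  out_iff := by
    intro v
    rw [← finSumFinEquiv.exists_congr_left (p := fun i => Sum.map G.out H.out i = v)]
    rcases v with v | v
    · simpa using G.out_iff v
    · simpa using H.out_iff v
  inp_ne_out := by
    intro i j
    rcases finSumFinEquiv.symm i with i | i <;> rcases finSumFinEquiv.symm j with j | j <;>
      simp [G.inp_ne_out, H.inp_ne_out]
  acyclic := by
    obtain ⟨rG, hG⟩ := G.acyclic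
    obtain ⟨rH, hH⟩ := H.acyclic
    exact ⟨Sum.elim rG rH, by rintro (e | e) <;> simp [hG, hH]⟩

section par

variable {p q p' q' : ℕ} (G : LinearNetwork p q) (H : LinearNetwork p' q')

theorem eval_par (x : Fin p ⊕ Fin p' → ℝ) :
    (G.par H).eval (x ∘ finSumFinEquiv.symm) =
      Sum.elim (G.eval (x ∘ Sum.inl)) (H.eval (x ∘ Sum.inr)) ∘ finSumFinEquiv.symm := by
  classical
  have h := value_unique (G.par H) (x ∘ finSumFinEquiv.symm)
    (Sum.elim (G.value (x ∘ Sum.inl)) (H.value (x ∘ Sum.inr))) ?_ ?_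
  · funext j
    rw [eval, h]
    simp only [par, Function.comp]
    rcases finSumFinEquiv.symm j with j | j <;> rfl
  · intro i
    simp only [par, Function.comp]
    rcases finSumFinEquiv.symm i with i | i <;> simp [value_inp]
  · rintro (v | v) hv
    · rw [Sum.elim_inl, value_eq_sum_of_not_inp]
      · show _ = ∑ e : G.E ⊕ H.E, _
        simp [par, Fintype.sum_sum_type]
      · exact fun i hi => hv (finSumFinEquiv (Sum.inl i)) (by simp [par, hi])
    · rw [Sum.elim_inr, value_eq_sum_of_not_inp]
      · show _ = ∑ e : G.E ⊕ H.E, _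
        simp [par, Fintype.sum_sum_type]
      · exact fun i hi => hv (finSumFinEquiv (Sum.inr i)) (by simp [par, hi])

theorem flops_par : (G.par H).flops = G.flops + H.flops := by
  classical
  have h := (G.par H).numAdd_add_card
  have hV : Fintype.card (G.par H).V = Fintype.card G.V + Fintype.card H.V :=
    Fintype.card_sum
  have hE : Fintype.card (G.par H).E = Fintype.card G.E + Fintype.card H.E :=
    Fintype.card_sum
  have hm : (G.par H).numMul = G.numMul + H.numMul := by
    simp only [numMul_eq_sum]
    show ∑ e : G.E ⊕ H.E, _ = _
    simp [par, Fintype.sum_sum_type, -Finset.sum_boole]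
    congr!
  have := G.numAdd_add_card
  have := H.numAdd_add_card
  rw [flops, flops, flops, hm]
  omega

end par

end LinearNetwork

/-! ### Linear maps that are computed with a given number of flops -/

/-- Some linear network computes `f`, up to a numbering of the inputs and outputs, with exactly `c`
flops. -/
def HasFlops {I O : Type} (f : (I → ℝ) → O → ℝ) (c : ℕ) : Prop :=
  ∃ (p q : ℕ) (e : Fin p ≃ I) (e' : Fin q ≃ O) (G : LinearNetwork p q),
    (∀ x : I → ℝ, G.eval (x ∘ e) = f x ∘ e') ∧ G.flops = c

open scoped Classical in
/-- The cost of the multiplication by a constant. -/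
noncomputable def mulCost (a : ℝ) : ℕ := if a = 1 ∨ a = -1 then 0 else 1

theorem mulCost_one : mulCost 1 = 0 := by simp [mulCost]

theorem mulCost_of_ne {a : ℝ} (h : a ≠ 1) (h' : a ≠ -1) : mulCost a = 1 := by
  simp [mulCost, h, h']

theorem mulCost_neg (a : ℝ) : mulCost (-a) = mulCost a := by
  simp only [mulCost, neg_eq_iff_eq_neg, neg_neg, or_comm]

theorem mulCost_of_pos {a : ℝ} (h : 0 < a) (h' : a ≠ 1) : mulCost a = 1 :=
  mulCost_of_ne h' (by linarith)

namespace HasFlops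

variable {I J O O' : Type}

theorem comp {g : (J → ℝ) → O → ℝ} {f : (I → ℝ) → J → ℝ} {c d : ℕ}
    (hg : HasFlops g d) (hf : HasFlops f c) : HasFlops (fun x => g (f x)) (c + d) := by
  obtain ⟨p, q, e, e', G, hG, hGc⟩ := hf
  obtain ⟨q', r, a, a', H, hH, hHc⟩ := hg
  obtain rfl : q = q' := by simpa using Fintype.card_congr (e'.trans a.symm)
  -- The permutation translates between the two numberings of `J`.
  refine ⟨p, r, e, a', (G.permuteOutputs (a.trans e'.symm)).andThen H, fun x => ?_, ?_⟩
  · rw [LinearNetwork.eval_andThen, LinearNetwork.eval_permuteOutputs, hG, ← hH]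
    congr 1
    funext j
    simp
  · rw [LinearNetwork.flops_andThen, LinearNetwork.flops_permuteOutputs, hGc, hHc]

theorem reindex [Finite I] (e : O ≃ I) : HasFlops (fun x : I → ℝ => x ∘ e) 0 := by
  obtain ⟨n, ⟨a⟩⟩ := Finite.exists_equiv_fin I
  refine ⟨n, n, a.symm, a.symm.trans e.symm, LinearNetwork.wires n, fun x => ?_,
    LinearNetwork.flops_wires n⟩
  rw [LinearNetwork.eval_wires]
  funext j
  simp

theorem id [Finite I] : HasFlops (fun x : I → ℝ => x) 0 := reindex (Equiv.refl I)

theorem congr {f g : (I → ℝ) → O → ℝ} {c d : ℕ} (h : HasFlops f c) (hfg : ∀ x o, f x o = g x o)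
    (hcd : c = d) : HasFlops g d := by
  obtain rfl : f = g := funext fun x => funext (hfg x)
  exact hcd ▸ h

theorem sum {f : (I → ℝ) → O → ℝ} {g : (J → ℝ) → O' → ℝ} {c d : ℕ} (hf : HasFlops f c)
    (hg : HasFlops g d) :
    HasFlops (fun x : I ⊕ J → ℝ => Sum.elim (f (x ∘ Sum.inl)) (g (x ∘ Sum.inr))) (c + d) := by
  obtain ⟨p, q, e, e', G, hG, hGc⟩ := hf
  obtain ⟨p', q', a, a', H, hH, hHc⟩ := hg
  refine ⟨p + p', q + q', finSumFinEquiv.symm.trans (e.sumCongr a),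
    finSumFinEquiv.symm.trans (e'.sumCongr a'), G.par H, fun x => ?_, ?_⟩
  · refine (LinearNetwork.eval_par G H (x ∘ e.sumCongr a)).trans ?_
    funext j
    simp only [Function.comp, Equiv.trans_apply]
    rcases finSumFinEquiv.symm j with j | j
    · exact congrFun (hG (x ∘ Sum.inl)) j
    · exact congrFun (hH (x ∘ Sum.inr)) j
  · rw [LinearNetwork.flops_par, hGc, hHc]

theorem family {n : ℕ} [Finite I] {f : Fin n → (I → ℝ) → I → ℝ} {c : ℕ}
    (h : ∀ k, HasFlops (f k) c) :
    HasFlops (fun (x : Fin n × I → ℝ) (k : Fin n × I) => f k.1 (fun i => x (k.1, i)) k.2)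
      (n * c) := by
  induction n with
  | zero => exact id.congr (fun x k => k.1.elim0) (by simp)
  | succ n ih =>
    let e : Fin (n + 1) × I ≃ I ⊕ Fin n × I :=
      { toFun := fun k => Fin.cases (motive := fun _ => I ⊕ Fin n × I) (Sum.inl k.2)
          (fun j => Sum.inr (j, k.2)) k.1
        invFun := Sum.elim (fun i => (0, i)) (fun k => (k.1.succ, k.2))
        left_inv := by
          rintro ⟨k, i⟩
          refine Fin.cases ?_ (fun j => ?_) k <;> simp
        right_inv := by rintro (i | ⟨k, i⟩) <;> simp }
    refine ((reindex e).comp (((h 0).sum (ih fun k => h k.succ)).comp (reindex e.symm))).congr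
      ?_ (by ring)
    rintro x ⟨k, i⟩
    refine Fin.cases ?_ (fun j => ?_) k <;> simp [e, Function.comp_def]

/-- A map of some of the coordinates. -/
theorem extend [Finite I] {f : (J → ℝ) → J → ℝ} {c : ℕ} (h : HasFlops f c) {ι : J → I}
    (hι : Function.Injective ι) :
    HasFlops (fun x : I → ℝ => Function.extend ι (f (x ∘ ι)) x) c := by
  classical
  have : Finite J := Finite.of_injective ι hι
  -- The coordinates outside the range of `ι` are carried along by wires, at no cost.
  let e : J ⊕ {i // i ∉ Set.range ι} ≃ I :=
    ((Equiv.ofInjective ι hι).sumCongr (Equiv.refl _)).trans (Equiv.sumCompl (· ∈ Set.range ι))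
  have h1 : ∀ j, e (Sum.inl j) = ι j := fun j => rfl
  have h2 : ∀ i, e (Sum.inr i) = i.1 := fun i => rfl
  refine ((reindex e.symm).comp
    ((h.sum (id (I := {i // i ∉ Set.range ι}))).comp (reindex e))).congr ?_ (by ring)
  intro x i
  obtain ⟨j, rfl⟩ := e.surjective i
  rcases j with j | j
  · simp only [Function.comp_apply, Equiv.symm_apply_apply, Sum.elim_inl]
    rw [h1, hι.extend_apply]
    rfl
  · simp only [Function.comp_apply, Equiv.symm_apply_apply, Sum.elim_inr]
    rw [h2, Function.extend_apply' _ _ _ j.2]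

theorem scale [Finite I] [DecidableEq I] (i : I) (a : ℝ) :
    HasFlops (fun x : I → ℝ => Function.update x i (a * x i)) (mulCost a) := by
  have h : HasFlops (fun x : Fin 1 → ℝ => fun _ : Fin 1 => a * x 0) (mulCost a) := by
    refine ⟨1, 1, Equiv.refl _, Equiv.refl _, LinearNetwork.dense (Matrix.of fun _ _ => a),
      fun x => ?_, ?_⟩
    · rw [LinearNetwork.eval_dense]
      funext j
      simp [Matrix.mulVec, dotProduct]
    · rw [LinearNetwork.flops, LinearNetwork.numAdd_dense, LinearNetwork.numMul_eq_sum]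
      show _ + ∑ e : Fin 1 × Fin 1, _ = _
      simp [LinearNetwork.dense, mulCost, ← not_or, ite_not]
  have hι : Function.Injective (fun _ : Fin 1 => i) := Function.injective_of_subsingleton _
  refine (h.extend hι).congr (fun x k => ?_) rfl
  by_cases hk : k = i
  · subst hk
    rw [Function.update_self]
    exact hι.extend_apply _ _ 0
  · rw [Function.update_of_ne hk, Function.extend_apply']
    rintro ⟨_, rfl⟩
    exact hk rfl

/-- The elementary block: all butterflies below are composed of such `2 × 2` maps and diagonal
scalings. -/
theorem pair [Finite I] [DecidableEq I] {i j : I} (hij : i ≠ j) (a b c d : ℝ) :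
    HasFlops (fun x : I → ℝ => Function.update (Function.update x i (a * x i + b * x j)) j
      (c * x i + d * x j)) (2 + (mulCost a + mulCost b + mulCost c + mulCost d)) := by
  have h : HasFlops (fun x : Fin 2 → ℝ => ![a * x 0 + b * x 1, c * x 0 + d * x 1])
      (2 + (mulCost a + mulCost b + mulCost c + mulCost d)) := by
    refine ⟨2, 2, Equiv.refl _, Equiv.refl _, LinearNetwork.dense !![a, b; c, d],
      fun x => ?_, ?_⟩
    · rw [LinearNetwork.eval_dense]
      funext j
      fin_cases j <;> simp [Matrix.mulVec, dotProduct]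
    · rw [LinearNetwork.flops, LinearNetwork.numAdd_dense, LinearNetwork.numMul_eq_sum]
      show _ + ∑ e : Fin 2 × Fin 2, _ = _
      simp [LinearNetwork.dense, Fintype.sum_prod_type, mulCost, ← not_or, ite_not]
      ring_nf
      congr!
  have hι : Function.Injective ![i, j] := by
    intro m n hmn
    fin_cases m <;> fin_cases n <;> simp_all
  refine (h.extend hι).congr (fun x k => ?_) rfl
  by_cases hkj : k = j
  · subst hkj
    rw [Function.update_self]
    exact hι.extend_apply _ _ 1
  · rw [Function.update_of_ne hkj]
    by_cases hki : k = i
    · subst hki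
      rw [Function.update_self]
      exact hι.extend_apply _ _ 0
    · rw [Function.update_of_ne hki, Function.extend_apply']
      rintro ⟨m, rfl⟩
      fin_cases m <;> simp_all

/-- A map between spaces of vectors is computed by a network with the given numbering. -/
theorem exists_network {p q : ℕ} {f : (Fin p → ℝ) → Fin q → ℝ} {c : ℕ} (h : HasFlops f c) :
    ∃ G : LinearNetwork p q, G.eval = f ∧ G.flops = c := by
  obtain ⟨p', q', e, e', G, hG, hGc⟩ := h
  obtain rfl : p' = p := by simpa using Fintype.card_congr e
  obtain rfl : q' = q := by simpa using Fintype.card_congr e'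
  refine ⟨(G.permuteInputs e.symm).permuteOutputs e'.symm, ?_, ?_⟩
  · funext x j
    rw [LinearNetwork.eval_permuteOutputs, LinearNetwork.eval_permuteInputs]
    simpa using congrFun (hG x) (e'.symm j)
  · rw [LinearNetwork.flops_permuteOutputs, LinearNetwork.flops_permuteInputs, hGc]

end HasFlops

/-! ### The scale factors of the fast Fourier transform -/

section fftScale

open Real

theorem fftScale_of_le_four {N : ℕ} (h : N ≤ 4) (k : ℕ) : fftScale N k = 1 := by
  rw [fftScale, if_pos h]

theorem fftScale_four_mul {M : ℕ} (hM : 1 < M) (k : ℕ) :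
    fftScale (4 * M) k = fftScale M (k % M) *
      if 2 * (k % M) ≤ M then cos (2 * π * ((k % M : ℕ) : ℝ) / (4 * M))
      else sin (2 * π * ((k % M : ℕ) : ℝ) / (4 * M)) := by
  rw [fftScale, if_neg (by omega), Nat.mul_div_cancel_left M (by norm_num)]
  push_cast
  by_cases h : 2 * (k % M) ≤ M
  · rw [if_pos h, if_pos (by omega)]
  · rw [if_neg h, if_neg (by omega)]

/-- The angles lie in `[0, π/2)`, and in the sine case the residue is not `0`, so each factor is in
`(0, 1]`. -/
theorem fftScale_pos_le_one (N k : ℕ) : 0 < fftScale N k ∧ fftScale N k ≤ 1 := by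
  induction N using Nat.strong_induction_on generalizing k with
  | _ N ih =>
    rw [fftScale]
    split_ifs with h1 h2
    · norm_num
    all_goals
      obtain ⟨hp, hl⟩ := ih (N / 4) (by omega) (k % (N / 4))
      have hr : k % (N / 4) < N / 4 := Nat.mod_lt _ (by omega)
      set r := k % (N / 4)
      have hN : (0 : ℝ) < N := by exact_mod_cast (by omega : 0 < N)
      have hr' : 4 * (r : ℝ) < N := by exact_mod_cast (by omega : 4 * r < N)
      have hlt : 2 * π * (r : ℝ) / N < π / 2 := by
        rw [div_lt_iff₀ hN]
        nlinarith [pi_pos]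
    · have h0 : 0 ≤ 2 * π * (r : ℝ) / N := by positivity
      exact ⟨mul_pos hp (cos_pos_of_mem_Ioo ⟨by linarith [pi_pos], hlt⟩),
        mul_le_one₀ hl (cos_nonneg_of_mem_Icc ⟨by linarith [pi_pos], hlt.le⟩) (cos_le_one _)⟩
    · have hr0 : (0 : ℝ) < r := by exact_mod_cast (by omega : 0 < r)
      have h0 : 0 < 2 * π * (r : ℝ) / N := by positivity
      have hs := sin_pos_of_pos_of_lt_pi h0 (by linarith [pi_pos])
      exact ⟨mul_pos hp hs, mul_le_one₀ hl hs.le (sin_le_one _)⟩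

theorem fftScale_pos (N k : ℕ) : 0 < fftScale N k := (fftScale_pos_le_one N k).1

theorem fftScale_ne_zero (N k : ℕ) : fftScale N k ≠ 0 := (fftScale_pos N k).ne'

theorem fftScale_le_one (N k : ℕ) : fftScale N k ≤ 1 := (fftScale_pos_le_one N k).2

theorem fftScale_mod_eq {M a b : ℕ} (h : a % M = b % M) :
    fftScale (4 * M) a = fftScale (4 * M) b := by
  rcases Nat.lt_or_ge 1 M with hM | hM
  · rw [fftScale_four_mul hM, fftScale_four_mul hM, h]
  · rw [fftScale_of_le_four (by omega), fftScale_of_le_four (by omega)]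

theorem fftScale_zero (N : ℕ) : fftScale N 0 = 1 := by
  induction N using Nat.strong_induction_on with
  | _ N ih =>
    rw [fftScale]
    split_ifs with h1 h2
    · rfl
    · rw [Nat.zero_mod, ih (N / 4) (by omega)]
      simp
    · simp at h2

theorem fftScale_of_dvd {M k : ℕ} (h : M ∣ k) : fftScale (4 * M) k = 1 := by
  rw [fftScale_mod_eq (b := 0) (by rw [Nat.zero_mod, Nat.mod_eq_zero_of_dvd h]), fftScale_zero]

/-- The two angles add up to `π/2`. Hence the sine case of the scale factor is the cosine at the
reflected residue. -/
theorem sin_eq_cos_of_add_eq {M a b : ℕ} (hM : 0 < M) (h : a + b = M) :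
    sin (2 * π * (b : ℝ) / (4 * M)) = cos (2 * π * (a : ℝ) / (4 * M)) := by
  have hM' : (M : ℝ) ≠ 0 := by exact_mod_cast hM.ne'
  rw [← sin_pi_div_two_sub]
  congr 1
  rw [← h] at hM' ⊢
  push_cast at hM' ⊢
  field_simp
  ring

/-- The scale factors are even and periodic. -/
theorem fftScale_symm (m : ℕ) {a b : ℕ} (h : 2 ^ m ∣ 4 * (a + b)) :
    fftScale (2 ^ m) a = fftScale (2 ^ m) b := by
  induction m using Nat.strong_induction_on generalizing a b with
  | _ m ih =>
    rcases Nat.lt_or_ge 2 m with hm | hm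
    · obtain ⟨n, rfl⟩ : ∃ n, m = n + 2 := ⟨m - 2, by omega⟩
      have hM : 1 < 2 ^ n := Nat.one_lt_two_pow (by omega)
      have hpow : 2 ^ (n + 2) = 4 * 2 ^ n := by ring
      rw [hpow] at h ⊢
      have h' : 2 ^ n ∣ a + b := Nat.dvd_of_mul_dvd_mul_left (by norm_num) h
      have hih := ih n (by omega) (a := a % 2 ^ n) (b := b % 2 ^ n)
      rw [fftScale_four_mul hM, fftScale_four_mul hM]
      set M := 2 ^ n
      have ha : a % M < M := Nat.mod_lt _ (by omega)
      have hb : b % M < M := Nat.mod_lt _ (by omega)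
      have hd : M ∣ a % M + b % M := by
        have := (Nat.dvd_iff_mod_eq_zero).1 h'
        rw [Nat.add_mod] at this
        exact (Nat.dvd_iff_mod_eq_zero).2 this
      obtain ⟨c, hc⟩ := hd
      -- Both residues are below `M`, so their sum is `0` or `M`.
      rcases c with _ | _ | c
      · have h1 : a % M = 0 := by omega
        have h2 : b % M = 0 := by omega
        rw [h1, h2]
      · have hsum : a % M + b % M = M := by omega
        rw [hih (by rw [hsum]; exact Dvd.intro_left 4 rfl)]
        congr 1
        -- The reflection exchanges the cosine and the sine case; both residues fall into the cosine
        -- case only if they equal `M / 2`.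
        by_cases h1 : 2 * (a % M) ≤ M <;> by_cases h2 : 2 * (b % M) ≤ M
        · have : a % M = b % M := by omega
          rw [this]
        · rw [if_pos h1, if_neg h2, sin_eq_cos_of_add_eq (by omega) hsum]
        · rw [if_neg h1, if_pos h2, sin_eq_cos_of_add_eq (by omega) ((add_comm _ _).trans hsum)]
        · omega
      · exfalso
        have : M * (c + 1 + 1) = M * c + 2 * M := by ring
        have := Nat.zero_le (M * c)
        omega
    · have : 2 ^ m ≤ 4 := (Nat.pow_le_pow_right (by norm_num) hm).trans (by norm_num)
      rw [fftScale_of_le_four this, fftScale_of_le_four this]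

/-- Doubling size and residue keeps the angle at every level of the recursion. The one base case
beyond the trivial scale factors is size `8`, where an even frequency is a multiple of the period
`2`. -/
theorem fftScale_two_mul (m k : ℕ) : fftScale (2 ^ (m + 1)) (2 * k) = fftScale (2 ^ m) k := by
  induction m using Nat.strong_induction_on generalizing k with
  | _ m ih =>
    rcases Nat.lt_or_ge 2 m with hm | hm
    · obtain ⟨n, rfl⟩ : ∃ n, m = n + 2 := ⟨m - 2, by omega⟩
      have hM : 1 < 2 ^ n := Nat.one_lt_two_pow (by omega)
      have hM' : 1 < 2 ^ (n + 1) := Nat.one_lt_two_pow (by omega)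
      rw [show 2 ^ (n + 2 + 1) = 4 * 2 ^ (n + 1) by ring, show 2 ^ (n + 2) = 4 * 2 ^ n by ring,
        fftScale_four_mul hM, fftScale_four_mul hM']
      have hmod : 2 * k % 2 ^ (n + 1) = 2 * (k % 2 ^ n) := by
        rw [pow_succ', Nat.mul_mod_mul_left]
      have harg : 2 * π * ((2 * (k % 2 ^ n) : ℕ) : ℝ) / (4 * (2 ^ (n + 1) : ℕ)) =
          2 * π * ((k % 2 ^ n : ℕ) : ℝ) / (4 * (2 ^ n : ℕ)) := by
        push_cast
        rw [pow_succ]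
        field_simp
      rw [hmod, ih n (by omega), harg]
      congr 1
      exact if_congr (by rw [pow_succ']; omega) rfl rfl
    · rw [fftScale_of_le_four ((Nat.pow_le_pow_right (by norm_num) hm).trans (by norm_num))]
      rcases Nat.lt_or_ge m 2 with h | h
      · exact fftScale_of_le_four
          ((Nat.pow_le_pow_right (by norm_num) (by omega : m + 1 ≤ 2)).trans (by norm_num)) _
      · obtain rfl : m = 2 := by omega
        exact fftScale_of_dvd (M := 2) (Dvd.intro k rfl)

end fftScale

/-! ### Cosines outside of cyclotomic fields -/

section Cyclotomic

open Complex IntermediateField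

/-- The field generated by the roots of unity of order `2 ^ n`. -/
noncomputable def twoPowCyclotomic (n : ℕ) : IntermediateField ℚ ℂ :=
  ℚ⟮exp (2 * Real.pi * I / (2 ^ n : ℕ))⟯

theorem isPrimitiveRoot_two_pow (n : ℕ) :
    IsPrimitiveRoot (exp (2 * Real.pi * I / (2 ^ n : ℕ))) (2 ^ n) :=
  isPrimitiveRoot_exp _ (by positivity)

theorem finrank_twoPowCyclotomic (n : ℕ) :
    Module.finrank ℚ (twoPowCyclotomic (n + 1)) = 2 ^ n := by
  have h := isPrimitiveRoot_two_pow (n + 1)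
  rw [twoPowCyclotomic, adjoin.finrank (h.isIntegral (by positivity)).tower_top,
    ← Polynomial.cyclotomic_eq_minpoly_rat h (by positivity), Polynomial.natDegree_cyclotomic,
    Nat.totient_prime_pow_succ Nat.prime_two]
  simp

theorem exp_mem_twoPowCyclotomic (n k : ℕ) :
    exp (2 * Real.pi * k / (2 ^ n : ℕ) * I) ∈ twoPowCyclotomic n := by
  have h : exp (2 * Real.pi * k / (2 ^ n : ℕ) * I) = exp (2 * Real.pi * I / (2 ^ n : ℕ)) ^ k := by
    rw [← exp_nat_mul]
    congr 1
    ring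
  rw [h]
  exact pow_mem (mem_adjoin_simple_self ℚ _) k

theorem twoPowCyclotomic_mono {m n : ℕ} (h : m ≤ n) : twoPowCyclotomic m ≤ twoPowCyclotomic n := by
  rw [twoPowCyclotomic, adjoin_simple_le_iff]
  have := exp_mem_twoPowCyclotomic n (2 ^ (n - m))
  convert this using 2
  obtain ⟨d, rfl⟩ := Nat.exists_eq_add_of_le h
  push_cast
  rw [Nat.add_sub_cancel_left, pow_add]
  field_simp

theorem cos_mem_twoPowCyclotomic (n k : ℕ) :
    ((Real.cos (2 * Real.pi * k / (2 ^ n : ℕ)) : ℝ) : ℂ) ∈ twoPowCyclotomic n := by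
  have h := exp_mem_twoPowCyclotomic n k
  push_cast at h ⊢
  rw [Complex.cos, neg_mul, exp_neg]
  exact div_mem (add_mem h (inv_mem h)) (ofNat_mem _ 2)

/-- Let `z` be the primitive root with this cosine as real part. Then `z ^ 2` lies in the smaller
field, so if `z + z⁻¹` did, then `z = (z ^ 2 + 1) / (z + z⁻¹)` would too, although the degree
doubles from one field to the next. -/
theorem cos_notMem_twoPowCyclotomic {n k : ℕ} (hn : 2 ≤ n) (hk : Odd k) :
    ((Real.cos (2 * Real.pi * k / (2 ^ (n + 1) : ℕ)) : ℝ) : ℂ) ∉ twoPowCyclotomic n := by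
  intro hc
  set θ : ℂ := 2 * Real.pi * k / (2 ^ (n + 1) : ℕ) with hθ
  set z := exp (θ * I) with hz
  have hprim : IsPrimitiveRoot z (2 ^ (n + 1)) := by
    have h : z = exp (2 * Real.pi * I / (2 ^ (n + 1) : ℕ)) ^ k := by
      rw [← exp_nat_mul, hz, hθ]
      congr 1
      ring
    rw [h]
    exact (isPrimitiveRoot_two_pow (n + 1)).pow_of_coprime k
      (Nat.Coprime.pow_right _ (Nat.coprime_two_right.2 hk))
  have hz0 : z ≠ 0 := exp_ne_zero _
  have hcos : ((Real.cos (2 * Real.pi * k / (2 ^ (n + 1) : ℕ)) : ℝ) : ℂ) = (z + z⁻¹) / 2 := by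
    rw [ofReal_cos, Complex.cos, neg_mul, exp_neg, hz, hθ]
    push_cast
    rfl
  rw [hcos] at hc
  have hc' : z + z⁻¹ ∈ twoPowCyclotomic n := by
    have := mul_mem hc (ofNat_mem _ 2)
    rwa [div_mul_cancel₀ _ two_ne_zero] at this
  have hsq : z ^ 2 ∈ twoPowCyclotomic n := by
    have := exp_mem_twoPowCyclotomic n k
    convert this using 1
    rw [hz, ← exp_nat_mul, hθ]
    congr 1
    push_cast
    rw [pow_succ]
    field_simp
  -- This is where `2 ≤ n` enters: the order of `z` is at least `8`, so `z ^ 2 ≠ -1`.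
  have hne : z + z⁻¹ ≠ 0 := by
    intro h
    have h2 : z ^ 2 = -1 := by
      field_simp at h
      linear_combination h
    have h4 : z ^ 4 = 1 := by
      rw [show (4 : ℕ) = 2 * 2 by norm_num, pow_mul, h2]
      norm_num
    have hle := Nat.le_of_dvd (by norm_num) (hprim.dvd_of_pow_eq_one 4 h4)
    have : 2 ^ 3 ≤ 2 ^ (n + 1) := Nat.pow_le_pow_right (by norm_num) (by omega)
    omega
  have hzm : z ∈ twoPowCyclotomic n := by
    have h : z = (z ^ 2 + 1) / (z + z⁻¹) := by
      rw [eq_div_iff hne, mul_add, mul_inv_cancel₀ hz0]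
      ring
    rw [h]
    exact div_mem (add_mem hsq (one_mem _)) hc'
  have hle : twoPowCyclotomic (n + 1) ≤ twoPowCyclotomic n := by
    rw [twoPowCyclotomic, adjoin_simple_le_iff]
    obtain ⟨i, _, hi⟩ := hprim.eq_pow_of_pow_eq_one (isPrimitiveRoot_two_pow (n + 1)).pow_eq_one
    rw [← hi]
    exact pow_mem hzm i
  obtain ⟨d, rfl⟩ : ∃ d, n = d + 1 := ⟨n - 1, by omega⟩
  have hfin : FiniteDimensional ℚ (twoPowCyclotomic (d + 1)) :=
    Module.finite_of_finrank_pos (by rw [finrank_twoPowCyclotomic]; positivity)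
  have h := finrank_le_of_le_right hle
  rw [finrank_twoPowCyclotomic, finrank_twoPowCyclotomic] at h
  exact absurd h (not_le.2 (Nat.pow_lt_pow_right (by norm_num) (by omega)))

/-- Both cases of the recursion become a cosine, with `a = k` or `a = 2 ^ n - k`, of the same parity
as `k`. -/
theorem exists_fftScale_factor {n : ℕ} (hn : 1 ≤ n) {k : ℕ} (hk : k < 2 ^ n) :
    ∃ a : ℕ, (Odd k → Odd a) ∧ fftScale (2 ^ (n + 2)) k =
      fftScale (2 ^ n) k * Real.cos (2 * Real.pi * a / (2 ^ (n + 2) : ℕ)) := by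
  have hM : 1 < 2 ^ n := Nat.one_lt_two_pow (by omega)
  have hpow : (2 ^ (n + 2) : ℕ) = 4 * 2 ^ n := by ring
  have hcast : ((2 ^ (n + 2) : ℕ) : ℝ) = 4 * (2 ^ n : ℕ) := by push_cast; ring
  rw [hcast, hpow, fftScale_four_mul hM, Nat.mod_eq_of_lt hk]
  split_ifs with h
  · exact ⟨k, fun h => h, rfl⟩
  · refine ⟨2 ^ n - k, fun h => ?_, ?_⟩
    · exact Nat.Even.sub_odd hk.le (even_two.pow_of_ne_zero (by omega)) h
    · rw [sin_eq_cos_of_add_eq (by omega) (Nat.sub_add_cancel hk.le)]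

theorem fftScale_mem_twoPowCyclotomic (m k : ℕ) :
    ((fftScale (2 ^ m) k : ℝ) : ℂ) ∈ twoPowCyclotomic m := by
  induction m using Nat.strong_induction_on generalizing k with
  | _ m ih =>
    rcases Nat.lt_or_ge 2 m with hm | hm
    · obtain ⟨n, rfl⟩ : ∃ n, m = n + 2 := ⟨m - 2, by omega⟩
      have hmod : fftScale (2 ^ (n + 2)) k = fftScale (2 ^ (n + 2)) (k % 2 ^ n) := by
        rw [show 2 ^ (n + 2) = 4 * 2 ^ n by ring]
        exact fftScale_mod_eq (Nat.mod_mod _ _).symm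
      obtain ⟨a, _, ha⟩ := exists_fftScale_factor (n := n) (by omega)
        (Nat.mod_lt k (by positivity : 2 ^ n > 0))
      rw [hmod, ha, ofReal_mul]
      exact mul_mem (twoPowCyclotomic_mono (by omega) (ih n (by omega) _))
        (cos_mem_twoPowCyclotomic _ _)
    · rw [fftScale_of_le_four ((Nat.pow_le_pow_right (by norm_num) hm).trans (by norm_num)),
        ofReal_one]
      exact one_mem _

/-- Halving both size and frequency reduces to odd `k`. Then `s_{2N,k} = s_{N/2,k} cos(2πa/2N)` with
`a` odd; if this were `s_{N,k}`, the cosine would be a quotient of elements of the field of `N`-th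
roots of unity. The lemma makes the extra scaling in the `s_{2N}` variant cost a real
multiplication. -/
theorem fftScale_ne_fftScale {m k : ℕ} (hk0 : 0 < k) (hk : k < 2 ^ m) :
    fftScale (2 ^ (m + 2)) k ≠ fftScale (2 ^ (m + 3)) k := by
  induction m generalizing k with
  | zero => simp at hk; omega
  | succ m ih =>
    rcases Nat.even_or_odd k with h | h
    · obtain ⟨l, rfl⟩ := h.two_dvd
      rw [fftScale_two_mul (m + 1 + 1), fftScale_two_mul (m + 1 + 2)]
      exact ih (by omega) (by rw [pow_succ] at hk; omega)
    · obtain ⟨a, ha, hk'⟩ := exists_fftScale_factor (n := m + 2) (by omega)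
        (hk.trans (Nat.pow_lt_pow_right (by norm_num) (by omega)))
      intro heq
      refine cos_notMem_twoPowCyclotomic (n := m + 3) (by omega) (ha h) ?_
      have hmem := fftScale_mem_twoPowCyclotomic (m + 3) k
      have hmem' := twoPowCyclotomic_mono (by omega : m + 2 ≤ m + 3)
        (fftScale_mem_twoPowCyclotomic (m + 2) k)
      have hne : ((fftScale (2 ^ (m + 2)) k : ℝ) : ℂ) ≠ 0 :=
        ofReal_ne_zero.2 (fftScale_ne_zero _ _)
      have := div_mem hmem hmem'
      rw [show m + 3 = m + 1 + 2 by omega, heq, hk', ofReal_mul,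
        mul_div_cancel_left₀ _ hne] at this
      exact this

/-- With `N = 2 ^ m`, for odd `k` the scale factor lies in the field of `N`-th roots of unity and
the cosine not even in that of `2N`-th ones. Used with `ε = ±1` for the last stage of the DCT-II. -/
theorem two_mul_cos_mul_fftScale_ne {m k : ℕ} (hk0 : 0 < k) (hk : k < 2 ^ m) (ε : ℚ) :
    2 * Real.cos (2 * Real.pi * k / (2 ^ (m + 2) : ℕ)) * fftScale (2 ^ m) k ≠ ε := by
  induction m generalizing k with
  | zero => simp at hk; omega
  | succ m ih =>
    rcases Nat.even_or_odd k with h | h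
    · obtain ⟨l, rfl⟩ := h.two_dvd
      have harg : 2 * Real.pi * ((2 * l : ℕ) : ℝ) / (2 ^ (m + 1 + 2) : ℕ) =
          2 * Real.pi * l / (2 ^ (m + 2) : ℕ) := by
        push_cast
        rw [show m + 1 + 2 = m + 2 + 1 by ring, pow_succ _ (m + 2)]
        field_simp
      rw [fftScale_two_mul, harg]
      exact ih (by omega) (by rw [pow_succ] at hk; omega)
    · intro heq
      refine cos_notMem_twoPowCyclotomic (n := m + 2) (by omega) h ?_
      have hmem := twoPowCyclotomic_mono (by omega : m + 1 ≤ m + 2)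
        (fftScale_mem_twoPowCyclotomic (m + 1) k)
      have hne := fftScale_ne_zero (2 ^ (m + 1)) k
      have hcos : Real.cos (2 * Real.pi * k / (2 ^ (m + 1 + 2) : ℕ)) =
          ε / (2 * fftScale (2 ^ (m + 1)) k) := by
        rw [← heq]
        field_simp
      have hcast := congrArg (fun r : ℝ => (r : ℂ)) hcos
      simp only [ofReal_div, ofReal_mul, ofReal_ratCast, ofReal_ofNat] at hcast
      rw [show m + 2 + 1 = m + 1 + 2 by ring, hcast]
      exact div_mem (_root_.algebraMap_mem (twoPowCyclotomic (m + 2)) ε)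
        (mul_mem (ofNat_mem _ 2) hmem)

end Cyclotomic

namespace HasFlops

theorem scaleAll {I : Type} [Fintype I] (d : I → ℝ) :
    HasFlops (fun (x : I → ℝ) i => d i * x i) (∑ i, mulCost (d i)) := by
  classical
  have h : ∀ s : Finset I, HasFlops (fun (x : I → ℝ) i => if i ∈ s then d i * x i else x i)
      (∑ i ∈ s, mulCost (d i)) := fun s => by
    induction s using Finset.induction_on with
    | empty => exact id.congr (by simp) rfl
    | insert a s ha ih =>
      refine ((scale a (d a)).comp ih).congr (fun x i => ?_)
        (by rw [Finset.sum_insert ha, add_comm])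
      by_cases hi : i = a
      · subst hi
        simp [ha]
      · simp [hi]
  exact (h univ).congr (by simp) rfl

/-! ### The butterflies of the real split-radix transform -/

/-- Multiplication of `x₄ + i x₅` by `1 - i t` and of `x₆ + i x₇` by `1 + i t`: the two conjugate
twiddle factors without their cosine. -/
theorem rotate (t : ℝ) :
    HasFlops (fun x : Fin 8 → ℝ => ![x 0, x 1, x 2, x 3, x 4 + t * x 5, x 5 - t * x 4,
      x 6 - t * x 7, x 7 + t * x 6]) (4 + 4 * mulCost t) := by
  refine ((pair (i := (6 : Fin 8)) (j := 7) (by decide) 1 (-t) t 1).comp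
    (pair (i := (4 : Fin 8)) (j := 5) (by decide) 1 t (-t) 1)).congr (fun x o => ?_) ?_
  · fin_cases o <;> simp [Function.update] <;> ring
  · rw [mulCost_neg, mulCost_one]
    ring

theorem sumDiff :
    HasFlops (fun x : Fin 8 → ℝ => ![x 0, x 1, x 2, x 3, x 4 + x 6, x 5 + x 7,
      x 4 - x 6, x 5 - x 7]) 4 := by
  refine ((pair (i := (5 : Fin 8)) (j := 7) (by decide) 1 1 1 (-1)).comp
    (pair (i := (4 : Fin 8)) (j := 6) (by decide) 1 1 1 (-1))).congr (fun x o => ?_) ?_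
  · fin_cases o <;> simp [Function.update] <;> ring
  · rw [mulCost_neg, mulCost_one]

/-- The signs produce the frequencies `k`, `N/4 + k`, `N/2 - k`, `N/4 - k` themselves rather than
their conjugates. The last two entries are the imaginary and then the real part of frequency `N/4 -
k`. -/
theorem butterfly :
    HasFlops (fun x : Fin 8 → ℝ => ![x 0 + x 4, x 1 + x 5, x 2 + x 7, -x 3 - x 6, x 0 - x 4,
      x 5 - x 1, x 3 - x 6, x 2 - x 7]) 8 := by
  have h1 : HasFlops (fun x : Fin 8 → ℝ => ![x 0 + x 4, x 1 + x 5, x 2, x 3, x 0 - x 4,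
      x 5 - x 1, x 6, x 7]) 4 := by
    refine ((pair (i := (0 : Fin 8)) (j := 4) (by decide) 1 1 1 (-1)).comp
      (pair (i := (1 : Fin 8)) (j := 5) (by decide) 1 1 (-1) 1)).congr (fun x o => ?_) ?_
    · fin_cases o <;> simp [Function.update] <;> ring
    · rw [mulCost_neg, mulCost_one]
  have h2 : HasFlops (fun x : Fin 8 → ℝ => ![x 0, x 1, x 2 + x 7, -x 3 - x 6, x 4, x 5,
      x 3 - x 6, x 2 - x 7]) 4 := by
    refine ((pair (i := (2 : Fin 8)) (j := 7) (by decide) 1 1 1 (-1)).comp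
      (pair (i := (3 : Fin 8)) (j := 6) (by decide) (-1) (-1) 1 (-1))).congr (fun x o => ?_) ?_
    · fin_cases o <;> simp [Function.update] <;> ring
    · rw [mulCost_neg, mulCost_one]
  refine (h1.comp h2).congr (fun x o => ?_) rfl
  fin_cases o <;> simp

/-- The combination of the frequencies `k`, `N/4 - k`, `N/4 + k` and `N/2 - k`: the rotations have
the tangent `t`, the sum and the difference are scaled by `c₁` and `c₂`, the results by `d`. -/
theorem combine (t c₁ c₂ : ℝ) (d : Fin 8 → ℝ) :
    HasFlops (fun x : Fin 8 → ℝ =>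
      let sr := c₁ * (x 4 + t * x 5 + (x 6 - t * x 7))
      let si := c₁ * (x 5 - t * x 4 + (x 7 + t * x 6))
      let dr := c₂ * (x 4 + t * x 5 - (x 6 - t * x 7))
      let di := c₂ * (x 5 - t * x 4 - (x 7 + t * x 6))
      ![d 0 * (x 0 + sr), d 1 * (x 1 + si), d 2 * (x 2 + di), d 3 * (-x 3 - dr), d 4 * (x 0 - sr),
        d 5 * (si - x 1), d 6 * (x 3 - dr), d 7 * (x 2 - di)])
      (16 + 4 * mulCost t + 2 * mulCost c₁ + 2 * mulCost c₂ + ∑ i, mulCost (d i)) := by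
  refine ((scaleAll d).comp (butterfly.comp ((scaleAll ![1, 1, 1, 1, c₁, c₁, c₂, c₂]).comp
    (sumDiff.comp (rotate t))))).congr (fun x o => ?_) ?_
  · fin_cases o <;> simp
  · simp only [Fin.sum_univ_eight]
    simp [mulCost_one]
    ring

/-- The combination of the frequencies `0`, `N/4` and `N/2`. -/
theorem combineReal (d₁ d₂ d₃ : ℝ) :
    HasFlops (fun x : Fin 4 → ℝ =>
      ![x 0 + (x 2 + x 3), d₁ * x 1, d₂ * (x 0 - (x 2 + x 3)), d₃ * (x 3 - x 2)])
      (4 + mulCost d₁ + mulCost d₂ + mulCost d₃) := by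
  refine ((scaleAll ![1, d₁, d₂, d₃]).comp
    ((pair (i := (0 : Fin 4)) (j := 2) (by decide) 1 1 1 (-1)).comp
    (pair (i := (2 : Fin 4)) (j := 3) (by decide) 1 1 (-1) 1))).congr (fun x o => ?_) ?_
  · fin_cases o <;> simp [Function.update] <;> ring_nf <;> simp
  · rw [Fin.sum_univ_four]
    simp [mulCost_one, mulCost_neg]
    ring

/-- The combination of the frequencies `N/8` and `3N/8`. -/
theorem combineEighth (c : ℝ) (d : Fin 4 → ℝ) :
    HasFlops (fun x : Fin 4 → ℝ =>
      ![d 0 * (x 0 + c * (x 2 + x 3)), d 1 * (x 1 + c * (x 3 - x 2)),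
        d 2 * (x 0 - c * (x 2 + x 3)), d 3 * (c * (x 3 - x 2) - x 1)])
      (6 + 2 * mulCost c + ∑ i, mulCost (d i)) := by
  have h : HasFlops (fun x : Fin 4 → ℝ => ![x 0 + x 2, x 1 + x 3, x 0 - x 2, x 3 - x 1]) 4 := by
    refine ((pair (i := (0 : Fin 4)) (j := 2) (by decide) 1 1 1 (-1)).comp
      (pair (i := (1 : Fin 4)) (j := 3) (by decide) 1 1 (-1) 1)).congr (fun x o => ?_) ?_
    · fin_cases o <;> simp [Function.update] <;> ring
    · rw [mulCost_neg, mulCost_one]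
  refine ((scaleAll d).comp (h.comp ((scaleAll ![1, 1, c, c]).comp
    (pair (i := (2 : Fin 4)) (j := 3) (by decide) 1 1 (-1) 1)))).congr (fun x o => ?_) ?_
  · fin_cases o <;> simp [Function.update] <;> ring_nf <;> simp
  · simp only [Fin.sum_univ_four]
    simp [mulCost_one, mulCost_neg]
    ring

end HasFlops

/-! ### The discrete Fourier transform of real numbers -/

section DFT

open Complex ComplexConjugate

theorem rootPow_add (M : ℕ) (a b : ℤ) : rootPow M (a + b) = rootPow M a * rootPow M b := by
  rw [rootPow, rootPow, rootPow, ← exp_add]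
  congr 1
  push_cast
  ring

theorem rootPow_zero (M : ℕ) : rootPow M 0 = 1 := by simp [rootPow]

theorem rootPow_eq (M : ℕ) (a : ℤ) : rootPow M a =
    ((Real.cos (2 * Real.pi * a / M) : ℝ) : ℂ) - ((Real.sin (2 * Real.pi * a / M) : ℝ) : ℂ) * I := by
  rw [ofReal_cos, ofReal_sin, Complex.cos_sub_sin_I, rootPow]
  congr 1
  push_cast
  ring

theorem rootPow_re (M : ℕ) (a : ℤ) : (rootPow M a).re = Real.cos (2 * Real.pi * a / M) := by
  rw [rootPow_eq]
  simp [-ofReal_cos, -ofReal_sin]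

theorem rootPow_im (M : ℕ) (a : ℤ) : (rootPow M a).im = -Real.sin (2 * Real.pi * a / M) := by
  rw [rootPow_eq]
  simp [-ofReal_cos, -ofReal_sin]

theorem rootPow_neg (M : ℕ) (a : ℤ) : rootPow M (-a) = conj (rootPow M a) := by
  apply Complex.ext
  · rw [conj_re, rootPow_re, rootPow_re, ← Real.cos_neg]
    congr 1
    push_cast
    ring
  · rw [conj_im, rootPow_im, rootPow_im, Int.cast_neg, mul_neg, neg_div, Real.sin_neg]

theorem rootPow_mul_mul {c M : ℕ} (hc : c ≠ 0) (a : ℤ) :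
    rootPow (c * M) (c * a) = rootPow M a := by
  have : (c : ℂ) ≠ 0 := by exact_mod_cast hc
  rw [rootPow, rootPow]
  congr 1
  push_cast
  by_cases hM : (M : ℂ) = 0
  · simp [hM]
  · field_simp

theorem rootPow_mul_self {M : ℕ} (hM : M ≠ 0) (a : ℤ) : rootPow M (M * a) = 1 := by
  have := rootPow_mul_mul (M := 1) hM a
  rw [mul_one] at this
  rw [this, rootPow, exp_eq_one_iff]
  exact ⟨-a, by push_cast; ring⟩

theorem rootPow_four : rootPow 4 1 = -I := by
  apply Complex.ext
  · rw [rootPow_re, show 2 * Real.pi * ((1 : ℤ) : ℝ) / (4 : ℕ) = Real.pi / 2 by push_cast; ring]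
    simp
  · rw [rootPow_im, show 2 * Real.pi * ((1 : ℤ) : ℝ) / (4 : ℕ) = Real.pi / 2 by push_cast; ring]
    simp

theorem rootPow_quarter {h : ℕ} (hh : h ≠ 0) : rootPow (4 * h) h = -I := by
  have := rootPow_mul_mul (M := 4) hh 1
  rwa [mul_one, mul_comm h 4, rootPow_four] at this

/-- The discrete Fourier transform `∑ n, x_n ω_N ^ (n k)` of real numbers. -/
noncomputable def dft (N : ℕ) (x : Fin N → ℝ) (k : ℤ) : ℂ :=
  ∑ n : Fin N, (x n : ℂ) * rootPow N ((n : ℕ) * k)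

theorem dft_neg {N : ℕ} (x : Fin N → ℝ) (k : ℤ) : dft N x (-k) = conj (dft N x k) := by
  simp only [dft, map_sum, map_mul, conj_ofReal]
  refine Finset.sum_congr rfl fun n _ => ?_
  rw [← rootPow_neg, mul_neg]

theorem dft_add_self {N : ℕ} (x : Fin N → ℝ) (k : ℤ) : dft N x (k + N) = dft N x k := by
  refine Finset.sum_congr rfl fun n _ => ?_
  have hN : N ≠ 0 := by have := n.2; omega
  rw [mul_add, rootPow_add, mul_comm ((n : ℕ) : ℤ) (N : ℤ), rootPow_mul_self hN, mul_one]

theorem dft_sub {N : ℕ} (x : Fin N → ℝ) (k : ℤ) : dft N x (N - k) = conj (dft N x k) := by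
  rw [← dft_neg, ← dft_add_self x (-k)]
  congr 1
  ring

theorem dft_zero_im {N : ℕ} (x : Fin N → ℝ) : (dft N x 0).im = 0 := by
  have := congrArg Complex.im (dft_neg x 0)
  rw [neg_zero, conj_im] at this
  linarith

theorem dft_half_im {h : ℕ} (x : Fin (2 * h) → ℝ) : (dft (2 * h) x h).im = 0 := by
  have := congrArg Complex.im (dft_sub x h)
  rw [conj_im, show ((2 * h : ℕ) : ℤ) - h = h by push_cast; ring] at this
  linarith

/-- The indices `2 n`, `4 n + 1` and `4 n - 1` modulo `4 h`. -/
noncomputable def splitRadixEquiv (h : ℕ) : Fin (2 * h) ⊕ Fin h ⊕ Fin h ≃ Fin (4 * h) :=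
  Equiv.ofBijective
    (Sum.elim (fun n : Fin (2 * h) => (⟨2 * (n : ℕ), by omega⟩ : Fin (4 * h)))
      (Sum.elim (fun n : Fin h => (⟨4 * (n : ℕ) + 1, by omega⟩ : Fin (4 * h)))
      fun n : Fin h => if (n : ℕ) = 0 then ⟨4 * h - 1, by have := n.2; omega⟩
        else ⟨4 * (n : ℕ) - 1, by omega⟩))
    ((Fintype.bijective_iff_injective_and_card _).2 ⟨by
      rintro (a | a | a) (b | b | b) hab <;>
        simp only [Sum.elim_inl, Sum.elim_inr, Fin.ext_iff, apply_ite Fin.val] at hab <;>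
        (try split_ifs at hab) <;>
        first
        | (exfalso; omega)
        | (have : a = b := Fin.ext (by omega)
           rw [this]), by simp; ring⟩)

theorem splitRadixEquiv_even {h : ℕ} (n : Fin (2 * h)) :
    (splitRadixEquiv h (Sum.inl n) : ℕ) = 2 * n := rfl

theorem splitRadixEquiv_add {h : ℕ} (n : Fin h) :
    (splitRadixEquiv h (Sum.inr (Sum.inl n)) : ℕ) = 4 * n + 1 := rfl

theorem splitRadixEquiv_sub {h : ℕ} (n : Fin h) :
    ∃ c : ℤ, ((splitRadixEquiv h (Sum.inr (Sum.inr n)) : ℕ) : ℤ) = 4 * n - 1 + (4 * h : ℕ) * c := by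
  have hv : (splitRadixEquiv h (Sum.inr (Sum.inr n)) : ℕ) =
      if (n : ℕ) = 0 then 4 * h - 1 else 4 * n - 1 := by
    simp only [splitRadixEquiv, Equiv.ofBijective_apply, Sum.elim_inr, apply_ite Fin.val]
  rw [hv]
  have := n.2
  split_ifs with hn
  -- For `n = 0` the index `-1` wraps around to `4h - 1`.
  · exact ⟨1, by omega⟩
  · exact ⟨0, by omega⟩

/-- The decimation of the conjugate-pair split-radix algorithm. -/
theorem dft_splitRadix {h : ℕ} (x : Fin (4 * h) → ℝ) (k : ℤ) :
    dft (4 * h) x k = dft (2 * h) (fun n => x (splitRadixEquiv h (Sum.inl n))) k +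
      (rootPow (4 * h) k * dft h (fun n => x (splitRadixEquiv h (Sum.inr (Sum.inl n)))) k +
        rootPow (4 * h) (-k) *
          dft h (fun n => x (splitRadixEquiv h (Sum.inr (Sum.inr n)))) k) := by
  rw [dft, ← (splitRadixEquiv h).sum_comp, Fintype.sum_sum_type, Fintype.sum_sum_type]
  simp only [dft, Finset.mul_sum]
  congr 1
  · refine Finset.sum_congr rfl fun n _ => ?_
    rw [splitRadixEquiv_even, ← rootPow_mul_mul (c := 2) (M := 2 * h) (by norm_num),
      ← mul_assoc 2 2 h]
    congr 2
    push_cast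
    ring
  · congr 1
    · refine Finset.sum_congr rfl fun n _ => ?_
      rw [splitRadixEquiv_add, ← rootPow_mul_mul (c := 4) (M := h) (by norm_num), mul_left_comm,
        ← rootPow_add]
      congr 2
      push_cast
      ring
    · refine Finset.sum_congr rfl fun n _ => ?_
      have hh : 4 * h ≠ 0 := by have := n.2; omega
      obtain ⟨c, hc⟩ := splitRadixEquiv_sub n
      rw [hc, ← rootPow_mul_mul (c := 4) (M := h) (by norm_num), mul_left_comm,
        ← rootPow_add, add_mul, rootPow_add, mul_assoc (((4 * h : ℕ) : ℤ)), rootPow_mul_self hh,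
        mul_one]
      congr 2
      push_cast
      ring

/-- The discrete Fourier transform of real numbers, divided by scale factors `σ k`; position
`k ≤ N/2` holds the real part of frequency `k` and position `N - k` its imaginary part. -/
noncomputable def realDFT (N : ℕ) (σ : ℕ → ℝ) (x : Fin N → ℝ) (j : Fin N) : ℝ :=
  if 2 * (j : ℕ) ≤ N then (dft N x (j : ℕ)).re / σ j
  else (dft N x ((N - j : ℕ) : ℤ)).im / σ (N - j)

theorem realDFT_re {N : ℕ} (σ : ℕ → ℝ) (x : Fin N → ℝ) {j : Fin N} {k : ℕ} (hj : (j : ℕ) = k)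
    (hk : 2 * k ≤ N) : realDFT N σ x j = (dft N x k).re / σ k := by
  rw [realDFT, hj, if_pos hk]

theorem realDFT_im {N : ℕ} (σ : ℕ → ℝ) (x : Fin N → ℝ) {j : Fin N} {k : ℕ} (hj : (j : ℕ) + k = N)
    (hk : 2 * k < N) : realDFT N σ x j = (dft N x k).im / σ k := by
  rw [realDFT, if_neg (by omega), show N - (j : ℕ) = k by omega]

theorem scaledRealDFT_mulVec (N : ℕ) (x : Fin N → ℝ) :
    scaledRealDFT N *ᵥ x = realDFT N (fftScale N) x := by
  funext j
  simp only [Matrix.mulVec, dotProduct, scaledRealDFT, Matrix.of_apply, realDFT, dft]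
  split_ifs with h
  · rw [re_sum, Finset.sum_div]
    refine Finset.sum_congr rfl fun n _ => ?_
    rw [re_ofReal_mul]
    ring
  · rw [im_sum, Finset.sum_div]
    refine Finset.sum_congr rfl fun n _ => ?_
    rw [im_ofReal_mul]
    ring

end DFT

/-! ### Combining the subtransforms of the split-radix algorithm -/

section SplitRadix

open Complex ComplexConjugate

/-- The four frequencies that the split-radix step obtains from the frequencies `k` and `h - k` of
the even part `U` and the frequency `k` of the odd parts `P` and `Q`, with `c + i s = ω_{4h} ^ (-k)`. -/
theorem dft_splitRadix_re_im {h : ℕ} (hh : h ≠ 0) (x : Fin (4 * h) → ℝ) (k : ℤ) (U V P Q : ℂ)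
    (c s : ℝ)
    (hU : dft (2 * h) (fun n => x (splitRadixEquiv h (Sum.inl n))) k = U)
    (hV : dft (2 * h) (fun n => x (splitRadixEquiv h (Sum.inl n))) (h - k) = V)
    (hP : dft h (fun n => x (splitRadixEquiv h (Sum.inr (Sum.inl n)))) k = P)
    (hQ : dft h (fun n => x (splitRadixEquiv h (Sum.inr (Sum.inr n)))) k = Q)
    (hc : c = Real.cos (2 * Real.pi * k / (4 * h : ℕ)))
    (hs : s = Real.sin (2 * Real.pi * k / (4 * h : ℕ))) :
    ((dft (4 * h) x k).re = U.re + (c * P.re + s * P.im + (c * Q.re - s * Q.im)) ∧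
      (dft (4 * h) x k).im = U.im + (c * P.im - s * P.re + (c * Q.im + s * Q.re))) ∧
    ((dft (4 * h) x (2 * h - k)).re = U.re - (c * P.re + s * P.im + (c * Q.re - s * Q.im)) ∧
      (dft (4 * h) x (2 * h - k)).im = (c * P.im - s * P.re + (c * Q.im + s * Q.re)) - U.im) ∧
    ((dft (4 * h) x (h + k)).re = V.re + (c * P.im - s * P.re - (c * Q.im + s * Q.re)) ∧
      (dft (4 * h) x (h + k)).im = -V.im - (c * P.re + s * P.im - (c * Q.re - s * Q.im))) ∧
    ((dft (4 * h) x (h - k)).re = V.re - (c * P.im - s * P.re - (c * Q.im + s * Q.re)) ∧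
      (dft (4 * h) x (h - k)).im = V.im - (c * P.re + s * P.im - (c * Q.re - s * Q.im))) := by
  have hw : rootPow (4 * h) k = (c : ℂ) - s * I := by rw [rootPow_eq, hc, hs]
  have hw' : rootPow (4 * h) (-k) = (c : ℂ) + s * I := by
    rw [rootPow_neg, hw]
    simp
  have hq : rootPow (4 * h) h = -I := rootPow_quarter hh
  have hq' : rootPow (4 * h) (-h) = I := by
    rw [rootPow_neg, hq]
    simp
  -- The odd parts have period `h`, and real data make reflected frequencies conjugate; so the
  -- values `U`, `V`, `P`, `Q` serve four frequencies.
  have hper : ∀ (y : Fin h → ℝ) (l : ℤ), dft h y (h + l) = dft h y l := fun y l => by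
    rw [add_comm, dft_add_self]
  have hsub : ∀ (y : Fin h → ℝ) (l : ℤ), dft h y (2 * h - l) = conj (dft h y l) := fun y l => by
    rw [← dft_sub, ← dft_add_self _ ((h : ℤ) - l)]
    congr 1
    ring
  have hUsub : dft (2 * h) (fun n => x (splitRadixEquiv h (Sum.inl n))) (2 * h - k) = conj U := by
    rw [← hU, ← dft_sub]
    push_cast
    rfl
  have hUadd : dft (2 * h) (fun n => x (splitRadixEquiv h (Sum.inl n))) (h + k) = conj V := by
    rw [← hV, ← dft_sub]
    push_cast
    congr 1
    ring
  have h2 : rootPow (4 * h) (2 * h - k) = -((c : ℂ) + s * I) := by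
    rw [show 2 * (h : ℤ) - k = h + (h + -k) by ring, rootPow_add, rootPow_add, hq, hw']
    linear_combination ((c : ℂ) + s * I) * I_mul_I
  have h2' : rootPow (4 * h) (-(2 * h - k)) = -((c : ℂ) - s * I) := by
    rw [show -(2 * (h : ℤ) - k) = -h + (-h + k) by ring, rootPow_add, rootPow_add, hq', hw]
    linear_combination ((c : ℂ) - s * I) * I_mul_I
  have h3 : rootPow (4 * h) (h + k) = -I * ((c : ℂ) - s * I) := by rw [rootPow_add, hq, hw]
  have h3' : rootPow (4 * h) (-(h + k)) = I * ((c : ℂ) + s * I) := by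
    rw [neg_add, rootPow_add, hq', hw']
  have h4 : rootPow (4 * h) (h - k) = -I * ((c : ℂ) + s * I) := by
    rw [sub_eq_add_neg, rootPow_add, hq, hw']
  have h4' : rootPow (4 * h) (-(h - k)) = I * ((c : ℂ) - s * I) := by
    rw [neg_sub, sub_eq_add_neg, rootPow_add, hq', hw, mul_comm]
  refine ⟨?_, ?_, ?_, ?_⟩
  · rw [dft_splitRadix, hU, hP, hQ, hw, hw']
    constructor <;> simp <;> ring
  · rw [dft_splitRadix, hUsub, hsub, hsub, hP, hQ, h2, h2']
    constructor <;> simp <;> ring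
  · rw [dft_splitRadix, hUadd, hper, hper, hP, hQ, h3, h3']
    constructor <;> simp <;> ring
  · rw [dft_splitRadix, hV, dft_sub, dft_sub, hP, hQ, h4, h4']
    constructor <;> simp <;> ring

/-- Grouping of the data of the three subtransforms by the frequencies that are combined. -/
noncomputable def combineInEquiv (n : ℕ) : (Fin n × Fin 8) ⊕ Fin 4 ⊕ Fin 4 ≃
    Fin (2 * (2 * (n + 1))) ⊕ Fin (2 * (n + 1)) ⊕ Fin (2 * (n + 1)) :=
  Equiv.ofBijective
    -- With `N = 8 (n + 1)` and `k = a.1 + 1 < N/8`, the eight entries are real and imaginary parts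
    -- of `U_k`, `U_{N/4-k}`, `P_k`, `Q_k`. The special groups belong to `k = 0` and `k = N/8`,
    -- where `P` and `Q` are real.
    (Sum.elim (fun a : Fin n × Fin 8 =>
      (![Sum.inl ⟨a.1 + 1, by omega⟩, Sum.inl ⟨4 * (n + 1) - (a.1 + 1), by omega⟩,
        Sum.inl ⟨2 * (n + 1) - (a.1 + 1), by omega⟩, Sum.inl ⟨2 * (n + 1) + (a.1 + 1), by omega⟩,
        Sum.inr (Sum.inl ⟨a.1 + 1, by omega⟩),
        Sum.inr (Sum.inl ⟨2 * (n + 1) - (a.1 + 1), by omega⟩),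
        Sum.inr (Sum.inr ⟨a.1 + 1, by omega⟩),
        Sum.inr (Sum.inr ⟨2 * (n + 1) - (a.1 + 1), by omega⟩)] :
        Fin 8 → Fin (2 * (2 * (n + 1))) ⊕ Fin (2 * (n + 1)) ⊕ Fin (2 * (n + 1))) a.2)
      (Sum.elim
        ![Sum.inl ⟨0, by omega⟩, Sum.inl ⟨2 * (n + 1), by omega⟩, Sum.inr (Sum.inl ⟨0, by omega⟩),
          Sum.inr (Sum.inr ⟨0, by omega⟩)]
        ![Sum.inl ⟨n + 1, by omega⟩, Sum.inl ⟨3 * (n + 1), by omega⟩,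
          Sum.inr (Sum.inl ⟨n + 1, by omega⟩), Sum.inr (Sum.inr ⟨n + 1, by omega⟩)]))
    ((Fintype.bijective_iff_surjective_and_card _).2 ⟨by
      rintro (⟨p, hp⟩ | ⟨p, hp⟩ | ⟨p, hp⟩)
      · by_cases h0 : p = 0
        · exact ⟨Sum.inr (Sum.inl 0), by simp [Fin.ext_iff]; omega⟩
        by_cases h1 : p < n + 1
        · exact ⟨Sum.inl (⟨p - 1, by omega⟩, 0), by simp [Fin.ext_iff]; omega⟩
        by_cases h2 : p = n + 1
        · exact ⟨Sum.inr (Sum.inr 0), by simp [Fin.ext_iff]; omega⟩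
        by_cases h3 : p < 2 * (n + 1)
        · exact ⟨Sum.inl (⟨2 * (n + 1) - p - 1, by omega⟩, 2), by simp [Fin.ext_iff]; omega⟩
        by_cases h4 : p = 2 * (n + 1)
        · exact ⟨Sum.inr (Sum.inl 1), by simp [Fin.ext_iff]; omega⟩
        by_cases h5 : p < 3 * (n + 1)
        · exact ⟨Sum.inl (⟨p - 2 * (n + 1) - 1, by omega⟩, 3), by simp [Fin.ext_iff]; omega⟩
        by_cases h6 : p = 3 * (n + 1)
        · exact ⟨Sum.inr (Sum.inr 1), by simp [Fin.ext_iff]; omega⟩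
        exact ⟨Sum.inl (⟨4 * (n + 1) - p - 1, by omega⟩, 1), by simp [Fin.ext_iff]; omega⟩
      · by_cases h0 : p = 0
        · exact ⟨Sum.inr (Sum.inl 2), by simp [Fin.ext_iff]; omega⟩
        by_cases h1 : p < n + 1
        · exact ⟨Sum.inl (⟨p - 1, by omega⟩, 4), by simp [Fin.ext_iff]; omega⟩
        by_cases h2 : p = n + 1
        · exact ⟨Sum.inr (Sum.inr 2), by simp [Fin.ext_iff]; omega⟩
        exact ⟨Sum.inl (⟨2 * (n + 1) - p - 1, by omega⟩, 5), by simp [Fin.ext_iff]; omega⟩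
      · by_cases h0 : p = 0
        · exact ⟨Sum.inr (Sum.inl 3), by simp [Fin.ext_iff]; omega⟩
        by_cases h1 : p < n + 1
        · exact ⟨Sum.inl (⟨p - 1, by omega⟩, 6), by simp [Fin.ext_iff]; omega⟩
        by_cases h2 : p = n + 1
        · exact ⟨Sum.inr (Sum.inr 3), by simp [Fin.ext_iff]; omega⟩
        exact ⟨Sum.inl (⟨2 * (n + 1) - p - 1, by omega⟩, 7), by simp [Fin.ext_iff]; omega⟩, by simp; ring⟩)

/-- The positions of the results of the combination. -/
noncomputable def combineOutEquiv (n : ℕ) :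
    (Fin n × Fin 8) ⊕ Fin 4 ⊕ Fin 4 ≃ Fin (4 * (2 * (n + 1))) :=
  Equiv.ofBijective
    (Sum.elim (fun a : Fin n × Fin 8 =>
      (![⟨a.1 + 1, by omega⟩, ⟨8 * (n + 1) - (a.1 + 1), by omega⟩,
        ⟨2 * (n + 1) + (a.1 + 1), by omega⟩, ⟨6 * (n + 1) - (a.1 + 1), by omega⟩,
        ⟨4 * (n + 1) - (a.1 + 1), by omega⟩, ⟨4 * (n + 1) + (a.1 + 1), by omega⟩,
        ⟨6 * (n + 1) + (a.1 + 1), by omega⟩, ⟨2 * (n + 1) - (a.1 + 1), by omega⟩] :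
        Fin 8 → Fin (4 * (2 * (n + 1)))) a.2)
      (Sum.elim
        ![⟨0, by omega⟩, ⟨2 * (n + 1), by omega⟩, ⟨4 * (n + 1), by omega⟩,
          ⟨6 * (n + 1), by omega⟩]
        ![⟨n + 1, by omega⟩, ⟨7 * (n + 1), by omega⟩, ⟨3 * (n + 1), by omega⟩,
          ⟨5 * (n + 1), by omega⟩]))
    ((Fintype.bijective_iff_surjective_and_card _).2 ⟨by
      rintro ⟨p, hp⟩
      by_cases h0 : p = 0
      · exact ⟨Sum.inr (Sum.inl 0), by simp [Fin.ext_iff]; omega⟩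
      by_cases h1 : p < n + 1
      · exact ⟨Sum.inl (⟨p - 1, by omega⟩, 0), by simp [Fin.ext_iff]; omega⟩
      by_cases h2 : p = n + 1
      · exact ⟨Sum.inr (Sum.inr 0), by simp [Fin.ext_iff]; omega⟩
      by_cases h3 : p < 2 * (n + 1)
      · exact ⟨Sum.inl (⟨2 * (n + 1) - p - 1, by omega⟩, 7), by simp [Fin.ext_iff]; omega⟩
      by_cases h4 : p = 2 * (n + 1)
      · exact ⟨Sum.inr (Sum.inl 1), by simp [Fin.ext_iff]; omega⟩
      by_cases h5 : p < 3 * (n + 1)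
      · exact ⟨Sum.inl (⟨p - 2 * (n + 1) - 1, by omega⟩, 2), by simp [Fin.ext_iff]; omega⟩
      by_cases h6 : p = 3 * (n + 1)
      · exact ⟨Sum.inr (Sum.inr 2), by simp [Fin.ext_iff]; omega⟩
      by_cases h7 : p < 4 * (n + 1)
      · exact ⟨Sum.inl (⟨4 * (n + 1) - p - 1, by omega⟩, 4), by simp [Fin.ext_iff]; omega⟩
      by_cases h8 : p = 4 * (n + 1)
      · exact ⟨Sum.inr (Sum.inl 2), by simp [Fin.ext_iff]; omega⟩
      by_cases h9 : p < 5 * (n + 1)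
      · exact ⟨Sum.inl (⟨p - 4 * (n + 1) - 1, by omega⟩, 5), by simp [Fin.ext_iff]; omega⟩
      by_cases h10 : p = 5 * (n + 1)
      · exact ⟨Sum.inr (Sum.inr 3), by simp [Fin.ext_iff]; omega⟩
      by_cases h11 : p < 6 * (n + 1)
      · exact ⟨Sum.inl (⟨6 * (n + 1) - p - 1, by omega⟩, 3), by simp [Fin.ext_iff]; omega⟩
      by_cases h12 : p = 6 * (n + 1)
      · exact ⟨Sum.inr (Sum.inl 3), by simp [Fin.ext_iff]; omega⟩
      by_cases h13 : p < 7 * (n + 1)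
      · exact ⟨Sum.inl (⟨p - 6 * (n + 1) - 1, by omega⟩, 6), by simp [Fin.ext_iff]; omega⟩
      by_cases h14 : p = 7 * (n + 1)
      · exact ⟨Sum.inr (Sum.inr 1), by simp [Fin.ext_iff]; omega⟩
      exact ⟨Sum.inl (⟨8 * (n + 1) - p - 1, by omega⟩, 1), by simp [Fin.ext_iff]; omega⟩, by simp; ring⟩)

end SplitRadix

/-! ### One recursion step for scaled real transforms -/

section SplitRadixStep

theorem HasFlops.realDFT_one {σ : ℕ → ℝ} (hσ : σ 0 = 1) : HasFlops (realDFT 1 σ) 0 := by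
  refine HasFlops.id.congr (fun x o => ?_) rfl
  obtain rfl : o = 0 := Subsingleton.elim _ _
  rw [realDFT_re σ x (k := 0) rfl (by norm_num), hσ]
  simp [dft, rootPow_zero]

theorem HasFlops.realDFT_two {σ : ℕ → ℝ} (hσ : σ 0 = 1) :
    HasFlops (realDFT 2 σ) (2 + mulCost (1 / σ 1)) := by
  refine ((HasFlops.scaleAll ![1, 1 / σ 1]).comp
    (HasFlops.pair (i := (0 : Fin 2)) (j := 1) (by decide) 1 1 1 (-1))).congr (fun x o => ?_) ?_
  · have h1 : rootPow 2 1 = -1 := by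
      have h := rootPow_add 4 1 1
      rw [rootPow_four, show (1 : ℤ) + 1 = (2 : ℕ) * 1 by norm_num, show 4 = 2 * 2 by norm_num,
        rootPow_mul_mul (by norm_num)] at h
      rw [h]
      simp
    fin_cases o
    · rw [realDFT_re σ x (k := 0) rfl (by norm_num), hσ]
      simp [dft, rootPow_zero, Function.update]
    · rw [realDFT_re σ x (k := 1) rfl (by norm_num)]
      simp [dft, rootPow_zero, Function.update, h1]
      ring
  · simp [Fin.sum_univ_two, mulCost_one, mulCost_neg]

/-- The split-radix step for natural numbers as frequencies. -/
theorem dft_splitRadix_nat {h : ℕ} (hh : h ≠ 0) (x : Fin (4 * h) → ℝ) (k k₂ k₃ k₄ : ℕ)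
    (hk₂ : k₂ + k = 2 * h) (hk₃ : k₃ = h + k) (hk₄ : k₄ + k = h) :
    ∃ U V P Q : ℂ,
    (dft (2 * h) (fun n => x (splitRadixEquiv h (Sum.inl n))) k = U ∧
      dft (2 * h) (fun n => x (splitRadixEquiv h (Sum.inl n))) k₄ = V ∧
      dft h (fun n => x (splitRadixEquiv h (Sum.inr (Sum.inl n)))) k = P ∧
      dft h (fun n => x (splitRadixEquiv h (Sum.inr (Sum.inr n)))) k = Q) ∧
    ∃ c s : ℝ, (c = Real.cos (2 * Real.pi * k / (4 * h : ℕ)) ∧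
      s = Real.sin (2 * Real.pi * k / (4 * h : ℕ))) ∧
    ((dft (4 * h) x k).re = U.re + (c * P.re + s * P.im + (c * Q.re - s * Q.im)) ∧
      (dft (4 * h) x k).im = U.im + (c * P.im - s * P.re + (c * Q.im + s * Q.re))) ∧
    ((dft (4 * h) x k₂).re = U.re - (c * P.re + s * P.im + (c * Q.re - s * Q.im)) ∧
      (dft (4 * h) x k₂).im = (c * P.im - s * P.re + (c * Q.im + s * Q.re)) - U.im) ∧
    ((dft (4 * h) x k₃).re = V.re + (c * P.im - s * P.re - (c * Q.im + s * Q.re)) ∧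
      (dft (4 * h) x k₃).im = -V.im - (c * P.re + s * P.im - (c * Q.re - s * Q.im))) ∧
    ((dft (4 * h) x k₄).re = V.re - (c * P.im - s * P.re - (c * Q.im + s * Q.re)) ∧
      (dft (4 * h) x k₄).im = V.im - (c * P.re + s * P.im - (c * Q.re - s * Q.im))) := by
  have e2 : (k₂ : ℤ) = 2 * h - k := by omega
  have e3 : (k₃ : ℤ) = h + k := by omega
  have e4 : (k₄ : ℤ) = h - k := by omega
  refine ⟨_, _, _, _, ⟨rfl, rfl, rfl, rfl⟩, _, _, ⟨rfl, rfl⟩, ?_⟩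
  rw [e2, e3, e4]
  exact dft_splitRadix_re_im hh x k _ _ _ _ _ _ rfl rfl rfl rfl rfl rfl

/-- Size `4` has no frequency `N/8`, so it is not an instance of the general step: the group of the
frequencies `0`, `N/4`, `N/2` is everything. -/
theorem HasFlops.realDFT_four {σ τ ρ : ℕ → ℝ} (hσ : σ 0 = 1) (hτ : τ 0 = 1) (hρ : ρ 0 = 1)
    (hτ1 : τ 1 ≠ 0) {cu cp : ℕ} (hU : HasFlops (realDFT 2 τ) cu) (hP : HasFlops (realDFT 1 ρ) cp) :
    HasFlops (realDFT 4 σ) (cu + 2 * cp + (4 + mulCost (τ 1 / σ 1) + mulCost (1 / σ 2) +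
      mulCost (1 / σ 1))) := by
  let e : Fin 4 ≃ Fin (2 * 1) ⊕ Fin 1 ⊕ Fin 1 :=
    Equiv.ofBijective ![Sum.inl 0, Sum.inl 1, Sum.inr (Sum.inl 0), Sum.inr (Sum.inr 0)]
      ((Fintype.bijective_iff_injective_and_card _).2 ⟨by decide, rfl⟩)
  refine ((combineReal (τ 1 / σ 1) (1 / σ 2) (1 / σ 1)).comp ((reindex e).comp
    ((hU.sum (hP.sum hP)).comp (reindex (splitRadixEquiv 1))))).congr (fun x o => ?_) (by ring)
  obtain ⟨U, V, P, Q, ⟨hU', hV', hP', hQ'⟩, c, s, ⟨hc, hs⟩, h1, h2, h3, -⟩ :=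
    dft_splitRadix_nat one_ne_zero x 0 2 1 1 rfl rfl rfl
  have hPi : P.im = 0 := hP' ▸ dft_zero_im _
  have hQi : Q.im = 0 := hQ' ▸ dft_zero_im _
  have hVi : V.im = 0 := hV' ▸ dft_half_im _
  obtain rfl : c = 1 := by simpa using hc
  obtain rfl : s = 0 := by simpa using hs
  set y : Fin 4 → ℝ := (Sum.elim (realDFT 2 τ ((x ∘ splitRadixEquiv 1) ∘ Sum.inl))
    (Sum.elim (realDFT 1 ρ (((x ∘ splitRadixEquiv 1) ∘ Sum.inr) ∘ Sum.inl))
      (realDFT 1 ρ (((x ∘ splitRadixEquiv 1) ∘ Sum.inr) ∘ Sum.inr)))) ∘ e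
  have y0 : y 0 = U.re := by
    rw [← hU', ← div_one (dft _ _ _).re, ← hτ]
    exact realDFT_re (N := 2) (j := 0) τ _ rfl (by norm_num)
  have y1 : y 1 = V.re / τ 1 := by
    rw [← hV']
    exact realDFT_re (N := 2) (j := 1) τ _ rfl (by norm_num)
  have y2 : y 2 = P.re := by
    rw [← hP', ← div_one (dft _ _ _).re, ← hρ]
    exact realDFT_re (N := 1) (j := 0) ρ _ rfl (by norm_num)
  have y3 : y 3 = Q.re := by
    rw [← hQ', ← div_one (dft _ _ _).re, ← hρ]
    exact realDFT_re (N := 1) (j := 0) ρ _ rfl (by norm_num)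
  rw [y0, y1, y2, y3]
  fin_cases o
  · refine Eq.trans ?_ (realDFT_re σ x (k := 0) rfl (by norm_num)).symm
    rw [h1.1, hσ, hPi, hQi]
    simp
  · refine Eq.trans ?_ (realDFT_re σ x (k := 1) rfl (by norm_num)).symm
    rw [h3.1, hPi, hQi]
    simp
    field_simp
  · refine Eq.trans ?_ (realDFT_re σ x (k := 2) rfl (by norm_num)).symm
    rw [h2.1, hPi, hQi]
    simp
    ring
  · refine Eq.trans ?_ (realDFT_im σ x (k := 1) rfl (by norm_num)).symm
    rw [h3.2, hPi, hQi, hVi]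
    simp
    ring

/-- Hence a generic tangent always counts as a multiplication. -/
theorem tan_pos_lt_one {θ : ℝ} (h0 : 0 < θ) (h : θ < Real.pi / 4) :
    0 < Real.sin θ / Real.cos θ ∧ Real.sin θ / Real.cos θ < 1 := by
  rw [← Real.tan_eq_sin_div_cos, ← Real.tan_pi_div_four]
  have hpi := Real.pi_pos
  exact ⟨Real.tan_pos_of_pos_of_lt_pi_div_two h0 (by linarith),
    Real.tan_lt_tan_of_lt_of_lt_pi_div_two (by linarith) (by linarith) h⟩

/-- A step of the split-radix algorithm for scaled discrete Fourier transforms of real numbers: the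
even part is scaled by `τ`, the odd parts by `ρ` and the result by `σ`. -/
theorem HasFlops.realDFT_step (n : ℕ) {σ τ ρ : ℕ → ℝ} (hσ0 : σ 0 = 1) (hτ0 : τ 0 = 1)
    (hρ0 : ρ 0 = 1) (hσ : ∀ k, σ k ≠ 0) (hτ : ∀ k, τ k ≠ 0) (hρ : ∀ k, ρ k ≠ 0) {cu cp α β : ℕ}
    (hU : HasFlops (realDFT (2 * (2 * (n + 1))) τ) cu)
    (hP : HasFlops (realDFT (2 * (n + 1)) ρ) cp)
    (hα : ∀ k, 0 < k → k ≤ n + 1 → ∀ l, l = k ∨ l = 2 * (n + 1) - k →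
      mulCost (ρ k * Real.cos (2 * Real.pi * k / (4 * (2 * (n + 1)) : ℕ)) / τ l) = α)
    (hβ : ∀ k, 0 < k → k < 2 * (n + 1) → ∀ l, l = k ∨ l = 4 * (n + 1) - k →
      mulCost (τ k / σ l) = β) :
    HasFlops (realDFT (4 * (2 * (n + 1))) σ)
      (cu + 2 * cp + n * (20 + 4 * α + 8 * β) + (10 + 2 * α + 4 * β) +
        (mulCost (τ (2 * (n + 1)) / σ (2 * (n + 1))) + mulCost (1 / σ (4 * (n + 1))) +
          mulCost (1 / σ (2 * (n + 1))))) := by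
  set θ : ℕ → ℝ := fun k => 2 * Real.pi * k / (4 * (2 * (n + 1)) : ℕ) with hθ
  have hθ1 : θ (n + 1) = Real.pi / 4 := by
    simp only [hθ]
    push_cast
    field_simp
  have hθlt : ∀ {k l : ℕ}, k < l → θ k < θ l := fun {k l} h => by
    have : (k : ℝ) < l := by exact_mod_cast h
    have := Real.pi_pos
    simp only [hθ]
    gcongr
  have hθ0 : θ 0 = 0 := by simp [hθ]
  have hcos : ∀ k ≤ n + 1, Real.cos (θ k) ≠ 0 := fun k hk => by
    have h1 : θ k ≤ Real.pi / 4 := by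
      rcases hk.lt_or_eq with h | rfl
      · exact hθ1 ▸ (hθlt h).le
      · exact hθ1.le
    have h0 : 0 ≤ θ k := by
      simp only [hθ]
      have := Real.pi_pos
      positivity
    have hpi := Real.pi_pos
    exact (Real.cos_pos_of_mem_Ioo ⟨by linarith, by linarith⟩).ne'
  -- The subtransforms deliver `U/τ` and `P/ρ`, `Q/ρ`. Pulling `τ_k` out of `X_k/σ_k` leaves the
  -- outer factor `τ_k/σ_k` and the inner factor `ρ_k cos θ_k / τ_k`; for the frequencies `N/4 ± k`
  -- the even part carries `τ` at `N/4 - k`.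
  have hgen : ∀ i : Fin n, HasFlops _ (20 + 4 * α + 8 * β) := fun i =>
    (combine (Real.sin (θ (i + 1)) / Real.cos (θ (i + 1)))
      (ρ (i + 1) * Real.cos (θ (i + 1)) / τ (i + 1))
      (ρ (i + 1) * Real.cos (θ (i + 1)) / τ (2 * (n + 1) - (i + 1)))
      ![τ (i + 1) / σ (i + 1), τ (i + 1) / σ (i + 1),
        τ (2 * (n + 1) - (i + 1)) / σ (2 * (n + 1) + (i + 1)),
        τ (2 * (n + 1) - (i + 1)) / σ (2 * (n + 1) + (i + 1)),
        τ (i + 1) / σ (4 * (n + 1) - (i + 1)), τ (i + 1) / σ (4 * (n + 1) - (i + 1)),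
        τ (2 * (n + 1) - (i + 1)) / σ (2 * (n + 1) - (i + 1)),
        τ (2 * (n + 1) - (i + 1)) / σ (2 * (n + 1) - (i + 1))]).congr (fun _ _ => rfl) (by
      have ht := tan_pos_lt_one (hθ0 ▸ hθlt (Nat.succ_pos i))
        (hθ1 ▸ hθlt (by omega : (i : ℕ) + 1 < n + 1))
      have e1 := mulCost_of_pos ht.1 ht.2.ne
      have e2 := hα (i + 1) (by omega) (by omega) _ (Or.inl rfl)
      have e3 := hα (i + 1) (by omega) (by omega) _ (Or.inr rfl)
      have e4 := hβ (i + 1) (by omega) (by omega) _ (Or.inl rfl)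
      have e5 := hβ (i + 1) (by omega) (by omega) _ (Or.inr rfl)
      have e6 := hβ (2 * (n + 1) - (i + 1)) (by omega) (by omega) _ (Or.inl rfl)
      have e7 := hβ (2 * (n + 1) - (i + 1)) (by omega) (by omega)
        (2 * (n + 1) + (i + 1)) (Or.inr (by omega))
      rw [e1, e2, e3, Fin.sum_univ_eight]
      simp only [Matrix.cons_val]
      rw [e4, e5, e6, e7]
      ring)
  have hreal := combineReal (τ (2 * (n + 1)) / σ (2 * (n + 1))) (1 / σ (4 * (n + 1)))
    (1 / σ (2 * (n + 1)))
  -- At `k = N/8` the tangent is `1` and `P`, `Q` are real, so the rotation needs no multiplication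
  -- of its own.
  have height : HasFlops _ (6 + 2 * α + 4 * β) :=
    (combineEighth (ρ (n + 1) * Real.cos (θ (n + 1)) / τ (n + 1))
      ![τ (n + 1) / σ (n + 1), τ (n + 1) / σ (n + 1), τ (n + 1) / σ (3 * (n + 1)),
        τ (n + 1) / σ (3 * (n + 1))]).congr (fun _ _ => rfl) (by
      have e2 := hα (n + 1) (by omega) (by omega) _ (Or.inl rfl)
      have e4 := hβ (n + 1) (by omega) (by omega) _ (Or.inl rfl)
      have e5 := hβ (n + 1) (by omega) (by omega) (3 * (n + 1)) (Or.inr (by omega))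
      rw [e2, Fin.sum_univ_four]
      simp only [Matrix.cons_val]
      rw [e4, e5]
      ring)
  refine ((reindex (combineOutEquiv n).symm).comp (((family hgen).sum (hreal.sum height)).comp
    ((reindex (combineInEquiv n)).comp ((hU.sum (hP.sum hP)).comp
      (reindex (splitRadixEquiv (2 * (n + 1)))))))).congr (fun x o => ?_) (by ring)
  obtain ⟨b, rfl⟩ := (combineOutEquiv n).surjective o
  beta_reduce
  set y := (Sum.elim
    (realDFT (2 * (2 * (n + 1))) τ ((x ∘ splitRadixEquiv (2 * (n + 1))) ∘ Sum.inl))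
    (Sum.elim
      (realDFT (2 * (n + 1)) ρ (((x ∘ splitRadixEquiv (2 * (n + 1))) ∘ Sum.inr) ∘ Sum.inl))
      (realDFT (2 * (n + 1)) ρ (((x ∘ splitRadixEquiv (2 * (n + 1))) ∘ Sum.inr) ∘ Sum.inr)))) ∘
    combineInEquiv n with hy
  simp only [Function.comp_apply, Equiv.symm_apply_apply]
  set xU := (x ∘ splitRadixEquiv (2 * (n + 1))) ∘ Sum.inl with hxU
  set xP := ((x ∘ splitRadixEquiv (2 * (n + 1))) ∘ Sum.inr) ∘ Sum.inl with hxP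
  set xQ := ((x ∘ splitRadixEquiv (2 * (n + 1))) ∘ Sum.inr) ∘ Sum.inr with hxQ
  clear hgen hreal height
  rcases b with ⟨i, a⟩ | a | a
  · obtain ⟨U, V, P, Q, ⟨hU', hV', hP', hQ'⟩, c, s, ⟨hc, hs⟩, h1, h2, h3, h4⟩ :=
      dft_splitRadix_nat (h := 2 * (n + 1)) (by omega) x (i + 1) (4 * (n + 1) - (i + 1))
        (2 * (n + 1) + (i + 1)) (2 * (n + 1) - (i + 1)) (by omega) (by omega) (by omega)
    have hc0 : c ≠ 0 := hc ▸ hcos (i + 1) (by omega)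
    have y0 : y (Sum.inl (i, 0)) = U.re / τ (i + 1) := by
      rw [← hU']
      exact realDFT_re (N := 2 * (2 * (n + 1))) (j := ⟨(i : ℕ) + 1, by omega⟩) τ xU rfl (by omega)
    have y1 : y (Sum.inl (i, 1)) = U.im / τ (i + 1) := by
      rw [← hU']
      exact realDFT_im (N := 2 * (2 * (n + 1))) (j := ⟨4 * (n + 1) - ((i : ℕ) + 1), by omega⟩) τ xU (by simp only; omega) (by omega)
    have y2 : y (Sum.inl (i, 2)) = V.re / τ (2 * (n + 1) - (i + 1)) := by
      rw [← hV']
      exact realDFT_re (N := 2 * (2 * (n + 1))) (j := ⟨2 * (n + 1) - ((i : ℕ) + 1), by omega⟩) τ xU rfl (by omega)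
    have y3 : y (Sum.inl (i, 3)) = V.im / τ (2 * (n + 1) - (i + 1)) := by
      rw [← hV']
      exact realDFT_im (N := 2 * (2 * (n + 1))) (j := ⟨2 * (n + 1) + ((i : ℕ) + 1), by omega⟩) τ xU (by simp only; omega) (by omega)
    have y4 : y (Sum.inl (i, 4)) = P.re / ρ (i + 1) := by
      rw [← hP']
      exact realDFT_re (N := 2 * (n + 1)) (j := ⟨(i : ℕ) + 1, by omega⟩) ρ xP rfl (by omega)
    have y5 : y (Sum.inl (i, 5)) = P.im / ρ (i + 1) := by
      rw [← hP']
      exact realDFT_im (N := 2 * (n + 1)) (j := ⟨2 * (n + 1) - ((i : ℕ) + 1), by omega⟩) ρ xP (by simp only; omega) (by omega)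
    have y6 : y (Sum.inl (i, 6)) = Q.re / ρ (i + 1) := by
      rw [← hQ']
      exact realDFT_re (N := 2 * (n + 1)) (j := ⟨(i : ℕ) + 1, by omega⟩) ρ xQ rfl (by omega)
    have y7 : y (Sum.inl (i, 7)) = Q.im / ρ (i + 1) := by
      rw [← hQ']
      exact realDFT_im (N := 2 * (n + 1)) (j := ⟨2 * (n + 1) - ((i : ℕ) + 1), by omega⟩) ρ xQ (by simp only; omega) (by omega)
    have hc' : Real.cos (θ (i + 1)) = c := hc.symm
    have hs' : Real.sin (θ (i + 1)) = s := hs.symm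
    have hρk := hρ (i + 1)
    have hτk := hτ (i + 1)
    have hτl := hτ (2 * (n + 1) - (i + 1))
    simp only [Sum.elim_inl]
    simp only [y0, y1, y2, y3, y4, y5, y6, y7, hc', hs']
    clear_value y
    clear y0 y1 y2 y3 y4 y5 y6 y7
    fin_cases a
    · refine Eq.trans ?_ (realDFT_re σ x (j := ⟨(i : ℕ) + 1, by omega⟩) (k := (i : ℕ) + 1)
        rfl (by omega)).symm
      have hσk := hσ ((i : ℕ) + 1)
      rw [h1.1]
      simp only [Matrix.cons_val, Fin.reduceFinMk]
      field_simp
      try ring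
    · refine Eq.trans ?_ (realDFT_im σ x (j := ⟨8 * (n + 1) - ((i : ℕ) + 1), by omega⟩) (k := (i : ℕ) + 1)
        (by simp only; omega) (by omega)).symm
      have hσk := hσ ((i : ℕ) + 1)
      rw [h1.2]
      simp only [Matrix.cons_val, Fin.reduceFinMk]
      field_simp
      try ring
    · refine Eq.trans ?_ (realDFT_re σ x (j := ⟨2 * (n + 1) + ((i : ℕ) + 1), by omega⟩) (k := 2 * (n + 1) + ((i : ℕ) + 1))
        rfl (by omega)).symm
      have hσk := hσ (2 * (n + 1) + ((i : ℕ) + 1))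
      rw [h3.1]
      simp only [Matrix.cons_val, Fin.reduceFinMk]
      field_simp
      try ring
    · refine Eq.trans ?_ (realDFT_im σ x (j := ⟨6 * (n + 1) - ((i : ℕ) + 1), by omega⟩) (k := 2 * (n + 1) + ((i : ℕ) + 1))
        (by simp only; omega) (by omega)).symm
      have hσk := hσ (2 * (n + 1) + ((i : ℕ) + 1))
      rw [h3.2]
      simp only [Matrix.cons_val, Fin.reduceFinMk]
      field_simp
      try ring
    · refine Eq.trans ?_ (realDFT_re σ x (j := ⟨4 * (n + 1) - ((i : ℕ) + 1), by omega⟩) (k := 4 * (n + 1) - ((i : ℕ) + 1))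
        rfl (by omega)).symm
      have hσk := hσ (4 * (n + 1) - ((i : ℕ) + 1))
      rw [h2.1]
      simp only [Matrix.cons_val, Fin.reduceFinMk]
      field_simp
      try ring
    · refine Eq.trans ?_ (realDFT_im σ x (j := ⟨4 * (n + 1) + ((i : ℕ) + 1), by omega⟩) (k := 4 * (n + 1) - ((i : ℕ) + 1))
        (by simp only; omega) (by omega)).symm
      have hσk := hσ (4 * (n + 1) - ((i : ℕ) + 1))
      rw [h2.2]
      simp only [Matrix.cons_val, Fin.reduceFinMk]
      field_simp
      try ring
    · refine Eq.trans ?_ (realDFT_im σ x (j := ⟨6 * (n + 1) + ((i : ℕ) + 1), by omega⟩) (k := 2 * (n + 1) - ((i : ℕ) + 1))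
        (by simp only; omega) (by omega)).symm
      have hσk := hσ (2 * (n + 1) - ((i : ℕ) + 1))
      rw [h4.2]
      simp only [Matrix.cons_val, Fin.reduceFinMk]
      field_simp
      try ring
    · refine Eq.trans ?_ (realDFT_re σ x (j := ⟨2 * (n + 1) - ((i : ℕ) + 1), by omega⟩) (k := 2 * (n + 1) - ((i : ℕ) + 1))
        rfl (by omega)).symm
      have hσk := hσ (2 * (n + 1) - ((i : ℕ) + 1))
      rw [h4.1]
      simp only [Matrix.cons_val, Fin.reduceFinMk]
      field_simp
      try ring
  · obtain ⟨U, V, P, Q, ⟨hU', hV', hP', hQ'⟩, c, s, ⟨hc, hs⟩, h1, h2, h3, -⟩ :=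
      dft_splitRadix_nat (h := 2 * (n + 1)) (by omega) x 0 (4 * (n + 1))
        (2 * (n + 1)) (2 * (n + 1)) (by omega) (by omega) (by omega)
    have hPi : P.im = 0 := hP' ▸ dft_zero_im _
    have hQi : Q.im = 0 := hQ' ▸ dft_zero_im _
    have hVi : V.im = 0 := hV' ▸ dft_half_im _
    obtain rfl : c = 1 := by simpa using hc
    obtain rfl : s = 0 := by simpa using hs
    have y0 : y (Sum.inr (Sum.inl 0)) = U.re := by
      rw [← hU', ← div_one (dft _ _ _).re, ← hτ0]
      exact realDFT_re (N := 2 * (2 * (n + 1))) (j := ⟨0, by omega⟩) τ xU rfl (by omega)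
    have y1 : y (Sum.inr (Sum.inl 1)) = V.re / τ (2 * (n + 1)) := by
      rw [← hV']
      exact realDFT_re (N := 2 * (2 * (n + 1))) (j := ⟨2 * (n + 1), by omega⟩) τ xU rfl (by omega)
    have y2 : y (Sum.inr (Sum.inl 2)) = P.re := by
      rw [← hP', ← div_one (dft _ _ _).re, ← hρ0]
      exact realDFT_re (N := 2 * (n + 1)) (j := ⟨0, by omega⟩) ρ xP rfl (by omega)
    have y3 : y (Sum.inr (Sum.inl 3)) = Q.re := by
      rw [← hQ', ← div_one (dft _ _ _).re, ← hρ0]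
      exact realDFT_re (N := 2 * (n + 1)) (j := ⟨0, by omega⟩) ρ xQ rfl (by omega)
    have hτl := hτ (2 * (n + 1))
    simp only [Sum.elim_inr]
    simp only [Sum.elim_inl, y0, y1, y2, y3]
    clear_value y
    clear y0 y1 y2 y3
    fin_cases a
    · refine Eq.trans ?_ (realDFT_re σ x (j := ⟨0, by omega⟩) (k := 0)
        rfl (by omega)).symm
      have hσk := hσ (0)
      rw [h1.1, hPi, hQi, hσ0]
      simp only [Matrix.cons_val, Fin.reduceFinMk]
      field_simp
      try ring
    · refine Eq.trans ?_ (realDFT_re σ x (j := ⟨2 * (n + 1), by omega⟩) (k := 2 * (n + 1))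
        rfl (by omega)).symm
      have hσk := hσ (2 * (n + 1))
      rw [h3.1, hPi, hQi]
      simp only [Matrix.cons_val, Fin.reduceFinMk]
      field_simp
      try ring
    · refine Eq.trans ?_ (realDFT_re σ x (j := ⟨4 * (n + 1), by omega⟩) (k := 4 * (n + 1))
        rfl (by omega)).symm
      have hσk := hσ (4 * (n + 1))
      rw [h2.1, hPi, hQi]
      simp only [Matrix.cons_val, Fin.reduceFinMk]
      field_simp
      try ring
    · refine Eq.trans ?_ (realDFT_im σ x (j := ⟨6 * (n + 1), by omega⟩) (k := 2 * (n + 1))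
        (by simp only; omega) (by omega)).symm
      have hσk := hσ (2 * (n + 1))
      rw [h3.2, hPi, hQi, hVi]
      simp only [Matrix.cons_val, Fin.reduceFinMk]
      field_simp
      try ring
  · obtain ⟨U, V, P, Q, ⟨hU', hV', hP', hQ'⟩, c, s, ⟨hc, hs⟩, h1, h2, h3, -⟩ :=
      dft_splitRadix_nat (h := 2 * (n + 1)) (by omega) x (n + 1) (3 * (n + 1))
        (3 * (n + 1)) (n + 1) (by omega) (by omega) (by omega)
    -- `N/8` is the middle frequency of the odd parts, whose size is `N/4`.
    have hPi : P.im = 0 := hP' ▸ dft_half_im _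
    have hQi : Q.im = 0 := hQ' ▸ dft_half_im _
    have hc' : Real.cos (θ (n + 1)) = c := hc.symm
    obtain rfl : s = c := by
      rw [← hc', hs]
      show Real.sin (θ (n + 1)) = _
      rw [hθ1, Real.sin_pi_div_four, Real.cos_pi_div_four]
    have hc0 : s ≠ 0 := hc ▸ hcos (n + 1) le_rfl
    have y0 : y (Sum.inr (Sum.inr 0)) = U.re / τ (n + 1) := by
      rw [← hU']
      exact realDFT_re (N := 2 * (2 * (n + 1))) (j := ⟨n + 1, by omega⟩) τ xU rfl (by omega)
    have y1 : y (Sum.inr (Sum.inr 1)) = U.im / τ (n + 1) := by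
      rw [← hU']
      exact realDFT_im (N := 2 * (2 * (n + 1))) (j := ⟨3 * (n + 1), by omega⟩) τ xU (by simp only; omega) (by omega)
    have y2 : y (Sum.inr (Sum.inr 2)) = P.re / ρ (n + 1) := by
      rw [← hP']
      exact realDFT_re (N := 2 * (n + 1)) (j := ⟨n + 1, by omega⟩) ρ xP rfl (by omega)
    have y3 : y (Sum.inr (Sum.inr 3)) = Q.re / ρ (n + 1) := by
      rw [← hQ']
      exact realDFT_re (N := 2 * (n + 1)) (j := ⟨n + 1, by omega⟩) ρ xQ rfl (by omega)
    have hρk := hρ (n + 1)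
    have hτk := hτ (n + 1)
    simp only [Sum.elim_inr]
    simp only [y0, y1, y2, y3, hc']
    clear_value y
    clear y0 y1 y2 y3
    fin_cases a
    · refine Eq.trans ?_ (realDFT_re σ x (j := ⟨n + 1, by omega⟩) (k := n + 1)
        rfl (by omega)).symm
      have hσk := hσ (n + 1)
      rw [h1.1, hPi, hQi]
      simp only [Matrix.cons_val, Fin.reduceFinMk]
      field_simp
      try ring
    · refine Eq.trans ?_ (realDFT_im σ x (j := ⟨7 * (n + 1), by omega⟩) (k := n + 1)
        (by simp only; omega) (by omega)).symm
      have hσk := hσ (n + 1)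
      rw [h1.2, hPi, hQi]
      simp only [Matrix.cons_val, Fin.reduceFinMk]
      field_simp
      try ring
    · refine Eq.trans ?_ (realDFT_re σ x (j := ⟨3 * (n + 1), by omega⟩) (k := 3 * (n + 1))
        rfl (by omega)).symm
      have hσk := hσ (3 * (n + 1))
      rw [h2.1, hPi, hQi]
      simp only [Matrix.cons_val, Fin.reduceFinMk]
      field_simp
      try ring
    · refine Eq.trans ?_ (realDFT_im σ x (j := ⟨5 * (n + 1), by omega⟩) (k := 3 * (n + 1))
        (by simp only; omega) (by omega)).symm
      have hσk := hσ (3 * (n + 1))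
      rw [h2.2, hPi, hQi]
      simp only [Matrix.cons_val, Fin.reduceFinMk]
      field_simp
      try ring

end SplitRadixStep

/-! ### The cost of the three scaled transforms -/

section FlopCount

/-- The new factor is the cosine or sine of an angle strictly between `0` and `π/2`. This certifies
that a quotient of the two scale factors is not `1`. -/
theorem fftScale_four_mul_lt {M k : ℕ} (hM : 1 < M) (hk : k % M ≠ 0) :
    fftScale (4 * M) k < fftScale M (k % M) := by
  rw [fftScale_four_mul hM]
  have hp := fftScale_pos M (k % M)
  have hr : k % M < M := Nat.mod_lt _ (by omega)
  set r := k % M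
  have hM0 : (0 : ℝ) < M := by exact_mod_cast (by omega : 0 < M)
  have hr0 : (0 : ℝ) < r := by exact_mod_cast (by omega : 0 < r)
  have hrM : (r : ℝ) < M := by exact_mod_cast hr
  have hpi := Real.pi_pos
  have h0 : 0 < 2 * Real.pi * (r : ℝ) / (4 * M) := by positivity
  have h1 : 2 * Real.pi * (r : ℝ) / (4 * M) < Real.pi / 2 := by
    rw [div_lt_iff₀ (by positivity)]
    nlinarith
  refine mul_lt_of_lt_one_right hp ?_
  split_ifs
  · rw [← Real.cos_zero]
    exact Real.cos_lt_cos_of_nonneg_of_le_pi_div_two le_rfl h1.le h0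
  · rw [← Real.sin_pi_div_two]
    exact Real.sin_lt_sin_of_lt_of_le_pi_div_two (by linarith) le_rfl h1

theorem mulCost_div_of_lt {a b : ℝ} (hb : 0 < b) (h : b < a) : mulCost (a / b) = 1 :=
  mulCost_of_pos (div_pos (hb.trans h) hb) ((one_lt_div hb).2 h).ne'

theorem mulCost_div_of_eq {a b : ℝ} (hb : b ≠ 0) (h : a = b) : mulCost (a / b) = 0 := by
  rw [h, div_self hb, mulCost_one]

/-- For size `N` the three scalings are `s_N`, `s_{2N}`, `s_{4N}`. The odd parts always use the
first scaling at size `N/4`; the even part of size `N/2` uses scale `s_N` (second kind) in the first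
and third transform and `s_{2N}` (third kind) in the second. So the three counts close up under one
strong induction. -/
theorem HasFlops.realDFT_two_pow (m : ℕ) : ∃ a b c : ℕ,
    (HasFlops (realDFT (2 ^ (m + 1)) (fftScale (2 ^ (m + 1)))) a ∧
      (a : ℝ) = 17 / 9 * 2 ^ (m + 1) * (m + 1) - 98 / 27 * 2 ^ (m + 1) -
        1 / 9 * (-1) ^ (m + 1) * (m + 1) + 7 / 54 * (-1) ^ (m + 1) + 11 / 2) ∧
    (HasFlops (realDFT (2 ^ (m + 1)) (fftScale (2 ^ (m + 2)))) b ∧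
      (b : ℝ) = 17 / 9 * 2 ^ (m + 1) * (m + 1) - 80 / 27 * 2 ^ (m + 1) -
        1 / 9 * (-1) ^ (m + 1) * (m + 1) + 25 / 54 * (-1) ^ (m + 1) + 9 / 2) ∧
    (HasFlops (realDFT (2 ^ (m + 1)) (fftScale (2 ^ (m + 3)))) c ∧
      (c : ℝ) = 17 / 9 * 2 ^ (m + 1) * (m + 1) - 71 / 27 * 2 ^ (m + 1) -
        1 / 9 * (-1) ^ (m + 1) * (m + 1) + 7 / 54 * (-1) ^ (m + 1) + 9 / 2) := by
  induction m using Nat.strong_induction_on with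
  | _ m ih =>
  have lt8 : fftScale 8 1 < 1 := by
    have := fftScale_four_mul_lt (M := 2) (k := 1) (by norm_num) (by norm_num)
    rwa [fftScale_of_le_four (N := 2) (by norm_num)] at this
  have lt16 : ∀ k, k % 4 ≠ 0 → fftScale 16 k < 1 := fun k hk => by
    have := fftScale_four_mul_lt (M := 4) (k := k) (by norm_num) hk
    rwa [fftScale_of_le_four (N := 4) (by norm_num)] at this
  have h4 : ∀ k, fftScale 4 k = 1 := fftScale_of_le_four le_rfl
  rcases m with _ | _ | m
  · refine ⟨2, 2, 3, ⟨(realDFT_two (fftScale_zero 2)).congr (fun _ _ => rfl) ?_, by norm_num⟩,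
      ⟨(realDFT_two (fftScale_zero 4)).congr (fun _ _ => rfl) ?_, by norm_num⟩,
      ⟨(realDFT_two (fftScale_zero 8)).congr (fun _ _ => rfl) ?_, by norm_num⟩⟩
    · rw [mulCost_div_of_eq (fftScale_ne_zero _ _) (fftScale_of_le_four (by norm_num) _).symm]
    · rw [mulCost_div_of_eq (fftScale_ne_zero _ _) (h4 1).symm]
    · rw [mulCost_div_of_lt (fftScale_pos _ _) lt8]
  · have hone := realDFT_one (fftScale_zero 1)
    have h2 := realDFT_two (fftScale_zero 4)
    rw [mulCost_div_of_eq (fftScale_ne_zero _ _) (h4 1).symm] at h2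
    have h3 := realDFT_two (fftScale_zero 8)
    rw [mulCost_div_of_lt (fftScale_pos _ _) lt8] at h3
    refine ⟨6, 8, 9,
      ⟨(realDFT_four (fftScale_zero 4) (fftScale_zero 4) (fftScale_zero 1)
        (fftScale_ne_zero 4 1) h2 hone).congr (fun _ _ => rfl) ?_, by norm_num⟩,
      ⟨(realDFT_four (fftScale_zero 8) (fftScale_zero 8) (fftScale_zero 1)
        (fftScale_ne_zero 8 1) h3 hone).congr (fun _ _ => rfl) ?_, by norm_num⟩,
      ⟨(realDFT_four (fftScale_zero 16) (fftScale_zero 4) (fftScale_zero 1)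
        (fftScale_ne_zero 4 1) h2 hone).congr (fun _ _ => rfl) ?_, by norm_num⟩⟩
    · rw [h4, h4]
      norm_num [mulCost_one]
    · rw [mulCost_div_of_eq (fftScale_ne_zero _ _) rfl,
        mulCost_div_of_eq (fftScale_ne_zero 8 2) (fftScale_of_dvd (M := 2) dvd_rfl).symm,
        mulCost_div_of_lt (fftScale_pos _ _) lt8]
    · rw [h4, mulCost_div_of_lt (fftScale_pos _ _) (lt16 1 (by norm_num)),
        mulCost_div_of_lt (fftScale_pos _ _) (lt16 2 (by norm_num))]
  · obtain ⟨-, b', c', -, ⟨hb', eb'⟩, hc', ec'⟩ := ih (m + 1) (by omega)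
    obtain ⟨a', -, -, ⟨ha', ea'⟩, -⟩ := ih m (by omega)
    -- The size is now `N = 2 ^ (m + 3) = 8 (n + 1)`, as in `HasFlops.realDFT_step`.
    obtain ⟨n, hn⟩ : ∃ n, 2 ^ m = n + 1 := ⟨2 ^ m - 1, (Nat.sub_add_cancel Nat.one_le_two_pow).symm⟩
    have p1 : 2 ^ (m + 1) = 2 * (n + 1) := by rw [← hn]; ring
    have p2 : 2 ^ (m + 1 + 1) = 2 * (2 * (n + 1)) := by rw [← hn]; ring
    have p3 : 2 ^ (m + 1 + 1 + 1) = 4 * (2 * (n + 1)) := by rw [← hn]; ring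
    have p4 : 2 ^ (m + 1 + 1 + 1 + 1) = 4 * (4 * (n + 1)) := by rw [← hn]; ring
    have p5 : 2 ^ (m + 1 + 1 + 1 + 1 + 1) = 4 * (8 * (n + 1)) := by rw [← hn]; ring
    have hnr : (n : ℝ) = 2 ^ m - 1 := by
      rw [eq_sub_iff_add_eq]
      exact_mod_cast hn.symm
    -- The purpose of the scale factors: `s_{N/4,k} cos θ_k = s_{N,k}` for `k ≤ N/8`.
    have hg : ∀ k, 0 < k → k ≤ n + 1 → fftScale (2 ^ (m + 1)) k *
        Real.cos (2 * Real.pi * k / (4 * (2 * (n + 1)) : ℕ)) = fftScale (2 ^ (m + 1 + 1 + 1)) k := by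
      intro k hk0 hk
      rw [p1, p3, fftScale_four_mul (by omega), Nat.mod_eq_of_lt (by omega), if_pos (by omega)]
      push_cast
      rfl
    have hg' : ∀ k, k ≤ n + 1 → fftScale (2 ^ (m + 1 + 1 + 1)) (2 * (n + 1) - k) =
        fftScale (2 ^ (m + 1 + 1 + 1)) k := fun k hk => by
      refine fftScale_symm _ ?_
      rw [Nat.sub_add_cancel (by omega), p3]
    have hs : ∀ k, k ≤ 4 * (n + 1) → fftScale (2 ^ (m + 3)) (4 * (n + 1) - k) =
        fftScale (2 ^ (m + 3)) k := fun k hk => by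
      refine fftScale_symm _ ?_
      rw [Nat.sub_add_cancel hk]
      exact ⟨2, by rw [show m + 3 = m + 1 + 1 + 1 by ring, p3]; ring⟩
    have hs' : ∀ k, k ≤ 4 * (n + 1) → fftScale (2 ^ (m + 4)) (4 * (n + 1) - k) =
        fftScale (2 ^ (m + 4)) k := fun k hk => by
      refine fftScale_symm _ ?_
      rw [Nat.sub_add_cancel hk, show m + 4 = m + 1 + 1 + 1 + 1 by ring, p4]
    have hone : ∀ k, 2 * (n + 1) ∣ k → fftScale (2 ^ (m + 3)) k = 1 := fun k hk => by
      rw [show m + 3 = m + 1 + 1 + 1 by ring, p3]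
      exact fftScale_of_dvd hk
    have hlt : ∀ k, 0 < k → k < 4 * (n + 1) → fftScale (2 ^ (m + 4)) k < fftScale (2 ^ (m + 2)) k :=
      fun k hk0 hk => by
      have h := fftScale_four_mul_lt (M := 4 * (n + 1)) (k := k) (by omega)
        (by rw [Nat.mod_eq_of_lt hk]; omega)
      rw [Nat.mod_eq_of_lt hk] at h
      rwa [show m + 4 = m + 1 + 1 + 1 + 1 by ring, p4, show m + 2 = m + 1 + 1 by ring, p2,
        show 2 * (2 * (n + 1)) = 4 * (n + 1) by ring]
    have hlt' : ∀ k, 0 < k → k < 8 * (n + 1) → fftScale (2 ^ (m + 5)) k < fftScale (2 ^ (m + 3)) k :=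
      fun k hk0 hk => by
      have h := fftScale_four_mul_lt (M := 8 * (n + 1)) (k := k) (by omega)
        (by rw [Nat.mod_eq_of_lt hk]; omega)
      rw [Nat.mod_eq_of_lt hk] at h
      rwa [show m + 5 = m + 1 + 1 + 1 + 1 + 1 by ring, p5, show m + 3 = m + 1 + 1 + 1 by ring, p3,
        show 4 * (2 * (n + 1)) = 8 * (n + 1) by ring]
    have hP : HasFlops (realDFT (2 * (n + 1)) (fftScale (2 ^ (m + 1)))) a' := by
      rw [← p1]
      exact ha'
    have hU2 : HasFlops (realDFT (2 * (2 * (n + 1))) (fftScale (2 ^ (m + 3)))) b' := by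
      rw [← p2]
      exact hb'
    have hU4 : HasFlops (realDFT (2 * (2 * (n + 1))) (fftScale (2 ^ (m + 4)))) c' := by
      rw [← p2]
      exact hc'
    have hα0 : ∀ k, 0 < k → k ≤ n + 1 → ∀ l, l = k ∨ l = 2 * (n + 1) - k →
        mulCost (fftScale (2 ^ (m + 1)) k *
          Real.cos (2 * Real.pi * k / (4 * (2 * (n + 1)) : ℕ)) / fftScale (2 ^ (m + 3)) l) = 0 := by
      intro k hk0 hk l hl
      refine mulCost_div_of_eq (fftScale_ne_zero _ _) ((hg k hk0 hk).trans ?_)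
      rcases hl with rfl | rfl
      · rfl
      · exact (hg' k hk).symm
    -- The constant is `s_{N,k}/s_{2N,l}` with `s_{N,k} = s_{N,l}`. No general inequality between
    -- these scalings is at hand, so the field argument decides.
    have hα1 : ∀ k, 0 < k → k ≤ n + 1 → ∀ l, l = k ∨ l = 2 * (n + 1) - k →
        mulCost (fftScale (2 ^ (m + 1)) k *
          Real.cos (2 * Real.pi * k / (4 * (2 * (n + 1)) : ℕ)) / fftScale (2 ^ (m + 4)) l) = 1 := by
      intro k hk0 hk l hl
      have hl' : 0 < l ∧ l < 2 ^ (m + 1) := by omega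
      have heq : fftScale (2 ^ (m + 1 + 2)) l = fftScale (2 ^ (m + 1 + 1 + 1)) k := by
        rcases hl with rfl | rfl
        · rfl
        · exact hg' k hk
      have hne := fftScale_ne_fftScale hl'.1 hl'.2
      rw [heq] at hne
      rw [hg k hk0 hk]
      refine mulCost_of_pos (div_pos (fftScale_pos _ _) (fftScale_pos _ _)) fun h => hne ?_
      exact (div_eq_one_iff_eq (fftScale_ne_zero _ _)).1 h
    -- Scale `s_N` throughout: the inner and outer constants are all `1`, only the tangents cost.
    have h1 := HasFlops.realDFT_step n (fftScale_zero (2 ^ (m + 3))) (fftScale_zero (2 ^ (m + 3)))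
      (fftScale_zero (2 ^ (m + 1))) (fftScale_ne_zero _) (fftScale_ne_zero _) (fftScale_ne_zero _)
      hU2 hP hα0 (β := 0) (fun k hk0 hk l hl => by
        refine mulCost_div_of_eq (fftScale_ne_zero _ _) ?_
        rcases hl with rfl | rfl
        · rfl
        · exact (hs k (by omega)).symm)
    -- Scale `s_{2N}`: the even part already has the scale of the result, and the inner constants
    -- cost.
    have h2 := HasFlops.realDFT_step n (fftScale_zero (2 ^ (m + 4))) (fftScale_zero (2 ^ (m + 4)))
      (fftScale_zero (2 ^ (m + 1))) (fftScale_ne_zero _) (fftScale_ne_zero _) (fftScale_ne_zero _)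
      hU4 hP hα1 (β := 0) (fun k hk0 hk l hl => by
        refine mulCost_div_of_eq (fftScale_ne_zero _ _) ?_
        rcases hl with rfl | rfl
        · rfl
        · exact (hs' k (by omega)).symm)
    -- Scale `s_{4N}`: computed as for `s_N`, then each result is multiplied by `s_N/s_{4N}`.
    have h4 := HasFlops.realDFT_step n (fftScale_zero (2 ^ (m + 5))) (fftScale_zero (2 ^ (m + 3)))
      (fftScale_zero (2 ^ (m + 1))) (fftScale_ne_zero _) (fftScale_ne_zero _) (fftScale_ne_zero _)
      hU2 hP hα0 (β := 1) (fun k hk0 hk l hl => by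
        have heq : fftScale (2 ^ (m + 3)) k = fftScale (2 ^ (m + 3)) l := by
          rcases hl with rfl | rfl
          · rfl
          · exact (hs k (by omega)).symm
        rw [heq]
        exact mulCost_div_of_lt (fftScale_pos _ _) (hlt' l (by omega) (by omega)))
    -- The special frequencies `N/4` and `N/2` remain: they cost nothing for `s_N`, one
    -- multiplication for `s_{2N}` (which is `1` at `N/2` but not at `N/4`), three for `s_{4N}`.
    rw [hone _ dvd_rfl, hone _ ⟨2, by ring⟩, div_one, mulCost_one] at h1
    rw [div_self (fftScale_ne_zero _ _), mulCost_one,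
      mulCost_div_of_eq (fftScale_ne_zero (2 ^ (m + 4)) (4 * (n + 1)))
        ((fftScale_zero _).symm.trans ((hs' 0 (by omega)).symm.trans (by rw [Nat.sub_zero]))),
      mulCost_div_of_lt (fftScale_pos (2 ^ (m + 4)) (2 * (n + 1)))
        ((hlt _ (by omega) (by omega)).trans_le (fftScale_le_one _ _))] at h2
    rw [mulCost_div_of_lt (fftScale_pos (2 ^ (m + 5)) (2 * (n + 1)))
        (hlt' _ (by omega) (by omega)),
      mulCost_div_of_lt (fftScale_pos (2 ^ (m + 5)) (4 * (n + 1)))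
        ((hlt' _ (by omega) (by omega)).trans_le (fftScale_le_one _ _)),
      mulCost_div_of_lt (fftScale_pos (2 ^ (m + 5)) (2 * (n + 1)))
        ((hlt' _ (by omega) (by omega)).trans_le (fftScale_le_one _ _))] at h4
    rw [← p3] at h1 h2 h4
    refine ⟨_, _, _, ⟨h1, ?_⟩, ⟨h2, ?_⟩, h4, ?_⟩ <;>
      push_cast at ea' eb' ec' ⊢ <;>
      rw [ea', hnr] <;> first | rw [eb'] | rw [ec']
    all_goals ring

end FlopCount

/-! ### The stage of rotations -/

namespace LinearNetwork

/-- The matrix of the one-stage network `rotations`. -/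
def rotationMatrix (N : ℕ) (W : Fin N → Fin N → ℝ) : Matrix (Fin N) (Fin N) ℝ :=
  Matrix.of fun k j => if k = j ∨ (k : ℕ) + j = N then W k j else 0

theorem eval_rotations (N : ℕ) (W : Fin N → Fin N → ℝ) (x : Fin N → ℝ) :
    (rotations N W).eval x = rotationMatrix N W *ᵥ x := by
  classical
  funext k
  refine value_unique (rotations N W) x (Sum.elim x (rotationMatrix N W *ᵥ x)) (fun i => rfl) ?_
    (Sum.inr k)
  rintro (v | v) hv
  · exact absurd rfl (hv v)
  · show ∑ j, (if v = j ∨ (v : ℕ) + j = N then W v j else 0) * x j =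
      ∑ e : {e : Fin N × Fin N // e.1 = e.2 ∨ (e.1 : ℕ) + e.2 = N}, _
    have h := Finset.sum_subtype (F := Subtype.fintype _) (univ.filter fun e : Fin N × Fin N =>
      e.1 = e.2 ∨ (e.1 : ℕ) + e.2 = N) (p := fun e => e.1 = e.2 ∨ (e.1 : ℕ) + e.2 = N) (by simp)
      (fun e => if e.1 = v then W e.1 e.2 * x e.2 else 0)
    have h' : (∑ e ∈ univ.filter fun e : Fin N × Fin N => e.1 = e.2 ∨ (e.1 : ℕ) + e.2 = N,
        if e.1 = v then W e.1 e.2 * x e.2 else 0) =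
          ∑ j, (if v = j ∨ (v : ℕ) + j = N then W v j else 0) * x j := by
      rw [Finset.sum_filter, Fintype.sum_prod_type, Finset.sum_eq_single v]
      · refine Finset.sum_congr rfl fun j _ => ?_
        simp only [if_true, ite_mul, zero_mul]
      · intro b _ hb
        simp [hb]
      · simp
    rw [← h', h]
    simp only [rotations, Sum.inr.injEq, Sum.elim_inl]

/-- Each output has two incoming edges, except `0` and `N/2`, which have one. -/
theorem card_rotations_edges {N : ℕ} (hN : 2 ≤ N) (he : Even N) (W : Fin N → Fin N → ℝ) :
    Fintype.card (rotations N W).E + 2 = 2 * N := by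
  classical
  have h1 : Fintype.card (rotations N W).E =
      ∑ k : Fin N, (univ.filter fun j : Fin N => k = j ∨ (k : ℕ) + j = N).card := by
    show Fintype.card {e : Fin N × Fin N // e.1 = e.2 ∨ (e.1 : ℕ) + e.2 = N} = _
    rw [Fintype.card_subtype, Finset.card_filter, Fintype.sum_prod_type]
    simp only [Finset.card_filter]
  obtain ⟨h, rfl⟩ := he
  have h2 : ∀ k : Fin (h + h),
      (univ.filter fun j : Fin (h + h) => k = j ∨ (k : ℕ) + j = h + h).card +
        ((if (k : ℕ) = 0 then 1 else 0) + if (k : ℕ) = h then 1 else 0) = 2 := by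
    intro k
    by_cases hk0 : (k : ℕ) = 0
    · have : (univ.filter fun j : Fin (h + h) => k = j ∨ (k : ℕ) + j = h + h) = {k} := by
        ext j
        simp only [mem_filter, mem_univ, true_and, mem_singleton, Fin.ext_iff]
        omega
      rw [this, Finset.card_singleton, if_pos hk0, if_neg (by omega)]
    · by_cases hkh : (k : ℕ) = h
      · have : (univ.filter fun j : Fin (h + h) => k = j ∨ (k : ℕ) + j = h + h) = {k} := by
          ext j
          simp only [mem_filter, mem_univ, true_and, mem_singleton, Fin.ext_iff]
          omega
        rw [this, Finset.card_singleton, if_neg hk0, if_pos hkh]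
      · have : (univ.filter fun j : Fin (h + h) => k = j ∨ (k : ℕ) + j = h + h) =
            {k, ⟨h + h - k, by omega⟩} := by
          ext j
          simp only [mem_filter, mem_univ, true_and, mem_insert, mem_singleton, Fin.ext_iff]
          omega
        rw [this, Finset.card_pair (by simp only [ne_eq, Fin.ext_iff]; omega), if_neg hk0,
          if_neg hkh]
  have h3 := Finset.sum_congr (rfl : (univ : Finset (Fin (h + h))) = univ) fun k _ => h2 k
  have h4 : ∑ k : Fin (h + h), (if (k : ℕ) = 0 then 1 else 0) = 1 := by
    rw [Finset.sum_eq_single (⟨0, by omega⟩ : Fin (h + h))]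
    · simp
    · intro b _ hb
      exact if_neg fun hb0 => hb (Fin.ext hb0)
    · simp
  have h5 : ∑ k : Fin (h + h), (if (k : ℕ) = h then 1 else 0) = 1 := by
    rw [Finset.sum_eq_single (⟨h, by omega⟩ : Fin (h + h))]
    · simp
    · intro b _ hb
      exact if_neg fun hb0 => hb (Fin.ext hb0)
    · simp
  rw [Finset.sum_add_distrib, Finset.sum_add_distrib, h4, h5, ← h1] at h3
  simp only [Finset.sum_const, Finset.card_univ, Fintype.card_fin, smul_eq_mul] at h3
  omega

theorem card_rotations_vertices (N : ℕ) (W : Fin N → Fin N → ℝ) :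
    Fintype.card (rotations N W).V = N + N := by
  rw [show Fintype.card (rotations N W).V = Fintype.card (Fin N ⊕ Fin N) from rfl]
  simp

/-- `2N - 2` multiplications, one per edge, and `N - 2` additions. -/
theorem flops_rotations {N : ℕ} (hN : 2 ≤ N) (he : Even N) (W : Fin N → Fin N → ℝ)
    (hW : ∀ k j : Fin N, k = j ∨ (k : ℕ) + j = N → W k j ≠ 1 ∧ W k j ≠ -1) :
    (rotations N W).flops + 4 = 3 * N := by
  classical
  have h1 := card_rotations_edges hN he W
  have h2 := (rotations N W).numAdd_add_card
  rw [card_rotations_vertices] at h2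
  have h3 : (rotations N W).numMul = Fintype.card (rotations N W).E := by
    rw [numMul, ← Finset.card_univ, Finset.filter_true_of_mem]
    exact fun e _ => hW e.1.1 e.1.2 e.2
  rw [flops]
  omega

theorem numAdd_rotations (N : ℕ) (W W' : Fin N → Fin N → ℝ) :
    (rotations N W).numAdd = (rotations N W').numAdd :=
  Nat.add_right_cancel ((rotations N W).numAdd_add_card.trans
    (rotations N W').numAdd_add_card.symm)

theorem numMul_rotations_swap {N : ℕ} {W W' : Fin N → Fin N → ℝ}
    (h : ∀ k j : Fin N, k = j ∨ (k : ℕ) + j = N → W' j k = W k j) :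
    (rotations N W').numMul = (rotations N W).numMul := by
  classical
  rw [numMul_eq_sum, numMul_eq_sum]
  let e : {e : Fin N × Fin N // e.1 = e.2 ∨ (e.1 : ℕ) + e.2 = N} ≃
      {e : Fin N × Fin N // e.1 = e.2 ∨ (e.1 : ℕ) + e.2 = N} :=
    (Equiv.prodComm _ _).subtypeEquiv fun a => by
      simp only [Equiv.prodComm_apply, Prod.fst_swap, Prod.snd_swap, eq_comm, add_comm]
  refine Fintype.sum_equiv e _ _ fun a => ?_
  have ha : (rotations N W').weight a = (rotations N W).weight (e a) :=
    h a.1.2 a.1.1 (by rcases a.2 with h | h <;> [exact Or.inl h.symm; exact Or.inr (by omega)])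
  rw [ha]

end LinearNetwork

open LinearNetwork

theorem rotationMatrix_transpose {N : ℕ} {W W' : Fin N → Fin N → ℝ}
    (h : ∀ k j : Fin N, k = j ∨ (k : ℕ) + j = N → W' j k = W k j) :
    rotationMatrix N W' = (rotationMatrix N W)ᵀ := by
  ext j k
  simp only [rotationMatrix, Matrix.of_apply, Matrix.transpose_apply]
  by_cases hk : k = j ∨ (k : ℕ) + j = N
  · rw [if_pos hk, if_pos (by rcases hk with h | h <;> [exact Or.inl h.symm; exact Or.inr (by omega)]),
      h k j hk]
  · rw [if_neg hk, if_neg fun h' => hk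
      (by rcases h' with h | h <;> [exact Or.inl h.symm; exact Or.inr (by omega)])]

/-- The factor `d_l` is the conjugate of `c_l`, and `d (x - i y)` transposes the real and imaginary
part of `c Z`. -/
theorem dctIIICoeff_swap (N : ℕ) (k j : Fin N) (h : k = j ∨ (k : ℕ) + j = N) :
    dctIIICoeff N j k = dctIICoeff N k j := by
  have hd : ∀ l : ℕ, (2 : ℂ) * rootPow (4 * N) (-(l : ℤ)) * fftScale N l =
      (starRingEnd ℂ) (2 * rootPow (4 * N) (l : ℤ) * fftScale N l) := fun l => by
    rw [rootPow_neg, map_mul, map_mul, Complex.conj_ofReal, map_ofNat]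
  have hk := k.2
  have hj := j.2
  simp only [dctIIICoeff, dctIICoeff, hd]
  rcases h with rfl | h
  · split_ifs <;> simp
  · by_cases hkj : k = j
    · subst hkj
      split_ifs <;> simp
    · have hkj' : (k : ℕ) ≠ j := fun h => hkj (Fin.ext h)
      have e1 : N - (j : ℕ) = k := by omega
      have e2 : N - (k : ℕ) = j := by omega
      rw [e1, e2, if_neg (by omega), if_neg (by omega), if_neg (by omega : ¬ (k : ℕ) = 0),
        if_neg (by omega : ¬ 2 * (k : ℕ) = N), if_neg hkj, if_neg (Ne.symm hkj)]
      by_cases hlt : 2 * (k : ℕ) < N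
      · rw [if_pos hlt, if_neg (by omega)]
        simp [hkj]
      · rw [if_neg hlt, if_pos (by omega)]
        simp [Ne.symm hkj]

/-- Row `k` of a product with the matrix of the rotations. -/
theorem rotationMatrix_mul_apply {N : ℕ} (W : Fin N → Fin N → ℝ) (B : Matrix (Fin N) (Fin N) ℝ)
    (k i : Fin N) : (rotationMatrix N W * B) k i =
      if h : (k : ℕ) = 0 ∨ 2 * (k : ℕ) = N then W k k * B k i
      else W k k * B k i + W k ⟨N - k, by omega⟩ * B ⟨N - k, by omega⟩ i := by
  have hk := k.2
  rw [Matrix.mul_apply]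
  simp only [rotationMatrix, Matrix.of_apply, ite_mul, zero_mul]
  split_ifs with h
  · rw [Finset.sum_eq_single k]
    · rw [if_pos (Or.inl rfl)]
    · intro j _ hj
      have hj' : (j : ℕ) ≠ k := fun h => hj (Fin.ext h)
      exact if_neg (by rw [Fin.ext_iff]; omega)
    · simp
  · rw [← Finset.sum_subset (Finset.subset_univ {k, (⟨N - k, by omega⟩ : Fin N)}),
      Finset.sum_pair (by rw [ne_eq, Fin.ext_iff]; simp only; omega), if_pos (Or.inl rfl),
      if_pos (Or.inr (by simp only; omega))]
    intro j _ hj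
    simp only [mem_insert, mem_singleton, Fin.ext_iff] at hj
    exact if_neg (by rw [Fin.ext_iff]; omega)

/-! ### Correctness of the new DCT-II and DCT-III -/

/-- If `p` is the new position of `i`, then `4 p + 1` is `2 i + 1` for even `i` and `4N - (2 i + 1)`
for odd `i`. -/
theorem rootPow_evenOddPerm {N : ℕ} (i : Fin N) (k : ℕ) :
    rootPow (4 * N) k * rootPow N (((evenOddPerm N i : Fin N) : ℕ) * (k : ℤ)) =
      rootPow (4 * N) ((-1) ^ (i : ℕ) * ((2 * i + 1) * k)) := by
  have hN : 4 * N ≠ 0 := by have := i.2; omega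
  have hv : ((evenOddPerm N i : Fin N) : ℕ) =
      if (i : ℕ) % 2 = 0 then (i : ℕ) / 2 else N - 1 - (i : ℕ) / 2 := by
    rw [evenOddPerm, Equiv.ofBijective_apply]
    split_ifs <;> rfl
  rw [← rootPow_mul_mul (c := 4) (M := N) (by norm_num), ← rootPow_add]
  have hi := i.2
  rcases Nat.even_or_odd' (i : ℕ) with ⟨c, hc | hc⟩
  · rw [hv, if_pos (by omega), hc, Nat.mul_div_cancel_left c (by norm_num),
      (even_two_mul c).neg_one_pow]
    congr 1
    push_cast
    ring
  · rw [hv, if_neg (by omega), hc, show (2 * c + 1) / 2 = c by omega,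
      (odd_two_mul_add_one c).neg_one_pow,
      ← mul_one (rootPow (4 * N) (-1 * _)), ← rootPow_mul_self hN (k : ℤ), ← rootPow_add]
    congr 1
    push_cast [show c ≤ N - 1 by omega, show 1 ≤ N by omega]
    ring

theorem rootPow_evenOddPerm_re {N : ℕ} (i : Fin N) (k : ℕ) :
    (rootPow (4 * N) k * rootPow N (((evenOddPerm N i : Fin N) : ℕ) * (k : ℤ))).re =
      Real.cos (Real.pi / N * ((i : ℝ) + 1 / 2) * k) := by
  have hN : (N : ℝ) ≠ 0 := by have := i.2; exact_mod_cast (by omega : N ≠ 0)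
  rw [rootPow_evenOddPerm, rootPow_re]
  rcases Nat.even_or_odd (i : ℕ) with h | h
  · rw [h.neg_one_pow]
    congr 1
    push_cast
    field_simp
    ring
  · rw [h.neg_one_pow, ← Real.cos_neg]
    congr 1
    push_cast
    field_simp
    ring

/-- With `k = N - l` the angle becomes `iπ + (π/2 - φ)`, so the cosine is `(-1) ^ i sin φ`; this
sign matches the sign of the exponent in `rootPow_evenOddPerm`. -/
theorem rootPow_evenOddPerm_im {N : ℕ} (i : Fin N) {k l : ℕ} (h : k + l = N) :
    -(rootPow (4 * N) l * rootPow N (((evenOddPerm N i : Fin N) : ℕ) * (l : ℤ))).im =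
      Real.cos (Real.pi / N * ((i : ℝ) + 1 / 2) * k) := by
  have hN : (N : ℝ) ≠ 0 := by have := i.2; exact_mod_cast (by omega : N ≠ 0)
  have hk : (k : ℝ) = N - l := by
    rw [← h]
    push_cast
    ring
  have harg : Real.pi / N * ((i : ℝ) + 1 / 2) * k =
      (Real.pi / 2 - 2 * Real.pi * ((2 * i + 1) * l) / (4 * N)) + (i : ℕ) * Real.pi := by
    rw [hk]
    field_simp
    ring
  rw [harg, Real.cos_add_nat_mul_pi, Real.cos_pi_div_two_sub, rootPow_evenOddPerm, rootPow_im,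
    neg_neg]
  rcases Nat.even_or_odd (i : ℕ) with h | h
  · rw [h.neg_one_pow, h.neg_one_pow, one_mul, one_mul]
    push_cast
    rfl
  · rw [h.neg_one_pow, h.neg_one_pow, neg_one_mul, neg_one_mul, ← Real.sin_neg]
    push_cast
    congr 1
    ring

theorem fftScale_half {m k : ℕ} (h : 2 * k = 2 ^ m) : fftScale (2 ^ m) k = 1 := by
  rw [fftScale_symm m (b := 0) ⟨2, by omega⟩, fftScale_zero]

section dctIICoeff

variable {N : ℕ} {k j : Fin N}

theorem dctIICoeff_of_eq_zero (hk : (k : ℕ) = 0) : dctIICoeff N k j = 2 := if_pos hk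

theorem dctIICoeff_of_eq_half (hk0 : (k : ℕ) ≠ 0) (hk : 2 * (k : ℕ) = N) :
    dctIICoeff N k j = √2 := by
  simp only [dctIICoeff]
  rw [if_neg hk0, if_pos hk]

theorem dctIICoeff_low (hk0 : (k : ℕ) ≠ 0) (hk : 2 * (k : ℕ) < N) :
    dctIICoeff N k k = 2 * (rootPow (4 * N) (k : ℕ)).re * fftScale N k := by
  simp only [dctIICoeff]
  rw [if_neg hk0, if_neg hk.ne, if_pos hk, if_true, Complex.re_mul_ofReal, Complex.mul_re]
  simp

theorem dctIICoeff_low' (hk0 : (k : ℕ) ≠ 0) (hk : 2 * (k : ℕ) < N) (hj : (k : ℕ) + j = N) :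
    dctIICoeff N k j = -(2 * (rootPow (4 * N) (k : ℕ)).im * fftScale N k) := by
  simp only [dctIICoeff]
  rw [if_neg hk0, if_neg hk.ne, if_pos hk, if_neg (by rw [Fin.ext_iff]; omega),
    Complex.im_mul_ofReal, Complex.mul_im]
  simp

theorem dctIICoeff_high (hk : N < 2 * (k : ℕ)) {l : ℕ} (hl : (k : ℕ) + l = N) :
    dctIICoeff N k k = -(2 * (rootPow (4 * N) l).re * fftScale N l) := by
  simp only [dctIICoeff]
  rw [if_neg (by omega), if_neg hk.ne', if_neg (by omega), if_true, show N - (k : ℕ) = l by omega,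
    Complex.re_mul_ofReal, Complex.mul_re]
  simp

theorem dctIICoeff_high' (hk : N < 2 * (k : ℕ)) {l : ℕ} (hl : (k : ℕ) + l = N)
    (hj : (j : ℕ) = l) :
    dctIICoeff N k j = -(2 * (rootPow (4 * N) l).im * fftScale N l) := by
  simp only [dctIICoeff]
  rw [if_neg (by omega), if_neg hk.ne', if_neg (by omega), if_neg (by rw [Fin.ext_iff]; omega),
    show N - (k : ℕ) = l by omega, Complex.im_mul_ofReal, Complex.mul_im]
  simp

end dctIICoeff

theorem scaledRealDFT_low {N : ℕ} {j n : Fin N} {k : ℕ} (hj : (j : ℕ) = k) (hk : 2 * k ≤ N) :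
    scaledRealDFT N j n = (rootPow N ((n : ℕ) * (k : ℤ))).re / fftScale N k := by
  rw [scaledRealDFT, Matrix.of_apply, hj, if_pos hk]

theorem scaledRealDFT_high {N : ℕ} {j n : Fin N} {k : ℕ} (hj : (j : ℕ) + k = N) (hk : 2 * k < N) :
    scaledRealDFT N j n = (rootPow N ((n : ℕ) * (k : ℤ))).im / fftScale N k := by
  rw [scaledRealDFT, Matrix.of_apply, if_neg (by omega), show N - (j : ℕ) = k by omega]

theorem rotationMatrix_mul_scaledRealDFT (m : ℕ) :
    rotationMatrix (2 ^ m) (dctIICoeff (2 ^ m)) *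
      (scaledRealDFT (2 ^ m)).submatrix id (evenOddPerm (2 ^ m)) =
        dctII .unnormalized (2 ^ m) := by
  ext k i
  have hk := k.2
  rw [rotationMatrix_mul_apply]
  simp only [Matrix.submatrix_apply, id, dctII, Matrix.of_apply, Normalization.factor]
  by_cases hk0 : (k : ℕ) = 0
  · rw [dif_pos (Or.inl hk0), dctIICoeff_of_eq_zero hk0, scaledRealDFT_low hk0 (by omega), hk0,
      fftScale_zero]
    simp [rootPow_zero]
  by_cases hkh : 2 * (k : ℕ) = 2 ^ m
  · have hk' : ((k : ℕ) : ℝ) ≠ 0 := by exact_mod_cast hk0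
    have hkr : (2 : ℝ) ^ m = 2 * (k : ℕ) := by exact_mod_cast hkh.symm
    -- At `k = N/2` the power of `ω_N` is real and `ω_{4N}^k` has real part `√2/2`, which explains
    -- the coefficient `√2`.
    have him : (rootPow (2 ^ m) (((evenOddPerm (2 ^ m) i : Fin (2 ^ m)) : ℕ) *
        ((k : ℕ) : ℤ))).im = 0 := by
      rw [rootPow_im, neg_eq_zero]
      convert Real.sin_nat_mul_pi ((evenOddPerm (2 ^ m) i : Fin (2 ^ m)) : ℕ) using 2
      push_cast
      rw [hkr]
      field_simp
    have hre : (rootPow (4 * 2 ^ m) (k : ℕ)).re = √2 / 2 := by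
      rw [rootPow_re, ← Real.cos_pi_div_four]
      congr 1
      push_cast
      rw [hkr]
      field_simp
    rw [dif_pos (Or.inr hkh), dctIICoeff_of_eq_half hk0 hkh, scaledRealDFT_low rfl (by omega),
      fftScale_half hkh, ← rootPow_evenOddPerm_re i k, Complex.mul_re, him, hre]
    ring
  rw [dif_neg (by omega)]
  by_cases hlt : 2 * (k : ℕ) < 2 ^ m
  · have hs := fftScale_ne_zero (2 ^ m) k
    rw [dctIICoeff_low hk0 hlt, dctIICoeff_low' hk0 hlt (by simp only; omega),
      scaledRealDFT_low rfl hlt.le, scaledRealDFT_high (k := k) (by simp only; omega) hlt,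
      ← rootPow_evenOddPerm_re i k, Complex.mul_re]
    field_simp
    try ring
  · obtain ⟨l, hl⟩ : ∃ l, (k : ℕ) + l = 2 ^ m := ⟨2 ^ m - k, by omega⟩
    have hs := fftScale_ne_zero (2 ^ m) l
    rw [dctIICoeff_high (by omega) hl, dctIICoeff_high' (l := l) (by omega) hl
        (by simp only; omega), scaledRealDFT_high hl (by omega),
      scaledRealDFT_low (k := l) (by simp only; omega) (by omega),
      ← rootPow_evenOddPerm_im i hl, Complex.mul_im]
    field_simp
    try ring

/-! ### The relations between the transforms -/

theorem dctIII_eq_transpose (ν : Normalization) (N : ℕ) : dctIII ν N = (dctII ν N)ᵀ := by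
  ext k n
  simp only [dctIII, dctII, Matrix.transpose_apply, Matrix.of_apply]
  congr 2
  ring

theorem dstIII_eq_transpose (ν : Normalization) (N : ℕ) : dstIII ν N = (dstII ν N)ᵀ := by
  ext k n
  simp only [dstIII, dstII, Matrix.transpose_apply, Matrix.of_apply]
  congr 2
  ring

/-- Row `k.rev` has frequency `N - k`, and its angle is `nπ + (π/2 - φ)` for the DCT angle `φ`. The
exceptional unitary factor moves along: `N - k = N` iff `k = 0`. -/
theorem dstII_rev (ν : Normalization) (N : ℕ) (k n : Fin N) :
    dstII ν N k.rev n = (-1) ^ (n : ℕ) * dctII ν N k n := by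
  have hk := k.2
  have hN : (N : ℝ) ≠ 0 := by exact_mod_cast (by omega : N ≠ 0)
  have hrev : ((k.rev : Fin N) : ℕ) + 1 = N - k := by rw [Fin.val_rev]; omega
  have hcast : (((k.rev : Fin N) : ℕ) : ℝ) + 1 = N - k := by
    rw [← Nat.cast_sub hk.le, ← hrev]
    push_cast
    rfl
  have hfac : ν.factor N (N - k) N = ν.factor N k 0 := by
    cases ν
    · rfl
    · simp only [Normalization.factor]
      rw [if_congr (show N - (k : ℕ) = N ↔ (k : ℕ) = 0 by omega) rfl rfl]
  simp only [dstII, dctII, Matrix.of_apply]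
  rw [hrev, hfac, hcast]
  have harg : Real.pi / N * ((n : ℝ) + 1 / 2) * (N - k) =
      (Real.pi / 2 - Real.pi / N * ((n : ℝ) + 1 / 2) * k) + (n : ℕ) * Real.pi := by
    field_simp
    ring
  rw [harg, Real.sin_add_nat_mul_pi, Real.sin_pi_div_two_sub]
  ring

theorem dstII_mulVec_rev (ν : Normalization) (N : ℕ) (x : Fin N → ℝ) (k : Fin N) :
    (dstII ν N *ᵥ x) k.rev = (dctII ν N *ᵥ fun n => (-1) ^ (n : ℕ) * x n) k := by
  simp only [Matrix.mulVec, dotProduct, dstII_rev]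
  exact Finset.sum_congr rfl fun n _ => by ring

theorem dstIII_mulVec (ν : Normalization) (N : ℕ) (x : Fin N → ℝ) (k : Fin N) :
    (dstIII ν N *ᵥ x) k = (-1) ^ (k : ℕ) * (dctIII ν N *ᵥ fun n => x n.rev) k := by
  simp only [Matrix.mulVec, dotProduct, dstIII_eq_transpose, dctIII_eq_transpose,
    Matrix.transpose_apply, Finset.mul_sum]
  rw [← Equiv.sum_comp Fin.revPerm]
  refine Finset.sum_congr rfl fun n _ => ?_
  rw [Fin.revPerm_apply, dstII_rev, mul_assoc]

theorem flipOddInputs_reverseOutputs_computes_iff (ν : Normalization) {N : ℕ}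
    (G : LinearNetwork N N) :
    G.flipOddInputs.reverseOutputs.Computes (dstII ν N) ↔ G.Computes (dctII ν N) := by
  have hev : ∀ x : Fin N → ℝ, G.flipOddInputs.reverseOutputs.eval x =
      fun k => G.eval (fun i => (-1) ^ (i : ℕ) * x i) k.rev := fun x => by
    rw [reverseOutputs, eval_permuteOutputs, eval_flipOddInputs]
    rfl
  have hsq : ∀ x : Fin N → ℝ,
      (fun n : Fin N => (-1) ^ (n : ℕ) * ((-1) ^ (n : ℕ) * x n)) = x := fun x => by
    funext n
    rw [← mul_assoc, ← mul_pow]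
    norm_num
  constructor
  · intro h x
    funext k
    -- Sign flip and reversal are involutions, so feeding the flipped vector recovers `G` at `x`.
    have h1 := congrFun (h fun i => (-1) ^ (i : ℕ) * x i) k.rev
    rw [hev, dstII_mulVec_rev] at h1
    simpa only [Fin.rev_rev, hsq] using h1
  · intro h x
    funext k
    rw [hev, ← Fin.rev_rev k, dstII_mulVec_rev, Fin.rev_rev, ← h]

theorem reverseInputs_flipOddOutputs_computes_iff (ν : Normalization) {N : ℕ}
    (G : LinearNetwork N N) :
    G.reverseInputs.flipOddOutputs.Computes (dstIII ν N) ↔ G.Computes (dctIII ν N) := by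
  have hev : ∀ x : Fin N → ℝ, G.reverseInputs.flipOddOutputs.eval x =
      fun k : Fin N => (-1) ^ (k : ℕ) * G.eval (fun i => x i.rev) k := fun x => by
    rw [eval_flipOddOutputs, reverseInputs, eval_permuteInputs]
    rfl
  constructor
  · intro h x
    funext k
    have h1 := congrFun (h fun i => x i.rev) k
    rw [hev, dstIII_mulVec] at h1
    simp only [Fin.rev_rev] at h1
    exact mul_left_cancel₀ (pow_ne_zero _ (by norm_num)) h1
  · intro h x
    funext k
    rw [hev, dstIII_mulVec, ← h]

/-! ### The new algorithms with arbitrary normalization -/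

/-- The new DCT-II, with the normalization absorbed into the last stage. -/
noncomputable def normalizedDCTII (ν : Normalization) {N : ℕ} (R : LinearNetwork N N) :
    LinearNetwork N N :=
  (R.permuteInputs (evenOddPerm N)).andThen
    (rotations N fun k j => ν.factor N k 0 / 2 * dctIICoeff N k j)

theorem normalizedDCTII_unnormalized {N : ℕ} (R : LinearNetwork N N) :
    normalizedDCTII .unnormalized R = newDCTII R := by
  simp only [normalizedDCTII, newDCTII, Normalization.factor]
  congr
  norm_num

theorem normalizedDCTII_computes (ν : Normalization) {m : ℕ}
    {R : LinearNetwork (2 ^ m) (2 ^ m)} (hR : R.Computes (scaledRealDFT (2 ^ m))) :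
    (normalizedDCTII ν R).Computes (dctII ν (2 ^ m)) := by
  intro x
  have hx : scaledRealDFT (2 ^ m) *ᵥ (x ∘ (evenOddPerm (2 ^ m)).symm) =
      (scaledRealDFT (2 ^ m)).submatrix id (evenOddPerm (2 ^ m)) *ᵥ x :=
    (Matrix.submatrix_mulVec_equiv _ x id (evenOddPerm (2 ^ m))).symm
  rw [normalizedDCTII, eval_andThen, eval_permuteInputs, eval_rotations, hR, hx,
    Matrix.mulVec_mulVec]
  congr 1
  -- Normalization is a diagonal factor on the outputs, hence it merges into the last stage without
  -- new edges.
  have h : rotationMatrix (2 ^ m) (fun k j => ν.factor (2 ^ m) k 0 / 2 * dctIICoeff (2 ^ m) k j) =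
      Matrix.diagonal (fun k : Fin (2 ^ m) => ν.factor (2 ^ m) k 0 / 2) *
        rotationMatrix (2 ^ m) (dctIICoeff (2 ^ m)) := by
    ext k j
    rw [Matrix.diagonal_mul]
    simp only [rotationMatrix, Matrix.of_apply, mul_ite, mul_zero]
  rw [h, Matrix.mul_assoc, rotationMatrix_mul_scaledRealDFT]
  ext k n
  rw [Matrix.diagonal_mul]
  simp only [dctII, Matrix.of_apply, Normalization.factor]
  ring

theorem newDCTIII_computes {m : ℕ} {R : LinearNetwork (2 ^ m) (2 ^ m)}
    (hR : R.Computes (scaledRealDFT (2 ^ m))) :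
    (newDCTIII R).Computes (dctIII .unnormalized (2 ^ m)) := by
  intro x
  have hRt := (transpose_computes_iff R _).2 hR
  rw [newDCTIII, eval_permuteOutputs, eval_andThen, eval_rotations, hRt,
    rotationMatrix_transpose (dctIIICoeff_swap (2 ^ m)), dctIII_eq_transpose,
    ← rotationMatrix_mul_scaledRealDFT, Matrix.transpose_mul, Matrix.transpose_submatrix,
    ← Matrix.mulVec_mulVec]
  rfl

theorem numAdd_newDCTIII {N : ℕ} (R : LinearNetwork N N) :
    (newDCTIII R).numAdd = (newDCTII R).numAdd := by
  rw [newDCTIII, newDCTII, numAdd_permuteOutputs, numAdd_andThen, numAdd_andThen,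
    numAdd_transpose, numAdd_permuteInputs, numAdd_rotations N _ (dctIICoeff N), add_comm]

theorem numMul_newDCTIII {N : ℕ} (R : LinearNetwork N N) :
    (newDCTIII R).numMul = (newDCTII R).numMul := by
  rw [newDCTII, numMul_andThen]
  refine (numMul_andThen (rotations N (dctIIICoeff N)) R.transpose).trans ?_
  rw [numMul_rotations_swap (dctIIICoeff_swap N), add_comm]
  rfl

/-! ### The flop count -/

/-- The real parts are cosines already. For the imaginary parts, `sin(2πl/4N) = cos(2π(N-l)/4N)`,
and the scale factor is invariant under `l ↦ N - l`. -/
theorem exists_dctIICoeff_eq {m : ℕ} {k j : Fin (2 ^ m)} (hk0 : (k : ℕ) ≠ 0)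
    (hk : 2 * (k : ℕ) ≠ 2 ^ m) (hj : k = j ∨ (k : ℕ) + j = 2 ^ m) :
    ∃ l : ℕ, 0 < l ∧ l < 2 ^ m ∧
      (dctIICoeff (2 ^ m) k j =
          2 * Real.cos (2 * Real.pi * l / (2 ^ (m + 2) : ℕ)) * fftScale (2 ^ m) l ∨
        dctIICoeff (2 ^ m) k j =
          -(2 * Real.cos (2 * Real.pi * l / (2 ^ (m + 2) : ℕ)) * fftScale (2 ^ m) l)) := by
  have hkN := k.2
  have hpow : (2 ^ (m + 2) : ℕ) = 4 * 2 ^ m := by ring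
  rw [hpow]
  have hre : ∀ l : ℕ, (rootPow (4 * 2 ^ m) l).re =
      Real.cos (2 * Real.pi * l / (4 * 2 ^ m : ℕ)) := fun l => by
    rw [rootPow_re]
    push_cast
    rfl
  have him : ∀ l l' : ℕ, l' + l = 2 ^ m → -(2 * (rootPow (4 * 2 ^ m) l).im * fftScale (2 ^ m) l) =
      2 * Real.cos (2 * Real.pi * l' / (4 * 2 ^ m : ℕ)) * fftScale (2 ^ m) l' := fun l l' h => by
    have hsin := sin_eq_cos_of_add_eq (by positivity) h
    rw [rootPow_im, fftScale_symm m (a := l) (b := l') ⟨4, by rw [add_comm, h]; ring⟩]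
    push_cast at hsin ⊢
    rw [hsin]
    ring
  by_cases hlt : 2 * (k : ℕ) < 2 ^ m
  · rcases hj with rfl | hj
    · exact ⟨k, by omega, hkN, Or.inl (by rw [dctIICoeff_low hk0 hlt, hre])⟩
    · exact ⟨j, by omega, j.2, Or.inl (by
        rw [dctIICoeff_low' hk0 hlt hj, him k j (by omega)])⟩
  · rcases hj with rfl | hj
    · exact ⟨2 ^ m - k, by omega, by omega, Or.inr (by
        rw [dctIICoeff_high (l := 2 ^ m - k) (by omega) (by omega), hre])⟩
    · exact ⟨k, by omega, hkN, Or.inl (by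
        rw [dctIICoeff_high' (l := j) (by omega) hj rfl, him j k hj])⟩

/-- No multiplication of the last stage is saved. Without normalization the coefficients are `2`,
`√2` or irrational by `two_mul_cos_mul_fftScale_ne`; in the unitary case all of them have absolute
value below `1`. -/
theorem normalizedCoeff_ne (ν : Normalization) {m : ℕ} (hm : 1 ≤ m) (k j : Fin (2 ^ m))
    (hj : k = j ∨ (k : ℕ) + j = 2 ^ m) :
    ν.factor (2 ^ m) k 0 / 2 * dctIICoeff (2 ^ m) k j ≠ 1 ∧
      ν.factor (2 ^ m) k 0 / 2 * dctIICoeff (2 ^ m) k j ≠ -1 := by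
  have h2 : (1 : ℝ) < √2 := by
    rw [Real.lt_sqrt zero_le_one]
    norm_num
  have h22 : √2 * √2 = 2 := Real.mul_self_sqrt (by norm_num)
  have hsq2 : √2 < 2 := by nlinarith
  cases ν with
  | unnormalized =>
    simp only [Normalization.factor]
    rw [div_self two_ne_zero, one_mul]
    by_cases hk0 : (k : ℕ) = 0
    · rw [dctIICoeff_of_eq_zero hk0]
      norm_num
    by_cases hk : 2 * (k : ℕ) = 2 ^ m
    · rw [dctIICoeff_of_eq_half hk0 hk]
      exact ⟨h2.ne', by linarith⟩
    obtain ⟨l, hl0, hl, h⟩ := exists_dctIICoeff_eq hk0 hk hj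
    have h1 := two_mul_cos_mul_fftScale_ne hl0 hl 1
    have h1' := two_mul_cos_mul_fftScale_ne hl0 hl (-1)
    push_cast at h1 h1' h
    rcases h with h | h <;> rw [h]
    · exact ⟨h1, h1'⟩
    · exact ⟨fun h => h1' (by linarith), fun h => h1 (by linarith)⟩
  | unitary =>
    suffices h : |Normalization.unitary.factor (2 ^ m) k 0 / 2 * dctIICoeff (2 ^ m) k j| < 1 by
      rw [abs_lt] at h
      exact ⟨h.2.ne, h.1.ne'⟩
    have hN : (2 : ℝ) ≤ (2 ^ m : ℕ) := by
      push_cast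
      calc (2 : ℝ) = 2 ^ 1 := (pow_one 2).symm
        _ ≤ 2 ^ m := pow_le_pow_right₀ (by norm_num) hm
    simp only [Normalization.factor]
    by_cases hk0 : (k : ℕ) = 0
    · rw [dctIICoeff_of_eq_zero hk0, if_pos hk0, div_mul_cancel₀ _ two_ne_zero,
        abs_of_nonneg (Real.sqrt_nonneg _), Real.sqrt_lt' one_pos, div_lt_iff₀ (by linarith)]
      linarith
    rw [if_neg hk0, sub_zero]
    have hs : √(2 / (2 ^ m : ℕ)) ≤ 1 := by
      rw [Real.sqrt_le_left zero_le_one, one_pow, div_le_one (by linarith)]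
      exact hN
    have hs0 := Real.sqrt_nonneg (2 / (2 ^ m : ℕ) : ℝ)
    by_cases hk : 2 * (k : ℕ) = 2 ^ m
    · rw [dctIICoeff_of_eq_half hk0 hk, abs_of_nonneg (by positivity)]
      nlinarith
    obtain ⟨l, hl0, hl, h⟩ := exists_dctIICoeff_eq hk0 hk hj
    have hlr : (0 : ℝ) < l := by exact_mod_cast hl0
    have hlN : (l : ℝ) < 2 ^ m := by exact_mod_cast hl
    have hpi := Real.pi_pos
    have harg0 : 0 < 2 * Real.pi * l / (2 ^ (m + 2) : ℕ) := by positivity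
    have harg1 : 2 * Real.pi * l / (2 ^ (m + 2) : ℕ) < Real.pi / 2 := by
      push_cast
      rw [pow_add, div_lt_iff₀ (by positivity)]
      nlinarith
    have hc0 := Real.cos_pos_of_mem_Ioo ⟨by linarith, harg1⟩
    have hc1 : Real.cos (2 * Real.pi * l / (2 ^ (m + 2) : ℕ)) < 1 := by
      rw [← Real.cos_zero]
      exact Real.cos_lt_cos_of_nonneg_of_le_pi_div_two le_rfl harg1.le harg0
    have hf0 := fftScale_pos (2 ^ m) l
    have hf1 := fftScale_le_one (2 ^ m) l
    have habs : |dctIICoeff (2 ^ m) k j| =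
        2 * Real.cos (2 * Real.pi * l / (2 ^ (m + 2) : ℕ)) * fftScale (2 ^ m) l := by
      rcases h with h | h <;> rw [h]
      · exact abs_of_pos (by positivity)
      · rw [abs_neg]
        exact abs_of_pos (by positivity)
    rw [abs_mul, habs, abs_of_nonneg (by positivity)]
    have hcf : Real.cos (2 * Real.pi * l / (2 ^ (m + 2) : ℕ)) * fftScale (2 ^ m) l < 1 :=
      mul_lt_one_of_nonneg_of_lt_one_left hc0.le hc1 hf1
    have hcf0 := mul_pos hc0 hf0
    nlinarith

theorem flops_normalizedDCTII (ν : Normalization) {m : ℕ} (hm : 1 ≤ m)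
    (R : LinearNetwork (2 ^ m) (2 ^ m)) :
    (normalizedDCTII ν R).flops + 4 = R.flops + 3 * 2 ^ m := by
  have h := flops_rotations (Nat.one_lt_two_pow (by omega) : 1 < 2 ^ m)
    (even_two.pow_of_ne_zero (by omega)) _ (normalizedCoeff_ne ν hm)
  rw [normalizedDCTII, flops_andThen, flops_permuteInputs]
  omega

/-- The split-radix network for the scaled discrete Fourier transform of real numbers. -/
theorem exists_scaledRealDFT_network {m : ℕ} (hm : 1 ≤ m) :
    ∃ R : LinearNetwork (2 ^ m) (2 ^ m), R.Computes (scaledRealDFT (2 ^ m)) ∧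
      ∀ ν : Normalization, ((normalizedDCTII ν R).flops : ℝ) = newDCTFlops m := by
  obtain ⟨n, rfl⟩ : ∃ n, m = n + 1 := ⟨m - 1, by omega⟩
  obtain ⟨a, -, -, ⟨ha, hae⟩, -⟩ := HasFlops.realDFT_two_pow n
  obtain ⟨R, hR, hRa⟩ := ha.exists_network
  refine ⟨R, fun x => ?_, fun ν => ?_⟩
  · rw [hR, scaledRealDFT_mulVec]
  -- The constants combine as `-98/27 + 3 = -17/27` and `11/2 - 4 = 3/2`; the same `R` serves both
  -- normalizations.
  · have h := flops_normalizedDCTII ν hm R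
    rw [hRa] at h
    have h' : ((normalizedDCTII ν R).flops : ℝ) + 4 = a + 3 * 2 ^ (n + 1) := by exact_mod_cast h
    rw [eq_sub_of_add_eq h', hae, newDCTFlops]
    push_cast
    ring

theorem flops_newDCTIII {N : ℕ} (R : LinearNetwork N N) :
    (newDCTIII R).flops = (newDCTII R).flops := by
  rw [flops, flops, numAdd_newDCTIII, numMul_newDCTIII]

theorem flops_flipOddInputs_reverseOutputs {N : ℕ} (G : LinearNetwork N N) :
    G.flipOddInputs.reverseOutputs.flops = G.flops := by
  rw [reverseOutputs, flops_permuteOutputs, flops, flops, numAdd_flipOddInputs,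
    numMul_flipOddInputs]

theorem flops_reverseInputs_flipOddOutputs {N : ℕ} (G : LinearNetwork N N) :
    G.reverseInputs.flipOddOutputs.flops = G.flops := by
  rw [flops, numAdd_flipOddOutputs, numMul_flipOddOutputs]
  exact flops_permuteInputs G _

theorem mainTheorem4 :
    -- network transposition computes the transposed matrix, at the same cost if there are as many
    -- outputs as inputs
    (∀ (p q : ℕ) (G : LinearNetwork p q) (A : Matrix (Fin q) (Fin p) ℝ),
      G.transpose.Computes Aᵀ ↔ G.Computes A) ∧
    (∀ (p q : ℕ) (G : LinearNetwork p q), G.transpose.numMul = G.numMul) ∧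
    (∀ (N : ℕ) (G : LinearNetwork N N), G.transpose.numAdd = G.numAdd) ∧
    -- the relations between the four transforms
    (∀ (ν : Normalization) (N : ℕ),
      dctIII ν N = (dctII ν N)ᵀ ∧ dstIII ν N = (dstII ν N)ᵀ) ∧
    (∀ (N : ℕ) (x : Fin N → ℝ) (k : Fin N),
      (dstII .unnormalized N *ᵥ x) k.rev =
        2 * ∑ n : Fin N, (-1) ^ (n : ℕ) * x n *
          Real.cos (Real.pi / N * ((n : ℝ) + 1 / 2) * (k : ℝ)) ∧
      (dstIII .unnormalized N *ᵥ x) k =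
        (-1) ^ (k : ℕ) * (2 * ∑ n : Fin N, x n.rev *
          Real.cos (Real.pi / N * (n : ℝ) * ((k : ℝ) + 1 / 2)))) ∧
    -- any algorithm for one of the transforms gives algorithms for the others at the same cost
    (∀ (ν : Normalization) (N : ℕ) (G : LinearNetwork N N),
      (G.transpose.Computes (dctIII ν N) ↔ G.Computes (dctII ν N)) ∧
      (G.flipOddInputs.reverseOutputs.Computes (dstII ν N) ↔ G.Computes (dctII ν N)) ∧
      (G.transpose.Computes (dstIII ν N) ↔ G.Computes (dstII ν N)) ∧
      (G.reverseInputs.flipOddOutputs.Computes (dstIII ν N) ↔ G.Computes (dctIII ν N))) ∧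
    (∀ (N : ℕ) (G : LinearNetwork N N),
      G.flipOddInputs.reverseOutputs.numAdd = G.numAdd ∧
      G.flipOddInputs.reverseOutputs.numMul = G.numMul ∧
      G.reverseInputs.flipOddOutputs.numAdd = G.numAdd ∧
      G.reverseInputs.flipOddOutputs.numMul = G.numMul) ∧
    -- the new DCT-II and DCT-III algorithms are correct and have the same cost
    (∀ (m : ℕ), 1 ≤ m → ∀ R : LinearNetwork (2 ^ m) (2 ^ m),
      R.Computes (scaledRealDFT (2 ^ m)) →
        (newDCTII R).Computes (dctII .unnormalized (2 ^ m)) ∧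
        (newDCTIII R).Computes (dctIII .unnormalized (2 ^ m)) ∧
        (newDCTIII R).numAdd = (newDCTII R).numAdd ∧
        (newDCTIII R).numMul = (newDCTII R).numMul) ∧
    -- the flop count, attained with a suitable network for the scaled DFT of real inputs
    (∀ (m : ℕ), 1 ≤ m → ∃ R : LinearNetwork (2 ^ m) (2 ^ m),
      R.Computes (scaledRealDFT (2 ^ m)) ∧
      ((newDCTII R).flops : ℝ) = newDCTFlops m ∧
      ((newDCTIII R).flops : ℝ) = newDCTFlops m) ∧
    -- the flop count for all four transforms, in both normalizations
    (∀ (ν : Normalization) (m : ℕ), 1 ≤ m → ∃ G : LinearNetwork (2 ^ m) (2 ^ m),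
      (G.Computes (dctII ν (2 ^ m)) ∧ (G.flops : ℝ) = newDCTFlops m) ∧
      (G.transpose.Computes (dctIII ν (2 ^ m)) ∧ (G.transpose.flops : ℝ) = newDCTFlops m) ∧
      (G.flipOddInputs.reverseOutputs.Computes (dstII ν (2 ^ m)) ∧
        (G.flipOddInputs.reverseOutputs.flops : ℝ) = newDCTFlops m) ∧
      (G.flipOddInputs.reverseOutputs.transpose.Computes (dstIII ν (2 ^ m)) ∧
        (G.flipOddInputs.reverseOutputs.transpose.flops : ℝ) = newDCTFlops m) ∧
      (G.transpose.reverseInputs.flipOddOutputs.Computes (dstIII ν (2 ^ m)) ∧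
        (G.transpose.reverseInputs.flipOddOutputs.flops : ℝ) = newDCTFlops m)) := by
  refine ⟨fun p q G A => transpose_computes_iff G A, fun p q G => numMul_transpose G,
    fun N G => numAdd_transpose G, fun ν N => ⟨dctIII_eq_transpose ν N, dstIII_eq_transpose ν N⟩,
    fun N x k => ⟨?_, ?_⟩, fun ν N G => ⟨?_, flipOddInputs_reverseOutputs_computes_iff ν G, ?_,
      reverseInputs_flipOddOutputs_computes_iff ν G⟩,
    fun N G => ⟨?_, numMul_flipOddInputs G, ?_, ?_⟩,
    fun m _ R hR => ⟨?_, newDCTIII_computes hR, numAdd_newDCTIII R, numMul_newDCTIII R⟩,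
    fun m hm => ?_, fun ν m hm => ?_⟩
  · rw [dstII_mulVec_rev]
    simp only [Matrix.mulVec, dotProduct, dctII, Matrix.of_apply, Normalization.factor,
      Finset.mul_sum]
    exact Finset.sum_congr rfl fun n _ => by ring
  · rw [dstIII_mulVec]
    simp only [Matrix.mulVec, dotProduct, dctIII, Matrix.of_apply, Normalization.factor,
      Finset.mul_sum]
    exact Finset.sum_congr rfl fun n _ => by ring
  · rw [dctIII_eq_transpose]
    exact transpose_computes_iff G _
  · rw [dstIII_eq_transpose]
    exact transpose_computes_iff G _
  · exact (numAdd_permuteOutputs G.flipOddInputs _).trans (numAdd_flipOddInputs G)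
  · exact (numAdd_flipOddOutputs G.reverseInputs).trans (numAdd_permuteInputs G _)
  · exact numMul_flipOddOutputs G.reverseInputs
  · rw [← normalizedDCTII_unnormalized]
    exact normalizedDCTII_computes _ hR
  · obtain ⟨R, hR, hflops⟩ := exists_scaledRealDFT_network hm
    have h := hflops .unnormalized
    rw [normalizedDCTII_unnormalized] at h
    exact ⟨R, hR, h, by rw [flops_newDCTIII, h]⟩
  · obtain ⟨R, hR, hflops⟩ := exists_scaledRealDFT_network hm
    have hG := normalizedDCTII_computes ν hR
    have h := hflops ν
    set G := normalizedDCTII ν R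
    have hT : G.transpose.Computes (dctIII ν (2 ^ m)) := by
      rw [dctIII_eq_transpose]
      exact hG.transpose
    have hS := (flipOddInputs_reverseOutputs_computes_iff ν G).2 hG
    refine ⟨G, ⟨hG, h⟩, ⟨hT, by rw [flops_transpose, h]⟩,
      ⟨hS, by rw [flops_flipOddInputs_reverseOutputs, h]⟩, ⟨?_, ?_⟩,
      ⟨(reverseInputs_flipOddOutputs_computes_iff ν _).2 hT, ?_⟩⟩
    · rw [dstIII_eq_transpose]
      exact hS.transpose
    · rw [flops_transpose, flops_flipOddInputs_reverseOutputs, h]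
    · rw [flops_reverseInputs_flipOddOutputs, flops_transpose, h]
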